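/- Let $N\ge 1$, $\alpha\in\mathbb R$, $\mu>0$. Let $L^2(\mathcal G)=\bigoplus_{j=1}^N L^2(\mathbb R^+)$ and $H^k(\mathcal G)=\bigoplus_{j=1}^N H^k(\mathbb R^+)$, $k=1,2$, (functions on the star graph $\mathcal G$ with $N$ half-lines), and write $\Psi=(\psi_1,\dots,\psi_N)$, $|\Psi|^{2\mu}\Psi=(|\psi_1|^{2\mu}\psi_1,\dots,|\psi_N|^{2\mu}\psi_N)$. Let $H$ be the operator on $L^2(\mathcal G)$ given by $(H\Psi)_j=-\psi_j''$ on the domain $$\mathcal D(H)=\Big\{\Psi\in H^2(\mathcal G):\ \psi_1(0)=\dots=\psi_N(0),\ \sum_{j=1}^N\psi_j'(0)=\alpha\,\psi_1(0)\Big\}.$$ Let $\mathcal E=\{\Psi\in H^1(\mathcal G):\psi_1(0)=\dots=\psi_N(0)\}$ with the norm $\|\Psi\|_{\mathcal E}^2=\sum_{j}\big(\|\psi_j\|_{L^2}^2+\|\psi_j'\|_{L^2}^2\big)$, and let $\mathcal E^\star$ be the dual of $\mathcal E$, into which $\mathcal E$ is embedded by $\Psi\mapsto(\Psi,\cdot)_{L^2(\mathcal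 G)}$. Then $-iH$ generates a strongly continuous unitary group $e^{-iHt}$ on $L^2(\mathcal G)$. For $\Psi_0\in\mathcal E$ and $0<T\le\infty$, a solution on $[0,T)$ is a $\Psi\in C^0([0,T),\mathcal E)\cap C^1([0,T),\mathcal E^\star)$ with $$\Psi_t=e^{-iHt}\Psi_0+i\int_0^t e^{-iH(t-s)}|\Psi_s|^{2\mu}\Psi_s\,ds\qquad\text{for all }t\in[0,T).$$ **Local well-posedness.** For every $\Psi_0\in\mathcal E$ there is $T>0$ such that there is exactly one solution on $[0,T)$. Moreover, there is a maximal solution $\Psi^{\max}$, defined on an interval $[0,T^\star)$ with $0<T^\star\le\infty$: every solution on an interval $[0,T)$, $0<T\le\infty$, satisfies $T\le T^\star$ and coincides with $\Psi^{\max}$ on $[0,T)$. Either $T^\star=\infty$ or $\lim_{t\to T^\star}\|\Psi^{\max}_t\|_{\mathcal E}=+\infty$. **Global well-posedness.** If $0<\mu<2$, then for every $\Psi_0\in\mathcal E$ there is exactly one solution on $[0,\infty)$. -/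

import Mathlib

open MeasureTheory Set Filter Topology
open scoped ContDiff ENNReal

namespace StarGraphNLS

noncomputable section

/-! ## Function spaces on the half-line and on the star graph -/

/-- Lebesgue measure on the half-line `(0, ∞)`. -/
abbrev halfLine : Measure ℝ := volume.restrict (Ioi (0 : ℝ))

/-- The complex Hilbert space `L²(ℝ⁺)`. -/
abbrev L2Half : Type := Lp ℂ 2 halfLine

/-- `L²(𝒢) = ⨁ⱼ L²(ℝ⁺)`, with norm `‖Ψ‖² = ∑ⱼ ‖ψⱼ‖²`. -/
abbrev L2Graph (N : ℕ) : Type := PiLp 2 (fun _ : Fin N => L2Half)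

/-- `g` is the weak derivative of `f` on the open half-line `(0, ∞)`. -/
def IsWeakDeriv (f g : L2Half) : Prop :=
  ∀ φ : ℝ → ℝ, ContDiff ℝ ∞ φ → HasCompactSupport φ → tsupport φ ⊆ Ioi 0 →
    ∫ x, ((deriv φ x : ℝ) : ℂ) * f x ∂halfLine = -∫ x, ((φ x : ℝ) : ℂ) * g x ∂halfLine

/-- `f` has a representative that is continuous on `[0, ∞)` and takes the value `c` at `0`.
For `f ∈ H¹(ℝ⁺)` this says that the boundary value `f(0)` is `c`. -/
def HasBoundaryValue (f : L2Half) (c : ℂ) : Prop :=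
  ∃ u : ℝ → ℂ, ContinuousOn u (Ici 0) ∧ f =ᵐ[halfLine] u ∧ u 0 = c

theorem integrable_test_mul {χ : ℝ → ℝ} (hc : Continuous χ) (hs : HasCompactSupport χ)
    (f : L2Half) : Integrable (fun x => ((χ x : ℝ) : ℂ) * f x) halfLine := by
  have h1 : MemLp (fun x => ((χ x : ℝ) : ℂ)) 2 halfLine := by
    have : MemLp χ 2 halfLine := (hc.memLp_of_hasCompactSupport hs)
    exact this.ofReal
  exact h1.integrable_mul (Lp.memLp f)

theorem IsWeakDeriv.add {f g f' g' : L2Half} (hf : IsWeakDeriv f f') (hg : IsWeakDeriv g g') :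
    IsWeakDeriv (f + g) (f' + g') := by
  intro φ h1 h2 h3
  have hd : Continuous (deriv φ) := h1.continuous_deriv (by simp)
  have e1 : ∫ x, ((deriv φ x : ℝ) : ℂ) * (f + g : L2Half) x ∂halfLine
      = ∫ x, (((deriv φ x : ℝ) : ℂ) * f x + ((deriv φ x : ℝ) : ℂ) * g x) ∂halfLine := by
    refine integral_congr_ae ?_
    filter_upwards [Lp.coeFn_add f g] with x hx
    rw [hx, Pi.add_apply, mul_add]
  have e2 : ∫ x, ((φ x : ℝ) : ℂ) * (f' + g' : L2Half) x ∂halfLine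
      = ∫ x, (((φ x : ℝ) : ℂ) * f' x + ((φ x : ℝ) : ℂ) * g' x) ∂halfLine := by
    refine integral_congr_ae ?_
    filter_upwards [Lp.coeFn_add f' g'] with x hx
    rw [hx, Pi.add_apply, mul_add]
  rw [e1, e2, integral_add (integrable_test_mul hd h2.deriv f) (integrable_test_mul hd h2.deriv g),
    integral_add (integrable_test_mul h1.continuous h2 f') (integrable_test_mul h1.continuous h2 g'),
    hf φ h1 h2 h3, hg φ h1 h2 h3]
  ring

theorem IsWeakDeriv.smul {f f' : L2Half} (a : ℂ) (hf : IsWeakDeriv f f') :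
    IsWeakDeriv (a • f) (a • f') := by
  intro φ h1 h2 h3
  have e1 : ∫ x, ((deriv φ x : ℝ) : ℂ) * (a • f : L2Half) x ∂halfLine
      = ∫ x, a * (((deriv φ x : ℝ) : ℂ) * f x) ∂halfLine := by
    refine integral_congr_ae ?_
    filter_upwards [Lp.coeFn_smul a f] with x hx
    rw [hx, Pi.smul_apply, smul_eq_mul]; ring
  have e2 : ∫ x, ((φ x : ℝ) : ℂ) * (a • f' : L2Half) x ∂halfLine
      = ∫ x, a * (((φ x : ℝ) : ℂ) * f' x) ∂halfLine := by
    refine integral_congr_ae ?_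
    filter_upwards [Lp.coeFn_smul a f'] with x hx
    rw [hx, Pi.smul_apply, smul_eq_mul]; ring
  rw [e1, e2, integral_const_mul, integral_const_mul, hf φ h1 h2 h3]
  ring

theorem IsWeakDeriv.zero : IsWeakDeriv 0 0 := by
  have h (χ : ℝ → ℝ) : ∫ x, ((χ x : ℝ) : ℂ) * (0 : L2Half) x ∂halfLine = 0 := by
    refine integral_eq_zero_of_ae ?_
    filter_upwards [Lp.coeFn_zero ℂ 2 halfLine] with x hx
    rw [hx]; simp
  intro φ _ _ _
  rw [h, h, neg_zero]

theorem HasBoundaryValue.add {f g : L2Half} {a b : ℂ} (hf : HasBoundaryValue f a)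
    (hg : HasBoundaryValue g b) : HasBoundaryValue (f + g) (a + b) := by
  obtain ⟨u, hu, hfu, hu0⟩ := hf
  obtain ⟨v, hv, hgv, hv0⟩ := hg
  refine ⟨fun x => u x + v x, hu.add hv, ?_, by simp [hu0, hv0]⟩
  filter_upwards [Lp.coeFn_add f g, hfu, hgv] with x h1 h2 h3
  rw [h1, Pi.add_apply, h2, h3]

theorem HasBoundaryValue.smul {f : L2Half} {c : ℂ} (a : ℂ) (hf : HasBoundaryValue f c) :
    HasBoundaryValue (a • f) (a * c) := by
  obtain ⟨u, hu, hfu, hu0⟩ := hf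
  refine ⟨fun x => a * u x, continuousOn_const.mul hu, ?_, by simp [hu0]⟩
  filter_upwards [Lp.coeFn_smul a f, hfu] with x h1 h2
  rw [h1, Pi.smul_apply, h2, smul_eq_mul]

theorem HasBoundaryValue.zero : HasBoundaryValue 0 0 :=
  ⟨fun _ => 0, continuousOn_const, Lp.coeFn_zero ℂ 2 halfLine, rfl⟩

/-- `H¹(ℝ⁺)`, realised as the space of pairs `(ψ, ψ')` in `L² × L²` with `ψ'` the weak derivative
of `ψ`; the inherited norm is the `H¹` norm, `‖ψ‖²_{H¹} = ‖ψ‖² + ‖ψ'‖²`. -/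
def H1Half : Submodule ℂ (WithLp 2 (L2Half × L2Half)) where
  carrier := {p | IsWeakDeriv p.fst p.snd}
  add_mem' := fun h h' => IsWeakDeriv.add h h'
  zero_mem' := IsWeakDeriv.zero
  smul_mem' := fun a _ h => IsWeakDeriv.smul a h

/-- `H¹(𝒢) = ⨁ⱼ H¹(ℝ⁺)`, with norm `‖Ψ‖²_{H¹} = ∑ⱼ ‖ψⱼ‖²_{H¹}`. -/
abbrev H1Graph (N : ℕ) : Type := PiLp 2 (fun _ : Fin N => H1Half)

/-- The energy space `ℰ = {Ψ ∈ H¹(𝒢) : ψ₁(0) = … = ψ_N(0)}`, as a subspace of `H¹(𝒢)`. -/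
def energySpace (N : ℕ) : Submodule ℂ (H1Graph N) where
  carrier := {Ψ | ∃ c : ℂ, ∀ j, HasBoundaryValue (Ψ j : WithLp 2 (L2Half × L2Half)).fst c}
  add_mem' := fun ⟨a, ha⟩ ⟨b, hb⟩ => ⟨a + b, fun j => (ha j).add (hb j)⟩
  zero_mem' := ⟨0, fun _ => HasBoundaryValue.zero⟩
  smul_mem' := fun a _ ⟨c, hc⟩ => ⟨a * c, fun j => (hc j).smul a⟩

/-- The energy space `ℰ` with the `H¹` norm. -/
abbrev Energy (N : ℕ) : Type := energySpace N

/-- The inclusion `ℰ ↪ L²(𝒢)`. -/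
def toL2 (N : ℕ) : Energy N →L[ℂ] L2Graph N :=
  (PiLp.continuousLinearEquiv 2 ℂ (fun _ : Fin N => L2Half)).symm.toContinuousLinearMap ∘L
    ContinuousLinearMap.pi (fun j =>
      WithLp.fstL 2 ℂ L2Half L2Half ∘L H1Half.subtypeL ∘L
        PiLp.proj 2 (fun _ : Fin N => H1Half) j ∘L (energySpace N).subtypeL)

/-- The embedding `ℰ ↪ ℰ*` given by the `L²` pairing: `⟨Ψ, Φ⟩ = (Ψ, Φ)_{L²(𝒢)}` (the scalar product
is antilinear in its first argument, so each `⟨Ψ, ·⟩` is a continuous linear functional). -/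
def toDual (N : ℕ) (Ψ : Energy N) : StrongDual ℂ (Energy N) :=
  (innerSL ℂ (toL2 N Ψ)) ∘L toL2 N

/-! ## The Hamiltonian with a `δ` vertex and its unitary group -/

/-- The graph of the Hamiltonian `H`: `Ψ ∈ 𝒟(H)` and `H Ψ = Θ`. The domain consists of the
`Ψ ∈ H²(𝒢)` with `ψ₁(0) = … = ψ_N(0)` and `∑ⱼ ψⱼ'(0) = α ψ₁(0)`, and `(H Ψ)ⱼ = -ψⱼ''`. -/
def HamiltonianGraph (N : ℕ) (α : ℝ) (Ψ Θ : L2Graph N) : Prop :=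
  ∃ (Ψ' Ψ'' : L2Graph N) (c : ℂ) (d : Fin N → ℂ),
    (∀ j, IsWeakDeriv (Ψ j) (Ψ' j)) ∧ (∀ j, IsWeakDeriv (Ψ' j) (Ψ'' j)) ∧
    (∀ j, HasBoundaryValue (Ψ j) c) ∧ (∀ j, HasBoundaryValue (Ψ' j) (d j)) ∧
    ∑ j, d j = (α : ℂ) * c ∧ Θ = -Ψ''

/-- `U` is the unitary group `t ↦ e^{-iHt}`: a strongly continuous one-parameter group of
isometries of `L²(𝒢)` whose infinitesimal generator, domain included, is `-iH`. -/
structure IsUnitaryGroup (N : ℕ) (α : ℝ) (U : ℝ → L2Graph N →L[ℂ] L2Graph N) : Prop where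
  map_zero : U 0 = ContinuousLinearMap.id ℂ (L2Graph N)
  map_add : ∀ s t, U (s + t) = U s ∘L U t
  norm_map : ∀ t Ψ, ‖U t Ψ‖ = ‖Ψ‖
  continuous : ∀ Ψ, Continuous fun t => U t Ψ
  generator : ∀ Ψ Θ, HamiltonianGraph N α Ψ Θ ↔
    HasDerivAt (fun t => U t Ψ) (-(Complex.I • Θ)) 0

open Classical in
/-- The propagator `e^{-iHt}`, i.e. the unitary group generated by `-iH`. (A group is determined
by its generator, so there is at most one; the alternative `0` is a formality.) -/
def propagator (N : ℕ) (α : ℝ) : ℝ → L2Graph N →L[ℂ] L2Graph N :=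
  if h : ∃ U, IsUnitaryGroup N α U then h.choose else 0

/-! ## The nonlinearity and the Duhamel equation -/

open Classical in
/-- The function `|ψ|^{2μ} ψ` on the half-line, as an element of `L²(ℝ⁺)` (with the value `0` if it
is not square integrable, which does not occur for `ψ ∈ H¹(ℝ⁺)`). -/
def powerHalf (μ : ℝ) (ψ : L2Half) : L2Half :=
  if h : MemLp (fun x => ((‖ψ x‖ ^ (2 * μ) : ℝ) : ℂ) * ψ x) 2 halfLine then h.toLp else 0

/-- The nonlinear term `|Ψ|^{2μ} Ψ`, acting componentwise. -/
def power (N : ℕ) (μ : ℝ) (Ψ : L2Graph N) : L2Graph N :=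
  WithLp.toLp 2 (fun j => powerHalf μ (Ψ j))

/-- The interval `[0, T)` for `T ∈ [-∞, ∞]`. -/
def timeInterval (T : EReal) : Set ℝ := {t | 0 ≤ t ∧ (t : EReal) < T}

/-- `Ψ ∈ C⁰([0,T), ℰ) ∩ C¹([0,T), ℰ*)` solves, for all `t ∈ [0,T)`,
`Ψ_t = e^{-iHt} Ψ₀ + i ∫₀ᵗ e^{-iH(t-s)} |Ψ_s|^{2μ} Ψ_s ds`. Only the values of `Ψ` on `[0,T)`
matter. -/
structure IsSolution (N : ℕ) (α μ : ℝ) (Ψ₀ : Energy N) (T : EReal) (Ψ : ℝ → Energy N) :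
    Prop where
  continuousOn : ContinuousOn Ψ (timeInterval T)
  contDiffOn : ContDiffOn ℝ 1 (fun t => toDual N (Ψ t)) (timeInterval T)
  duhamel : ∀ t ∈ timeInterval T,
    toL2 N (Ψ t) = propagator N α t (toL2 N Ψ₀) +
      Complex.I • ∫ s in (0 : ℝ)..t, propagator N α (t - s) (power N μ (toL2 N (Ψ s)))

end

end StarGraphNLS

/-! The linear part is handled through the form `q(u,v) = ∑ⱼ (uⱼ',vⱼ') + α conj(u(0)) v(0)` on `ℰ`.
The trace bound `|u(0)|² ≤ 2(‖u‖²/h + h‖u'‖²)` with small `h` makes `q + m` coercive for a suitable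
shift `m`, so Lax–Milgram gives a solution operator `S : L² → ℰ`. With `J : ℰ → L²` the inclusion,
integration by parts identifies `G = J S` with `(H + m)⁻¹` (`hamiltonianGraph_iff_eq`). This `G` is
bounded, self-adjoint and injective, and `z ↦ z e^{-it/z}` is continuous on the real line; the
bounded functional calculus therefore yields `e^{-itG⁻¹} G`, and `e^{-itG⁻¹}` follows by isometric
extension from the dense range of `G` (`exists_unitaryGroup`). A scalar phase removes `m`. The group
commutes with `G`, hence preserves the form, hence restricts to a bounded strongly continuous group
`V` on `ℰ` (`IsFormGroup.exists_restricted`).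

In the interaction picture `u(t) = V(-t) Ψ(t)` the Duhamel formula becomes an integral equation in
`ℰ` with field `V(-t) i F(V(t) u)`, where `F(u) = |u|^{2μ} u`. The difficulty is that `z ↦ |z|^{2μ}
z` is only `C¹`: for `μ < 1/2` its derivative is not Lipschitz near `0`, so a contraction in `ℰ` is
not available. Two weaker facts hold on bounded sets of `ℰ` (`H1Half.comp_estimates`): `F` is
Lipschitz in the `L²` norm, and it is Lipschitz in `ℰ` up to an error that is small when the `L²`
distance is small, because `L²`-closeness of `H¹`-bounded functions forces uniform closeness. Picard
iterates contract in `L²` first, and are then Cauchy in `ℰ` (`IsAdmissibleField.exists_local`).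
Gronwall in `L²` gives uniqueness. The existence time depends only on a bound for the data, which
gives the blow-up alternative. Continuity into `ℰ*` of the time derivative comes for free, since `S
J Ψ` is `C¹` with values in `ℰ`.

Global existence rests on conservation of mass and energy. Both are proved without regularising the
data: the mass and the quadratic part of the energy are differentiated along `u`, which is
differentiable in `ℰ`, and the potential part along `Ψ`, where the Taylor error is quadratic in the
`L²` norm and therefore controlled by the differentiability of `S J Ψ`. The Gagliardo–Nirenberg
bound of the potential by `C ‖Ψ‖_{L²}^{μ+2} ‖Ψ‖_ℰ^μ` is beaten by the quadratic part exactly when `μ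
< 2`. -/

namespace StarGraphNLS

/-! ## The unitary group generated by the inverse of a bounded self-adjoint operator -/

section UnitaryGroup

/-- The function `z ↦ z e^{-it/z}`, whose value at a bounded self-adjoint operator `G` is
`e^{-itG⁻¹} G`. -/
noncomputable def phaseMul (t : ℝ) (z : ℂ) : ℂ := z * Complex.exp (-(Complex.I * t / z))

theorem phaseMul_mul (t s : ℝ) (z : ℂ) : phaseMul t z * phaseMul s z = z * phaseMul (t + s) z := by
  simp only [phaseMul]
  rw [mul_mul_mul_comm, ← Complex.exp_add, mul_assoc]
  congr 3
  push_cast; ring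

theorem norm_exp_neg_I_mul_div (t x : ℝ) : ‖Complex.exp (-(Complex.I * t / (x : ℂ)))‖ = 1 := by
  have : -(Complex.I * t / (x : ℂ)) = ((-(t / x) : ℝ) : ℂ) * Complex.I := by push_cast; ring
  rw [this, Complex.norm_exp_ofReal_mul_I]

theorem norm_phaseMul_ofReal (t x : ℝ) : ‖phaseMul t (x : ℂ)‖ = |x| := by
  simp [phaseMul, norm_exp_neg_I_mul_div]

/-- On the real axis the exponential has modulus one, so the value at `x` has modulus `|x|` and
tends to `0` at the origin. Off the axis there is an essential singularity, so the restriction to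
real points matters. -/
theorem continuousOn_phaseMul (t : ℝ) : ContinuousOn (phaseMul t) (range ((↑) : ℝ → ℂ)) := by
  rintro _ ⟨x, rfl⟩
  by_cases hx : x = 0
  · subst hx
    have h0 : phaseMul t ((0 : ℝ) : ℂ) = 0 := by simp [phaseMul]
    rw [ContinuousWithinAt, h0, tendsto_zero_iff_norm_tendsto_zero]
    have h1 : Tendsto (fun z : ℂ => ‖z‖) (𝓝[range ((↑) : ℝ → ℂ)] ((0 : ℝ) : ℂ)) (𝓝 0) := by
      have : Tendsto (fun z : ℂ => ‖z‖) (𝓝 ((0 : ℝ) : ℂ)) (𝓝 ‖((0 : ℝ) : ℂ)‖) :=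
        continuous_norm.tendsto _
      simpa using this.mono_left nhdsWithin_le_nhds
    refine h1.congr' ?_
    filter_upwards [self_mem_nhdsWithin] with z hz
    obtain ⟨y, rfl⟩ := hz
    rw [norm_phaseMul_ofReal, Complex.norm_real, Real.norm_eq_abs]
  · have hx' : (x : ℂ) ≠ 0 := by exact_mod_cast hx
    have : ContinuousAt (phaseMul t) (x : ℂ) := by
      unfold phaseMul
      fun_prop (disch := exact hx')
    exact this.continuousWithinAt

/-- The factor `x` cancels the `1/x` in the phase, so the bound is uniform over the spectrum and
becomes an operator norm bound. -/
theorem norm_phaseMul_sub_le (t s x : ℝ) :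
    ‖phaseMul t (x : ℂ) - phaseMul s (x : ℂ)‖ ≤ |t - s| := by
  by_cases hx : x = 0
  · simp [hx, phaseMul]
  have e : phaseMul t (x : ℂ) - phaseMul s (x : ℂ)
      = x * Complex.exp (-(Complex.I * s / (x : ℂ)))
        * (Complex.exp (Complex.I * ((-((t - s) / x) : ℝ) : ℂ)) - 1) := by
    simp only [phaseMul]
    rw [mul_sub, mul_one, mul_assoc, ← Complex.exp_add]
    congr 3
    push_cast
    ring
  rw [e, norm_mul, norm_mul, norm_exp_neg_I_mul_div, mul_one, Complex.norm_real, Real.norm_eq_abs]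
  calc |x| * ‖Complex.exp (Complex.I * ((-((t - s) / x) : ℝ) : ℂ)) - 1‖
      ≤ |x| * ‖-((t - s) / x)‖ := by
        gcongr; exact Real.norm_exp_I_mul_ofReal_sub_one_le
    _ = |t - s| := by
        rw [norm_neg, Real.norm_eq_abs, abs_div]; field_simp

/-- No smallness of `θ` may be assumed, since it will be `-t/x` with `x` near `0`. Taylor's bound
covers `|θ| ≤ 1`; beyond that the crude bound `2|θ|` is already below `3θ²`. -/
theorem norm_exp_sub_one_sub_id_le (θ : ℝ) :
    ‖Complex.exp (Complex.I * θ) - 1 - Complex.I * θ‖ ≤ 3 * θ ^ 2 := by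
  have hn : ‖Complex.I * (θ : ℂ)‖ = |θ| := by simp
  by_cases h : |θ| ≤ 1
  · have := Complex.norm_exp_sub_one_sub_id_le (x := Complex.I * θ) (by rw [hn]; exact h)
    rw [hn, sq_abs] at this
    nlinarith [sq_nonneg θ]
  · push Not at h
    calc ‖Complex.exp (Complex.I * θ) - 1 - Complex.I * θ‖
        ≤ ‖Complex.exp (Complex.I * θ) - 1‖ + ‖Complex.I * (θ : ℂ)‖ := norm_sub_le _ _
      _ ≤ |θ| + |θ| := by
          gcongr
          · exact Real.norm_exp_I_mul_ofReal_sub_one_le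
          · exact hn.le
      _ ≤ 3 * θ ^ 2 := by nlinarith [sq_abs θ]

theorem norm_mul_phaseMul_sub_le (t x : ℝ) :
    ‖(x : ℂ) * phaseMul t x - x * x + Complex.I * t * x‖ ≤ 3 * t ^ 2 := by
  by_cases hx : x = 0
  · simp [hx]; positivity
  have hx' : (x : ℂ) ≠ 0 := by exact_mod_cast hx
  have e : (x : ℂ) * phaseMul t x - x * x + Complex.I * t * x
      = x * x * (Complex.exp (Complex.I * ((-(t / x) : ℝ) : ℂ)) - 1
        - Complex.I * ((-(t / x) : ℝ) : ℂ)) := by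
    simp only [phaseMul]
    have : Complex.I * ((-(t / x) : ℝ) : ℂ) = -(Complex.I * t / (x : ℂ)) := by push_cast; ring
    rw [this]
    field_simp
    ring
  rw [e, norm_mul, norm_mul, Complex.norm_real, Real.norm_eq_abs, abs_mul_abs_self]
  calc x * x * _ ≤ x * x * (3 * (-(t / x)) ^ 2) := by
        have := mul_self_nonneg x
        gcongr
        exact norm_exp_sub_one_sub_id_le _
    _ = 3 * t ^ 2 := by field_simp

variable {Y : Type*} [NormedAddCommGroup Y] [InnerProductSpace ℂ Y] [CompleteSpace Y]

/-- Here `V t` stands for `e^{-itG⁻¹} G`, obtained from the continuous functional calculus. Each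
clause is a scalar identity or estimate on the real spectrum of `G`; the last one is the derivative
of `e^{-itG⁻¹}` at `0`, tested on the range of `G²`. -/
theorem exists_group_aux (G : Y →L[ℂ] Y) (hG : IsSelfAdjoint G) :
    ∃ V : ℝ → Y →L[ℂ] Y, V 0 = G ∧ (∀ t s, V t ∘L V s = G ∘L V (t + s)) ∧
      (∀ t, V t ∘L G = G ∘L V t) ∧ (∀ t y, ‖V t y‖ = ‖G y‖) ∧
      (∀ t s, ‖V t - V s‖ ≤ |t - s|) ∧
      (∀ t : ℝ, ‖G ∘L V t - G ∘L G + (Complex.I * t) • G‖ ≤ 3 * t ^ 2) := by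
  have hn : IsStarNormal G := hG.isStarNormal
  have hspec : spectrum ℂ G ⊆ range ((↑) : ℝ → ℂ) := fun z hz =>
    ⟨z.re, (hG.mem_spectrum_eq_re hz).symm⟩
  have hc : ∀ t, ContinuousOn (phaseMul t) (spectrum ℂ G) := fun t =>
    (continuousOn_phaseMul t).mono hspec
  have hmul : ∀ t, G * cfc (phaseMul t) G = cfc (fun z => z * phaseMul t z) G := by
    intro t
    rw [cfc_mul (fun z => z) (phaseMul t) G continuousOn_id (hc t), cfc_id' ℂ G]
  refine ⟨fun t => cfc (phaseMul t) G, ?_, ?_, ?_, ?_, ?_, ?_⟩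
  · have : phaseMul 0 = id := by ext z; simp [phaseMul]
    simp only [this, cfc_id ℂ G]
  · intro t s
    change cfc (phaseMul t) G * cfc (phaseMul s) G = G * cfc (phaseMul (t + s)) G
    rw [hmul, ← cfc_mul _ _ G (hc t) (hc s)]
    congr 1
    ext z
    exact phaseMul_mul t s z
  · intro t
    change cfc (phaseMul t) G * G = G * cfc (phaseMul t) G
    have := (cfc_commute_cfc (phaseMul t) (fun z => z) G).eq
    rwa [cfc_id' ℂ G] at this
  · intro t y
    have h1 : star (cfc (phaseMul t) G) * cfc (phaseMul t) G = G * G := by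
      rw [← cfc_star, ← cfc_mul _ _ G (hc t).star (hc t)]
      have : G * G = cfc (fun z : ℂ => z * z) G := by
        rw [cfc_mul (fun z => z) (fun z => z) G continuousOn_id continuousOn_id, cfc_id' ℂ G]
      rw [this]
      refine cfc_congr fun z hz => ?_
      obtain ⟨x, rfl⟩ := hspec hz
      have h := norm_phaseMul_ofReal t x
      simp only [RCLike.star_def]
      rw [mul_comm, Complex.mul_conj, Complex.normSq_eq_norm_sq, h, sq_abs]
      push_cast; ring
    have h2 : ∀ A : Y →L[ℂ] Y, (‖A y‖ : ℂ) ^ 2 = inner ℂ ((star A * A) y) y := by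
      intro A
      rw [ContinuousLinearMap.star_eq_adjoint, mul_apply_eq_comp,
        ContinuousLinearMap.adjoint_inner_left, inner_self_eq_norm_sq_to_K]
      rfl
    have h3 := h2 (cfc (phaseMul t) G)
    rw [h1] at h3
    have h4 := h2 G
    rw [hG.star_eq, ← h3] at h4
    have h5 : ‖G y‖ ^ 2 = ‖cfc (phaseMul t) G y‖ ^ 2 := by exact_mod_cast h4
    exact ((sq_eq_sq₀ (norm_nonneg _) (norm_nonneg _)).1 h5).symm
  · intro t s
    change ‖cfc (phaseMul t) G - cfc (phaseMul s) G‖ ≤ _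
    rw [← cfc_sub _ _ G (hc t) (hc s)]
    refine norm_cfc_le (abs_nonneg _) fun z hz => ?_
    obtain ⟨x, rfl⟩ := hspec hz
    exact norm_phaseMul_sub_le t s x
  · intro t
    change ‖G * cfc (phaseMul t) G - G * G + (Complex.I * t) • G‖ ≤ _
    have e : G * cfc (phaseMul t) G - G * G + (Complex.I * t) • G
        = cfc (fun z : ℂ => z * phaseMul t z - z * z + Complex.I * t * z) G := by
      have hct := hc t
      rw [cfc_add (a := G) (fun z : ℂ => z * phaseMul t z - z * z) (fun z => Complex.I * t * z),
        cfc_sub (a := G) (fun z : ℂ => z * phaseMul t z) (fun z => z * z), hmul,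
        cfc_mul (fun z => z) (fun z => z) G, cfc_const_mul_id _ G, cfc_id' ℂ G]
    rw [e]
    refine norm_cfc_le (by positivity) fun z hz => ?_
    obtain ⟨x, rfl⟩ := hspec hz
    exact norm_mul_phaseMul_sub_le t x

/-- If `v` is orthogonal to the range, then `0 = ⟨G(Gv), v⟩ = ‖Gv‖²`, and injectivity gives `v = 0`.
-/
theorem denseRange_of_isSelfAdjoint {G : Y →L[ℂ] Y} (hG : IsSelfAdjoint G)
    (hinj : Function.Injective G) : DenseRange G := by
  have h : (LinearMap.range (G : Y →ₗ[ℂ] Y))ᗮ = ⊥ := by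
    rw [eq_bot_iff]
    intro v hv
    have h1 : inner ℂ (G (G v)) v = 0 := (Submodule.mem_orthogonal _ _).1 hv _ ⟨G v, rfl⟩
    have h2 : inner ℂ (G v) (G v) = (0 : ℂ) := by
      rw [← h1]
      exact (((ContinuousLinearMap.isSelfAdjoint_iff_isSymmetric).1 hG) (G v) v).symm
    rw [inner_self_eq_zero] at h2
    exact hinj (by simpa using h2)
  have h' := Submodule.topologicalClosure_eq_top_iff.2 h
  intro y
  have : y ∈ (LinearMap.range (G : Y →ₗ[ℂ] Y)).topologicalClosure := by rw [h']; trivial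
  exact this

/-- For an injective bounded self-adjoint `G`, the unitary group `e^{-itG⁻¹}`. -/
theorem exists_unitaryGroup (G : Y →L[ℂ] Y) (hG : IsSelfAdjoint G) (hinj : Function.Injective G) :
    ∃ U : ℝ → Y →L[ℂ] Y, U 0 = ContinuousLinearMap.id ℂ Y ∧ (∀ s t, U (s + t) = U s ∘L U t) ∧
      (∀ t y, ‖U t y‖ = ‖y‖) ∧ (∀ y, Continuous fun t => U t y) ∧
      (∀ t y, U t (G y) = G (U t y)) ∧
      (∀ y, HasDerivAt (fun t => U t (G y)) (-(Complex.I • y)) 0) := by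
  obtain ⟨V, hV0, hVV, hVG, hVn, hVl, hVd⟩ := exists_group_aux G hG
  have hd := denseRange_of_isSelfAdjoint hG hinj
  have hb : ∀ t, ∀ y, ‖(V t : Y →ₗ[ℂ] Y) y‖ ≤ 1 * ‖(G : Y →ₗ[ℂ] Y) y‖ := fun t y => by
    simpa using (hVn t y).le
  -- Since `‖V t y‖ = ‖G y‖`, the assignment `G y ↦ V t y` is isometric and extends from the dense
  -- range of `G`.
  let U : ℝ → Y →L[ℂ] Y := fun t => (V t : Y →ₗ[ℂ] Y).extendOfNorm (G : Y →ₗ[ℂ] Y)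
  have hU : ∀ t y, U t (G y) = V t y := fun t y =>
    LinearMap.extendOfNorm_eq (f := (V t : Y →ₗ[ℂ] Y)) (e := (G : Y →ₗ[ℂ] Y)) hd ⟨1, hb t⟩ y
  have hUn : ∀ t y, ‖U t y‖ = ‖y‖ := by
    intro t y
    refine congrFun (hd.equalizer (f := G) (g := fun y => ‖U t y‖) (h := fun y => ‖y‖)
      (by fun_prop) (by fun_prop) ?_) y
    ext y
    simp [hU, hVn]
  have hUG : ∀ t y, U t (G y) = G (U t y) := by
    intro t y
    refine congrFun (hd.equalizer (f := G) (g := fun y => U t (G y)) (h := fun y => G (U t y))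
      (by fun_prop) (by fun_prop) ?_) y
    ext y
    simp only [Function.comp_apply, hU]
    exact congrArg (fun A : Y →L[ℂ] Y => A y) (hVG t)
  have hUc : ∀ y, Continuous fun t => U t y := by
    intro y
    refine Metric.continuous_iff.2 fun t ε hε => ?_
    obtain ⟨x, hx⟩ := hd.exists_dist_lt y (ε := ε / 3) (by positivity)
    refine ⟨ε / (3 * (‖x‖ + 1)), by positivity, fun s hs => ?_⟩
    rw [dist_eq_norm] at hx ⊢
    have e : U s y - U t y = U s (y - G x) - U t (y - G x) + (V s - V t) x := by
      simp only [map_sub, hU, sub_apply]; abel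
    have h1 : ‖(V s - V t) x‖ ≤ |s - t| * ‖x‖ :=
      ((V s - V t).le_opNorm x).trans (by gcongr; exact hVl s t)
    have h2 : |s - t| * ‖x‖ ≤ ε / 3 := by
      rw [Real.dist_eq] at hs
      calc |s - t| * ‖x‖ ≤ ε / (3 * (‖x‖ + 1)) * (‖x‖ + 1) := by gcongr; linarith
        _ = ε / 3 := by field_simp
    calc ‖U s y - U t y‖ ≤ ‖U s (y - G x)‖ + ‖U t (y - G x)‖ + ‖(V s - V t) x‖ := by
          rw [e]; exact (norm_add_le _ _).trans (by gcongr; exact norm_sub_le _ _)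
      _ < ε := by rw [hUn, hUn]; linarith
  refine ⟨U, ?_, ?_, hUn, hUc, hUG, ?_⟩
  · refine ContinuousLinearMap.ext fun y => ?_
    refine congrFun (hd.equalizer (f := G) (g := fun y => U 0 y) (h := fun y => y)
      (by fun_prop) (by fun_prop) ?_) y
    ext y
    simp [hU, hV0]
  · intro s t
    refine ContinuousLinearMap.ext fun y => ?_
    refine congrFun (hd.equalizer (f := G) (g := fun y => U (s + t) y)
      (h := fun y => U s (U t y)) (by fun_prop) (by fun_prop) ?_) y
    ext y
    -- The relation between `V s ∘ V t` and `V (s + t)` carries an extra factor `G`, which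
    -- injectivity removes.
    refine hinj ?_
    simp only [Function.comp_apply, hU]
    rw [← hUG, hU]
    exact (congrArg (fun A : Y →L[ℂ] Y => A y) (hVV s t)).symm
  · intro y
    rw [hasDerivAt_iff_isLittleO_nhds_zero, Asymptotics.isLittleO_iff]
    intro ε hε
    obtain ⟨x, hx⟩ := hd.exists_dist_lt y (ε := ε / 4) (by positivity)
    rw [dist_eq_norm] at hx
    have hev : ∀ᶠ h : ℝ in 𝓝 0, |h| < ε / (6 * (‖x‖ + 1)) :=
      Metric.eventually_nhds_iff.2
        ⟨ε / (6 * (‖x‖ + 1)), by positivity, fun h hh => by rwa [Real.dist_eq, sub_zero] at hh⟩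
    filter_upwards [hev] with h hh
    have hU0 : U 0 (G y) = G y := by rw [hU, hV0]
    rw [zero_add, hU0]
    -- With `y` approximated by `G x`, the remainder at `y - G x` is at most `2|h|‖y - G x‖`, and
    -- the remainder at `G x` is quadratic in `h`.
    have e : U h (G y) - G y - h • -(Complex.I • y)
        = (V h - V 0) (y - G x) + (Complex.I * h) • (y - G x)
          + (G ∘L V h - G ∘L G + (Complex.I * h) • G) x := by
      simp only [sub_apply, add_apply, map_sub, hV0,
        ContinuousLinearMap.comp_apply, smul_apply]
      rw [show G (V h x) = V h (G x) from
        (congrArg (fun A : Y →L[ℂ] Y => A x) (hVG h)).symm, hU]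
      have : h • -(Complex.I • y) = -((Complex.I * h) • y) := by
        rw [smul_neg, mul_comm, mul_smul, Complex.coe_smul]
      rw [this, smul_sub]
      abel
    have h1 : ‖(V h - V 0) (y - G x)‖ ≤ |h| * ‖y - G x‖ :=
      ((V h - V 0).le_opNorm _).trans (by gcongr; simpa using hVl h 0)
    have h2 : ‖(Complex.I * (h : ℂ)) • (y - G x)‖ = |h| * ‖y - G x‖ := by
      rw [norm_smul, norm_mul]; simp
    have h3 : ‖(G ∘L V h - G ∘L G + (Complex.I * h) • G) x‖ ≤ 3 * h ^ 2 * ‖x‖ :=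
      (ContinuousLinearMap.le_opNorm _ _).trans (by gcongr; exact hVd h)
    have h4 : 3 * h ^ 2 * ‖x‖ ≤ ε / 2 * |h| := by
      have : |h| * (6 * (‖x‖ + 1)) < ε := (lt_div_iff₀ (by positivity)).1 hh
      rw [← sq_abs h]
      nlinarith [abs_nonneg h, norm_nonneg x, mul_nonneg (abs_nonneg h) (abs_nonneg h)]
    calc ‖U h (G y) - G y - h • -(Complex.I • y)‖
        ≤ |h| * ‖y - G x‖ + |h| * ‖y - G x‖ + 3 * h ^ 2 * ‖x‖ := by
          rw [e]
          refine (norm_add_le _ _).trans (add_le_add ((norm_add_le _ _).trans ?_) h3)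
          rw [h2]; gcongr
      _ ≤ |h| * (ε / 4) + |h| * (ε / 4) + ε / 2 * |h| := by gcongr
      _ = ε * ‖h‖ := by rw [Real.norm_eq_abs]; ring

end UnitaryGroup

/-! ## Integral equations with a field that is Lipschitz only in a weaker norm -/

section IntegralEquation

set_option linter.unusedSectionVars false

variable {E Y : Type*} [NormedAddCommGroup E] [NormedSpace ℝ E]
  [NormedAddCommGroup Y] [NormedSpace ℝ Y]

/-- A time-dependent vector field that is bounded and continuous, Lipschitz on bounded sets in the
weak norm `‖J ·‖`, and Lipschitz on bounded sets up to an error controlled by the weak norm. -/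
structure IsAdmissibleField (J : E →L[ℝ] Y) (f : ℝ → E → E) : Prop where
  continuous : Continuous fun p : ℝ × E => f p.1 p.2
  bound : ∀ M : ℝ, ∃ L : ℝ, ∀ t u, ‖u‖ ≤ M → ‖f t u‖ ≤ L
  weakLipschitz : ∀ M : ℝ, ∃ L : ℝ, ∀ t u v, ‖u‖ ≤ M → ‖v‖ ≤ M →
    ‖J (f t u) - J (f t v)‖ ≤ L * ‖J u - J v‖
  almostLipschitz : ∀ M : ℝ, ∃ L : ℝ, ∀ ε > 0, ∃ δ > 0, ∀ t u v, ‖u‖ ≤ M → ‖v‖ ≤ M →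
    ‖J u - J v‖ ≤ δ → ‖f t u - f t v‖ ≤ L * ‖u - v‖ + ε

/-- `u` is a continuous solution on `[0, T)` of `u t = u₀ + ∫₀ᵗ f s (u s) ds`. -/
structure IsIntegralSolution (f : ℝ → E → E) (u₀ : E) (T : EReal) (u : ℝ → E) : Prop where
  continuousOn : ContinuousOn u (timeInterval T)
  eq : ∀ t ∈ timeInterval T, u t = u₀ + ∫ s in (0 : ℝ)..t, f s (u s)

theorem mem_timeInterval_coe {T t : ℝ} : t ∈ timeInterval (T : EReal) ↔ t ∈ Ico 0 T := by
  simp [timeInterval]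

theorem Icc_subset_timeInterval {T : EReal} {t : ℝ} (ht : t ∈ timeInterval T) :
    Icc 0 t ⊆ timeInterval T := fun _ hs =>
  ⟨hs.1, (EReal.coe_le_coe_iff.2 hs.2).trans_lt ht.2⟩

theorem timeInterval_mono {T T' : EReal} (h : T ≤ T') : timeInterval T ⊆ timeInterval T' :=
  fun _ ht => ⟨ht.1, ht.2.trans_le h⟩

theorem timeInterval_mem_nhdsWithin {T T' : EReal} {t : ℝ} (ht : t ∈ timeInterval T) :
    timeInterval T ∈ 𝓝[timeInterval T'] t := by
  have h1 : {s : ℝ | (s : EReal) < T} ∈ 𝓝 t :=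
    (isOpen_Iio.preimage continuous_coe_real_ereal).mem_nhds ht.2
  filter_upwards [mem_nhdsWithin_of_mem_nhds h1, self_mem_nhdsWithin] with s hs hs'
  exact ⟨hs'.1, hs⟩

variable {J : E →L[ℝ] Y} {f : ℝ → E → E}

theorem IsAdmissibleField.continuousOn_comp (hf : IsAdmissibleField J f) {u : ℝ → E} {s : Set ℝ}
    (hu : ContinuousOn u s) : ContinuousOn (fun t => f t (u t)) s :=
  hf.continuous.comp_continuousOn (continuousOn_id.prodMk hu)

theorem IsAdmissibleField.intervalIntegrable (hf : IsAdmissibleField J f) {u : ℝ → E} {a b : ℝ}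
    (hab : a ≤ b) (hu : ContinuousOn u (Icc a b)) :
    IntervalIntegrable (fun t => f t (u t)) volume a b :=
  (hf.continuousOn_comp hu).intervalIntegrable_of_Icc hab

variable [CompleteSpace E] [CompleteSpace Y]

theorem exists_bound_Icc {u : ℝ → E} {a b : ℝ} (hu : ContinuousOn u (Icc a b)) :
    ∃ M, ∀ t ∈ Icc a b, ‖u t‖ ≤ M := by
  obtain ⟨M, hM⟩ := isCompact_Icc.exists_bound_of_continuousOn hu
  exact ⟨M, hM⟩

/-- Picard iteration. -/
noncomputable def picardIter (f : ℝ → E → E) (t₀ : ℝ) (u₀ : E) : ℕ → ℝ → E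
  | 0 => fun _ => u₀
  | n + 1 => fun t => u₀ + ∫ s in t₀..t, f s (picardIter f t₀ u₀ n s)

theorem IsAdmissibleField.continuous_picardIter (hf : IsAdmissibleField J f) (t₀ : ℝ) (u₀ : E)
    (n : ℕ) : Continuous (picardIter f t₀ u₀ n) := by
  induction n with
  | zero => exact continuous_const
  | succ n ih =>
    have h : Continuous fun s => f s (picardIter f t₀ u₀ n s) :=
      hf.continuous.comp (continuous_id.prodMk ih)
    exact continuous_const.add
      (intervalIntegral.continuous_primitive (fun a b => h.intervalIntegrable a b) t₀)

/-- The Picard iterates contract in the weak norm. Once they are weakly close, the almost-Lipschitz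
bound is a contraction in `E` up to `ε`, so they are uniformly Cauchy in `E`. The step `δ` depends
only on `M`, which is what continuation needs. -/
theorem IsAdmissibleField.exists_local (hf : IsAdmissibleField J f) (M : ℝ) :
    ∃ δ > 0, ∀ (t₀ : ℝ) (u₀ : E), ‖u₀‖ ≤ M → ∃ u : ℝ → E,
      ContinuousOn u (Icc t₀ (t₀ + δ)) ∧
        ∀ t ∈ Icc t₀ (t₀ + δ), u t = u₀ + ∫ s in t₀..t, f s (u s) := by
  obtain ⟨L₁, h₁⟩ := hf.bound (M + 1)
  obtain ⟨L₂, h₂⟩ := hf.weakLipschitz (M + 1)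
  obtain ⟨L₃, h₃⟩ := hf.almostLipschitz (M + 1)
  set L := max (max |L₁| |L₂|) (max |L₃| 1) with hL
  have hL1 : 1 ≤ L := (le_max_right _ _).trans (le_max_right _ _)
  have hb : ∀ t u, ‖u‖ ≤ M + 1 → ‖f t u‖ ≤ L := fun t u hu =>
    (h₁ t u hu).trans ((le_abs_self _).trans ((le_max_left _ _).trans (le_max_left _ _)))
  have hw : ∀ t u v, ‖u‖ ≤ M + 1 → ‖v‖ ≤ M + 1 → ‖J (f t u) - J (f t v)‖ ≤ L * ‖J u - J v‖ :=
    fun t u v hu hv => (h₂ t u v hu hv).trans <| by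
      gcongr
      exact (le_abs_self _).trans ((le_max_right _ _).trans (le_max_left _ _))
  have hs : ∀ ε > 0, ∃ δ > 0, ∀ t u v, ‖u‖ ≤ M + 1 → ‖v‖ ≤ M + 1 →
      ‖J u - J v‖ ≤ δ → ‖f t u - f t v‖ ≤ L * ‖u - v‖ + ε := by
    intro ε hε
    obtain ⟨δ, hδ, h⟩ := h₃ ε hε
    refine ⟨δ, hδ, fun t u v hu hv huv => (h t u v hu hv huv).trans ?_⟩
    gcongr
    exact (le_abs_self _).trans ((le_max_left _ _).trans (le_max_right _ _))
  have hLpos : 0 < L := by linarith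
  -- With `L δ = 1/2` the iterates stay in the ball of radius `M + 1`, and each integration halves
  -- differences.
  refine ⟨1 / (2 * L), by positivity, fun t₀ u₀ hu₀ => ?_⟩
  set δ := 1 / (2 * L) with hδ
  have hδpos : 0 < δ := by positivity
  have hδL : L * δ = 1 / 2 := by rw [hδ]; field_simp
  have hδ1 : δ ≤ 1 / 2 := by nlinarith
  set I := Icc t₀ (t₀ + δ) with hI
  set p := picardIter f t₀ u₀ with hp
  have hpc : ∀ n, Continuous (p n) := hf.continuous_picardIter t₀ u₀
  have hfc : ∀ n, Continuous fun s => f s (p n s) := fun n =>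
    hf.continuous.comp (continuous_id.prodMk (hpc n))
  have hM0 : 0 ≤ M := (norm_nonneg _).trans hu₀
  have hsub : ∀ t ∈ I, ∀ s ∈ uIoc t₀ t, s ∈ I := by
    intro t ht s hs
    rw [uIoc_of_le ht.1] at hs
    exact ⟨hs.1.le, hs.2.trans ht.2⟩
  have habs : ∀ t ∈ I, |t - t₀| ≤ δ := by
    intro t ht
    rw [abs_of_nonneg (by linarith [ht.1])]
    linarith [ht.2]
  have hpb : ∀ n, ∀ t ∈ I, ‖p n t‖ ≤ M + 1 := by
    intro n
    induction n with
    | zero => intro t _; exact hu₀.trans (by linarith)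
    | succ n ih =>
      intro t ht
      have h : ‖∫ s in t₀..t, f s (p n s)‖ ≤ L * |t - t₀| :=
        intervalIntegral.norm_integral_le_of_norm_le_const fun s hs =>
          hb s _ (ih s (hsub t ht s hs))
      have h' : L * |t - t₀| ≤ L * δ := by gcongr; exact habs t ht
      calc ‖p (n + 1) t‖ ≤ ‖u₀‖ + ‖∫ s in t₀..t, f s (p n s)‖ := norm_add_le _ _
        _ ≤ M + 1 := by linarith
  have hdiff : ∀ n m t, p (n + 1) t - p (m + 1) t
      = ∫ s in t₀..t, (f s (p n s) - f s (p m s)) := by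
    intro n m t
    rw [intervalIntegral.integral_sub ((hfc n).intervalIntegrable _ _)
      ((hfc m).intervalIntegrable _ _)]
    exact add_sub_add_left_eq_sub _ _ _
  set B := ‖J‖ * (2 * (M + 1)) with hB
  have hweak : ∀ k n m, k ≤ n → k ≤ m → ∀ t ∈ I, ‖J (p n t) - J (p m t)‖ ≤ B * (1 / 2) ^ k := by
    intro k
    induction k with
    | zero =>
      intro n m _ _ t ht
      rw [← map_sub, pow_zero, mul_one]
      refine (J.le_opNorm _).trans ?_
      rw [hB]
      gcongr
      linarith [norm_sub_le (p n t) (p m t), hpb n t ht, hpb m t ht]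
    | succ k ih =>
      intro n m hn hm t ht
      obtain ⟨n, rfl⟩ : ∃ n', n = n' + 1 := ⟨n - 1, by omega⟩
      obtain ⟨m, rfl⟩ : ∃ m', m = m' + 1 := ⟨m - 1, by omega⟩
      have hint : IntervalIntegrable (fun s => f s (p n s) - f s (p m s)) volume t₀ t :=
        ((hfc n).sub (hfc m)).intervalIntegrable _ _
      rw [← map_sub, hdiff, ← J.intervalIntegral_comp_comm hint]
      have h : ‖∫ s in t₀..t, J (f s (p n s) - f s (p m s))‖
          ≤ L * (B * (1 / 2) ^ k) * |t - t₀| := by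
        refine intervalIntegral.norm_integral_le_of_norm_le_const fun s hs => ?_
        have hsI := hsub t ht s hs
        rw [map_sub]
        refine (hw s _ _ (hpb n s hsI) (hpb m s hsI)).trans ?_
        gcongr
        exact ih n m (by omega) (by omega) s hsI
      refine h.trans ?_
      calc L * (B * (1 / 2) ^ k) * |t - t₀| ≤ L * (B * (1 / 2) ^ k) * δ := by
            gcongr; exact habs t ht
        _ = L * δ * (B * (1 / 2) ^ k) := by ring
        _ = B * (1 / 2) ^ (k + 1) := by rw [hδL]; ring
  have hcauchy : UniformCauchySeqOn p atTop I := by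
    rw [Metric.uniformCauchySeqOn_iff]
    intro ε hε
    obtain ⟨η, hη, hstr⟩ := hs (ε / 4) (by positivity)
    obtain ⟨K, hK⟩ : ∃ K : ℕ, B * (1 / 2 : ℝ) ^ K ≤ η := by
      have : Tendsto (fun k : ℕ => B * (1 / 2 : ℝ) ^ k) atTop (𝓝 (B * 0)) :=
        (tendsto_pow_atTop_nhds_zero_of_lt_one (by norm_num) (by norm_num)).const_mul _
      rw [mul_zero] at this
      exact ((this.eventually (gt_mem_nhds hη)).exists).imp fun _ h => h.le
    -- The first `K` iterations are spent on weak closeness, the next `j` on strong contraction. The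
    -- floor `ε/2` reproduces itself: a step turns it into `ε/4 + (ε/4) δ ≤ ε/2`.
    have hstrong : ∀ j n m, K + j ≤ n → K + j ≤ m → ∀ t ∈ I,
        ‖p n t - p m t‖ ≤ 2 * (M + 1) * (1 / 2) ^ j + ε / 2 := by
      intro j
      induction j with
      | zero =>
        intro n m _ _ t ht
        linarith [norm_sub_le (p n t) (p m t), hpb n t ht, hpb m t ht]
      | succ j ih =>
        intro n m hn hm t ht
        obtain ⟨n, rfl⟩ : ∃ n', n = n' + 1 := ⟨n - 1, by omega⟩
        obtain ⟨m, rfl⟩ : ∃ m', m = m' + 1 := ⟨m - 1, by omega⟩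
        rw [hdiff]
        have h : ‖∫ s in t₀..t, (f s (p n s) - f s (p m s))‖
            ≤ (L * (2 * (M + 1) * (1 / 2) ^ j + ε / 2) + ε / 4) * |t - t₀| := by
          refine intervalIntegral.norm_integral_le_of_norm_le_const fun s hs => ?_
          have hsI := hsub t ht s hs
          refine (hstr s _ _ (hpb n s hsI) (hpb m s hsI)
            ((hweak K n m (by omega) (by omega) s hsI).trans hK)).trans ?_
          gcongr
          exact ih n m (by omega) (by omega) s hsI
        refine h.trans ?_
        calc _ ≤ (L * (2 * (M + 1) * (1 / 2) ^ j + ε / 2) + ε / 4) * δ := by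
              gcongr; exact habs t ht
          _ = L * δ * (2 * (M + 1) * (1 / 2) ^ j + ε / 2) + ε / 4 * δ := by ring
          _ ≤ 2 * (M + 1) * (1 / 2) ^ (j + 1) + ε / 2 := by
              rw [hδL, pow_succ]
              nlinarith
    obtain ⟨j, hj⟩ : ∃ j : ℕ, 2 * (M + 1) * (1 / 2 : ℝ) ^ j < ε / 2 := by
      have : Tendsto (fun k : ℕ => 2 * (M + 1) * (1 / 2 : ℝ) ^ k) atTop (𝓝 (2 * (M + 1) * 0)) :=
        (tendsto_pow_atTop_nhds_zero_of_lt_one (by norm_num) (by norm_num)).const_mul _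
      rw [mul_zero] at this
      exact (this.eventually (gt_mem_nhds (half_pos hε))).exists
    refine ⟨K + j, fun m hm n hn t ht => ?_⟩
    rw [dist_eq_norm]
    linarith [hstrong j m n hm hn t ht]
  have hlim : ∀ t, ∃ l, t ∈ I → Tendsto (fun n => p n t) atTop (𝓝 l) := by
    intro t
    by_cases ht : t ∈ I
    · obtain ⟨l, hl⟩ := cauchySeq_tendsto_of_complete (hcauchy.cauchySeq ht)
      exact ⟨l, fun _ => hl⟩
    · exact ⟨0, fun h => absurd h ht⟩
  choose u hu using hlim
  have hunif : TendstoUniformlyOn p u atTop I :=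
    hcauchy.tendstoUniformlyOn_of_tendsto fun t ht => hu t ht
  refine ⟨u, hunif.continuousOn (Frequently.of_forall fun n => (hpc n).continuousOn), ?_⟩
  intro t ht
  have h1 : Tendsto (fun n => p (n + 1) t) atTop (𝓝 (u t)) :=
    (hu t ht).comp (tendsto_add_atTop_nat 1)
  refine tendsto_nhds_unique h1 (tendsto_const_nhds.add ?_)
  refine intervalIntegral.tendsto_integral_filter_of_dominated_convergence (fun _ => L) ?_ ?_ ?_ ?_
  · exact Eventually.of_forall fun n => (hfc n).aestronglyMeasurable
  · exact Eventually.of_forall fun n => Eventually.of_forall fun s hs =>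
      hb s _ (hpb n s (hsub t ht s hs))
  · exact intervalIntegrable_const
  · refine Eventually.of_forall fun s hs => ?_
    have : Continuous (f s) := hf.continuous.comp (by fun_prop : Continuous fun v : E => (s, v))
    exact (this.tendsto _).comp (hu s (hsub t ht s hs))

/-- A local solution started at `u t₁` is glued on at `t₁`. The gain `δ` depends only on the bound
of `‖u t₁‖`, not on `t₁` or the earlier history. -/
theorem IsAdmissibleField.exists_extension (hf : IsAdmissibleField J f) (M : ℝ) :
    ∃ δ > 0, ∀ (u₀ : E) (t₁ : ℝ) (u : ℝ → E), 0 ≤ t₁ → ContinuousOn u (Icc 0 t₁) →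
      (∀ t ∈ Icc 0 t₁, u t = u₀ + ∫ s in (0 : ℝ)..t, f s (u s)) → ‖u t₁‖ ≤ M →
      ∃ w, IsIntegralSolution f u₀ ((t₁ + δ : ℝ) : EReal) w := by
  obtain ⟨δ, hδ, h⟩ := hf.exists_local M
  refine ⟨δ, hδ, fun u₀ t₁ u ht₁ huc hu hM => ?_⟩
  obtain ⟨v, hvc, hv⟩ := h t₁ (u t₁) hM
  classical
  let w : ℝ → E := fun t => if t ≤ t₁ then u t else v t
  have hvt : v t₁ = u t₁ := by simpa using hv t₁ ⟨le_rfl, by linarith⟩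
  have hwu : EqOn w u (Icc 0 t₁) := fun t ht => if_pos ht.2
  have hwv : EqOn w v (Icc t₁ (t₁ + δ)) := by
    intro t ht
    by_cases h : t ≤ t₁
    · have : t = t₁ := le_antisymm h ht.1
      subst this
      simp only [w, le_refl, if_true, hvt]
    · exact if_neg h
  have hwc1 : ContinuousOn w (Icc 0 t₁) := huc.congr hwu
  have hwc2 : ContinuousOn w (Icc t₁ (t₁ + δ)) := hvc.congr hwv
  have hwc : ContinuousOn w (Icc 0 (t₁ + δ)) := by
    rw [← Icc_union_Icc_eq_Icc ht₁ (by linarith : t₁ ≤ t₁ + δ)]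
    exact hwc1.union_of_isClosed hwc2 isClosed_Icc isClosed_Icc
  refine ⟨w, hwc.mono fun t ht => ?_, fun t ht => ?_⟩
  · rw [mem_timeInterval_coe] at ht; exact Ico_subset_Icc_self ht
  rw [mem_timeInterval_coe] at ht
  have hle : ∀ t ∈ Icc 0 t₁, w t = u₀ + ∫ s in (0 : ℝ)..t, f s (w s) := by
    intro t ht
    rw [hwu ht, hu t ht]
    congr 1
    refine intervalIntegral.integral_congr fun s hs => ?_
    rw [uIcc_of_le ht.1] at hs
    simp only [hwu ⟨hs.1, hs.2.trans ht.2⟩]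
  by_cases htt : t ≤ t₁
  · exact hle t ⟨ht.1, htt⟩
  · push Not at htt
    have ht' : t ∈ Icc t₁ (t₁ + δ) := ⟨htt.le, ht.2.le⟩
    rw [← intervalIntegral.integral_add_adjacent_intervals (b := t₁)
      (hf.intervalIntegrable ht₁ hwc1)
      (hf.intervalIntegrable htt.le (hwc2.mono (Icc_subset_Icc_right ht'.2))),
      ← add_assoc, ← hle t₁ ⟨ht₁, le_rfl⟩, hwu ⟨ht₁, le_rfl⟩, hwv ht', hv t ht']
    congr 1
    refine intervalIntegral.integral_congr fun s hs => ?_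
    rw [uIcc_of_le htt.le] at hs
    simp only [hwv ⟨hs.1, hs.2.trans ht'.2⟩]

theorem IsIntegralSolution.congr {u₀ : E} {T : EReal} {u v : ℝ → E}
    (h : IsIntegralSolution f u₀ T u) (huv : EqOn v u (timeInterval T)) :
    IsIntegralSolution f u₀ T v := by
  refine ⟨h.continuousOn.congr huv, fun t ht => ?_⟩
  rw [huv ht, h.eq t ht]
  congr 1
  refine intervalIntegral.integral_congr fun s hs => ?_
  rw [uIcc_of_le ht.1] at hs
  simp only [huv (Icc_subset_timeInterval ht hs)]

/-- The derivative of a solution, from within any set that agrees with `[0, T)` near the point. -/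
theorem IsIntegralSolution.hasDerivWithinAt (hf : IsAdmissibleField J f) {u₀ : E} {T : EReal}
    {u : ℝ → E} (h : IsIntegralSolution f u₀ T u) {t : ℝ} (ht : t ∈ timeInterval T) :
    HasDerivWithinAt u (f t (u t)) (Ici 0) t := by
  -- A real `T'` strictly between `t` and `T` makes `[0, T']` a compact neighbourhood of `t` within
  -- `[0, ∞)`.
  obtain ⟨T', htT', hT'⟩ := EReal.lt_iff_exists_real_btwn.1 ht.2
  have htT'' : t < T' := EReal.coe_lt_coe_iff.1 htT'
  have hT'mem : T' ∈ timeInterval T := ⟨ht.1.trans htT''.le, hT'⟩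
  have hc : ContinuousOn (fun s => f s (u s)) (Icc 0 T') :=
    hf.continuousOn_comp (h.continuousOn.mono (Icc_subset_timeInterval hT'mem))
  have htI : t ∈ Icc 0 T' := ⟨ht.1, htT''.le⟩
  have hfact : Fact (t ∈ Icc 0 T') := ⟨htI⟩
  have hder : HasDerivWithinAt (fun r => u₀ + ∫ s in (0 : ℝ)..r, f s (u s)) (f t (u t))
      (Icc 0 T') t := by
    have hint : IntervalIntegrable (fun s => f s (u s)) volume 0 t :=
      (hc.mono (Icc_subset_Icc_right htT''.le)).intervalIntegrable_of_Icc ht.1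
    have := intervalIntegral.integral_hasDerivWithinAt_right (s := Icc 0 T') (t := Icc 0 T') hint
      (hc.stronglyMeasurableAtFilter_nhdsWithin measurableSet_Icc t) (hc t htI)
    exact this.const_add u₀
  have hmem : Icc 0 T' ∈ 𝓝[Ici 0] t := by
    filter_upwards [mem_nhdsWithin_of_mem_nhds (Iio_mem_nhds htT''), self_mem_nhdsWithin]
      with s hs hs'
    exact ⟨hs', le_of_lt hs⟩
  refine ((hder.congr_of_mem (fun s hs => ?_) htI)).mono_of_mem_nhdsWithin hmem
  exact h.eq s (Icc_subset_timeInterval hT'mem hs)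

/-- Gronwall's inequality for `‖J (u - v)‖`: a true Lipschitz bound holds only in the weak norm, and
injectivity of `J` makes that sufficient. -/
theorem IsIntegralSolution.unique (hJ : Function.Injective J) (hf : IsAdmissibleField J f) {u₀ : E}
    {T T' : EReal} {u v : ℝ → E} (hu : IsIntegralSolution f u₀ T u)
    (hv : IsIntegralSolution f u₀ T' v) {t : ℝ} (ht : t ∈ timeInterval T)
    (ht' : t ∈ timeInterval T') : u t = v t := by
  have huc := hu.continuousOn.mono (Icc_subset_timeInterval ht)
  have hvc := hv.continuousOn.mono (Icc_subset_timeInterval ht')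
  obtain ⟨M₁, hM₁⟩ := exists_bound_Icc huc
  obtain ⟨M₂, hM₂⟩ := exists_bound_Icc hvc
  obtain ⟨L, hL⟩ := hf.weakLipschitz (max M₁ M₂)
  have h0 : (0 : ℝ) ∈ Icc 0 t := ⟨le_rfl, ht.1⟩
  have key := norm_le_gronwallBound_of_norm_deriv_right_le (f := fun s => J (u s - v s))
    (f' := fun s => J (f s (u s) - f s (v s))) (δ := 0) (K := L) (ε := 0) (a := 0) (b := t)
    (J.continuous.comp_continuousOn (huc.sub hvc)) ?_ ?_ ?_ t ⟨ht.1, le_rfl⟩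
  · rw [gronwallBound_ε0, zero_mul] at key
    have : J (u t - v t) = 0 := norm_le_zero_iff.1 key
    exact sub_eq_zero.1 (hJ (by rw [this, map_zero]))
  · intro s hs
    have hsI : s ∈ Icc 0 t := Ico_subset_Icc_self hs
    have hd := ((hu.hasDerivWithinAt hf (Icc_subset_timeInterval ht hsI)).sub
      (hv.hasDerivWithinAt hf (Icc_subset_timeInterval ht' hsI))).mono (Ici_subset_Ici.2 hs.1)
    exact J.hasFDerivAt.comp_hasDerivWithinAt s hd
  · have e1 := hu.eq 0 (Icc_subset_timeInterval ht h0)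
    have e2 := hv.eq 0 (Icc_subset_timeInterval ht' h0)
    simp only [intervalIntegral.integral_same, add_zero] at e1 e2
    simp [e1, e2]
  · intro s hs
    have hsI : s ∈ Icc 0 t := Ico_subset_Icc_self hs
    rw [map_sub, map_sub, add_zero]
    exact hL s _ _ ((hM₁ s hsI).trans (le_max_left _ _)) ((hM₂ s hsI).trans (le_max_right _ _))

/-- Maximal solutions and the blow-up alternative. -/
theorem IsAdmissibleField.exists_maximal (hJ : Function.Injective J) (hf : IsAdmissibleField J f)
    (u₀ : E) : ∃ (Tstar : EReal) (u : ℝ → E), 0 < Tstar ∧ IsIntegralSolution f u₀ Tstar u ∧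
      (∀ (T : EReal) (v : ℝ → E), IsIntegralSolution f u₀ T v →
        T ≤ Tstar ∧ EqOn v u (timeInterval T)) ∧
      (Tstar = ⊤ ∨ ∃ τ : ℝ, Tstar = (τ : EReal) ∧ Tendsto (fun t => ‖u t‖) (𝓝[<] τ) atTop) := by
  set A : Set EReal := {T | ∃ v, IsIntegralSolution f u₀ T v} with hA
  -- By uniqueness all solutions reaching `t` share one value there; the maximal solution is their
  -- union. Beyond the supremum the value is irrelevant and set to `0`.
  have hsel : ∀ t : ℝ, ∃ l : E, t ∈ timeInterval (sSup A) →
      ∀ T v, IsIntegralSolution f u₀ T v → t ∈ timeInterval T → v t = l := by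
    intro t
    by_cases ht : t ∈ timeInterval (sSup A)
    · obtain ⟨T, ⟨v, hv⟩, hT⟩ := lt_sSup_iff.1 ht.2
      exact ⟨v t, fun _ T' v' hv' ht' => hv'.unique hJ hf hv ht' ⟨ht.1, hT⟩⟩
    · exact ⟨0, fun h => absurd h ht⟩
  choose u hu using hsel
  have hEq : ∀ (T : EReal) (v : ℝ → E), IsIntegralSolution f u₀ T v →
      T ≤ sSup A ∧ EqOn v u (timeInterval T) := by
    intro T v hv
    have hle : T ≤ sSup A := le_sSup ⟨v, hv⟩
    exact ⟨hle, fun t ht => hu t (timeInterval_mono hle ht) T v hv ht⟩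
  have hloc : ∀ t ∈ timeInterval (sSup A), ∃ T, t ∈ timeInterval T ∧
      IsIntegralSolution f u₀ T u := by
    intro t ht
    obtain ⟨T, ⟨v, hv⟩, hT⟩ := lt_sSup_iff.1 ht.2
    exact ⟨T, ⟨ht.1, hT⟩, hv.congr (hEq T v hv).2.symm⟩
  have hsol : IsIntegralSolution f u₀ (sSup A) u := by
    refine ⟨fun t ht => ?_, fun t ht => ?_⟩
    · obtain ⟨T, hT, h⟩ := hloc t ht
      exact (h.continuousOn t hT).mono_of_mem_nhdsWithin (timeInterval_mem_nhdsWithin hT)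
    · obtain ⟨T, hT, h⟩ := hloc t ht
      exact h.eq t hT
  have hpos : 0 < sSup A := by
    obtain ⟨δ, hδ, h⟩ := hf.exists_extension ‖u₀‖
    obtain ⟨w, hw⟩ := h u₀ 0 (fun _ => u₀) le_rfl continuousOn_const
      (fun t ht => by
        have : t = 0 := le_antisymm ht.2 ht.1
        simp [this]) le_rfl
    refine lt_of_lt_of_le ?_ (hEq _ w hw).1
    exact_mod_cast (by linarith : (0 : ℝ) < 0 + δ)
  refine ⟨sSup A, u, hpos, hsol, hEq, ?_⟩
  by_cases htop : sSup A = ⊤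
  · exact Or.inl htop
  right
  have hbot : sSup A ≠ ⊥ := fun h => by rw [h] at hpos; exact absurd hpos (by simp)
  lift sSup A to ℝ using ⟨htop, hbot⟩ with τ hτ
  refine ⟨τ, rfl, ?_⟩
  rw [tendsto_atTop]
  intro M
  -- If the norm did not tend to infinity, it would stay below some `M` at times arbitrarily close
  -- to `τ`. At such a time within `δ` of `τ`, an extension by `δ` would pass `τ`.
  by_contra hcon
  have hfreq : ∃ᶠ t in 𝓝[<] τ, ‖u t‖ ≤ M := by
    refine (not_eventually.1 hcon).mono fun t ht => ?_
    exact (not_le.1 ht).le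
  obtain ⟨δ, hδ, h⟩ := hf.exists_extension M
  have hτ0 : 0 < τ := by exact_mod_cast hpos
  have hev : ∀ᶠ t in 𝓝[<] τ, max 0 (τ - δ) < t ∧ t < τ := by
    have h1 : ∀ᶠ t in 𝓝[<] τ, max 0 (τ - δ) < t :=
      mem_nhdsWithin_of_mem_nhds (Ioi_mem_nhds (max_lt hτ0 (by linarith)))
    exact h1.and self_mem_nhdsWithin
  obtain ⟨t₁, hMt, ht1, ht2⟩ := (hfreq.and_eventually hev).exists
  have ht0 : 0 ≤ t₁ := (le_max_left _ _).trans ht1.le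
  have hmem : t₁ ∈ timeInterval (τ : EReal) := mem_timeInterval_coe.2 ⟨ht0, ht2⟩
  obtain ⟨w, hw⟩ := h u₀ t₁ u ht0 (hsol.continuousOn.mono (Icc_subset_timeInterval hmem))
    (fun t ht => hsol.eq t (Icc_subset_timeInterval hmem ht)) hMt
  have := EReal.coe_le_coe_iff.1 (hEq _ w hw).1
  have := (le_max_right 0 (τ - δ)).trans_lt ht1
  linarith

end IntegralEquation

/-! ## Coercive forms and the induced group on the form domain -/

section Form

set_option linter.unusedSectionVars false

variable {E Y : Type*} [NormedAddCommGroup E] [InnerProductSpace ℂ E] [CompleteSpace E]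
  [NormedAddCommGroup Y] [InnerProductSpace ℂ Y] [CompleteSpace Y]

local notation "⟪" x ", " y "⟫" => inner ℂ x y

/-- The operator `B` represents a bounded, symmetric and coercive sesquilinear form on `E`. -/
structure IsCoerciveForm (B : E →L[ℂ] E) : Prop where
  symm : ∀ u v : E, ⟪B u, v⟫ = ⟪u, B v⟫
  coercive : ∃ c > 0, ∀ u : E, c * ‖u‖ ^ 2 ≤ (⟪B u, u⟫).re

namespace IsCoerciveForm

variable {B : E →L[ℂ] E}

theorem injective_aux (hB : IsCoerciveForm B) :
    ∃ c > 0, ∀ u : E, c * ‖u‖ ≤ ‖B u‖ := by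
  obtain ⟨c, hc, h⟩ := hB.coercive
  refine ⟨c, hc, fun u => ?_⟩
  by_cases hu : ‖u‖ = 0
  · rw [hu, mul_zero]; exact norm_nonneg _
  have hpos : 0 < ‖u‖ := lt_of_le_of_ne (norm_nonneg _) (Ne.symm hu)
  have h1 : c * ‖u‖ ^ 2 ≤ ‖B u‖ * ‖u‖ :=
    (h u).trans ((Complex.re_le_norm _).trans (norm_inner_le_norm _ _))
  nlinarith

/-- Lax–Milgram in the symmetric case: the lower bound makes `B` injective with closed range, and a
self-adjoint injective operator has dense range. -/
theorem bijective (hB : IsCoerciveForm B) : Function.Bijective B := by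
  obtain ⟨c, hc, h⟩ := hB.injective_aux
  have hanti : AntilipschitzWith (Real.toNNReal c⁻¹) B := by
    refine B.antilipschitz_of_bound fun u => ?_
    rw [Real.coe_toNNReal _ (by positivity)]
    rw [← div_eq_inv_mul, le_div_iff₀ hc, mul_comm]
    exact h u
  refine ⟨hanti.injective, ?_⟩
  have hsa : IsSelfAdjoint B :=
    ContinuousLinearMap.isSelfAdjoint_iff_isSymmetric.2 fun u v => hB.symm u v
  have hd := denseRange_of_isSelfAdjoint hsa hanti.injective
  have hcl := hanti.isClosed_range B.uniformContinuous
  rw [← Set.range_eq_univ, ← hcl.closure_eq]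
  exact hd.closure_range

/-- The solution operator of the variational problem `⟪B u, v⟫ = ⟪y, J v⟫`. -/
theorem exists_solution (hB : IsCoerciveForm B) (J : E →L[ℂ] Y) :
    ∃ S : Y →L[ℂ] E, ∀ y v, ⟪B (S y), v⟫ = ⟪y, J v⟫ := by
  let e : E ≃L[ℂ] E := ContinuousLinearEquiv.ofBijective B
    (LinearMap.ker_eq_bot.2 hB.bijective.1) (LinearMap.range_eq_top.2 hB.bijective.2)
  -- The solution operator is `S = B⁻¹ J*`.
  refine ⟨e.symm.toContinuousLinearMap ∘L ContinuousLinearMap.adjoint J, fun y v => ?_⟩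
  have : B (e.symm (ContinuousLinearMap.adjoint J y)) = ContinuousLinearMap.adjoint J y :=
    e.apply_symm_apply _
  change ⟪B (e.symm (ContinuousLinearMap.adjoint J y)), v⟫ = _
  rw [this, ContinuousLinearMap.adjoint_inner_left]

variable {J : E →L[ℂ] Y} {S : Y →L[ℂ] E}

theorem solution_symm (hB : IsCoerciveForm B) (hS : ∀ y v, ⟪B (S y), v⟫ = ⟪y, J v⟫) (y z : Y) :
    ⟪J (S y), z⟫ = ⟪y, J (S z)⟫ := by
  rw [← inner_conj_symm, ← hS, inner_conj_symm, ← hB.symm, hS]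

theorem isSelfAdjoint_comp (hB : IsCoerciveForm B) (hS : ∀ y v, ⟪B (S y), v⟫ = ⟪y, J v⟫) :
    IsSelfAdjoint (J ∘L S) :=
  ContinuousLinearMap.isSelfAdjoint_iff_isSymmetric.2 (hB.solution_symm hS)

/-- From `J S y = 0` follows `S y = 0`, so `y` is orthogonal to the dense range of `J`. -/
theorem injective_comp (hJ : Function.Injective J) (hd : DenseRange J)
    (hS : ∀ y v, ⟪B (S y), v⟫ = ⟪y, J v⟫) : Function.Injective (J ∘L S) := by
  refine (injective_iff_map_eq_zero (J ∘L S)).2 fun y hy => ?_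
  have h0 : S y = 0 := hJ (by rw [map_zero]; exact hy)
  have h1 : ∀ v, ⟪y, J v⟫ = 0 := fun v => by rw [← hS, h0, map_zero, inner_zero_left]
  have h2 : ∀ z, ⟪y, z⟫ = 0 := fun z => by
    refine congrFun (hd.equalizer (f := J) (g := fun z => ⟪y, z⟫) (h := fun _ => 0)
      (by fun_prop) continuous_const ?_) z
    ext v
    exact h1 v
  exact inner_self_eq_zero.1 (h2 y)

/-- A vector orthogonal to the range has the form `B w`; pairing it with `S (J w)` gives `‖J w‖² =
0`. Density is in the norm of `E`, which allows the group to be extended from the range of `S`. -/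
theorem denseRange_solution (hB : IsCoerciveForm B) (hJ : Function.Injective J)
    (hS : ∀ y v, ⟪B (S y), v⟫ = ⟪y, J v⟫) : DenseRange S := by
  have h : (LinearMap.range (S : Y →ₗ[ℂ] E))ᗮ = ⊥ := by
    rw [eq_bot_iff]
    intro v hv
    obtain ⟨w, rfl⟩ := hB.bijective.2 v
    have h1 : ⟪S (J w), B w⟫ = 0 := (Submodule.mem_orthogonal _ _).1 hv _ ⟨J w, rfl⟩
    rw [← hB.symm, hS, inner_self_eq_zero] at h1
    have : w = 0 := hJ (by rw [h1, map_zero])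
    simp [this]
  have h' := Submodule.topologicalClosure_eq_top_iff.2 h
  intro y
  have : y ∈ (LinearMap.range (S : Y →ₗ[ℂ] E)).topologicalClosure := by rw [h']; trivial
  exact this

end IsCoerciveForm

/-- `U` is the unitary group generated by `-i (G⁻¹ - m)` with `G = J S`, where `S` is the solution
operator of the form `B`. -/
structure IsFormGroup (J : E →L[ℂ] Y) (B : E →L[ℂ] E) (S : Y →L[ℂ] E) (m : ℝ)
    (U : ℝ → Y →L[ℂ] Y) : Prop where
  form : IsCoerciveForm B
  injective : Function.Injective J
  solution : ∀ y v, ⟪B (S y), v⟫ = ⟪y, J v⟫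
  map_zero : U 0 = ContinuousLinearMap.id ℂ Y
  map_add : ∀ s t, U (s + t) = U s ∘L U t
  norm_map : ∀ t y, ‖U t y‖ = ‖y‖
  continuous : ∀ y, Continuous fun t => U t y
  comm : ∀ t y, U t (J (S y)) = J (S (U t y))
  hasDerivAt : ∀ y, HasDerivAt (fun t => U t (J (S y))) (-(Complex.I • (y - (m : ℂ) • J (S y)))) 0

/-- `V` is the restriction of the unitary group `U` to the form domain. -/
structure IsRestrictedGroup (J : E →L[ℂ] Y) (B : E →L[ℂ] E) (S : Y →L[ℂ] E) (m : ℝ)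
    (U : ℝ → Y →L[ℂ] Y) (V : ℝ → E →L[ℂ] E) : Prop where
  intertwine : ∀ t u, J (V t u) = U t (J u)
  form_map : ∀ t u v, ⟪B (V t u), V t v⟫ = ⟪B u, v⟫
  bound : ∃ C > 0, ∀ t u, ‖V t u‖ ≤ C * ‖u‖
  continuous : ∀ u, Continuous fun t => V t u
  neg_apply : ∀ t u, V (-t) (V t u) = u
  apply_neg : ∀ t u, V t (V (-t) u) = u
  comm : ∀ t u, V t (S (J u)) = S (J (V t u))
  hasDerivAt : ∀ t u, HasDerivAt (fun t => V t (S (J u)))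
    (-(Complex.I • (V t u - (m : ℂ) • V t (S (J u))))) t

/-- The fundamental theorem of calculus holds in `Y`, and injectivity pulls the integral identity
back to `E`. Continuity of `d` in `E` then gives the derivative in the stronger norm. -/
theorem hasDerivAt_of_injective_comp {J : E →L[ℂ] Y} (hJ : Function.Injective J) {w d : ℝ → E}
    (hd : Continuous d) (h : ∀ t, HasDerivAt (fun t => J (w t)) (J (d t)) t) (t : ℝ) :
    HasDerivAt w (d t) t := by
  have key : ∀ t, w t = w 0 + ∫ s in (0 : ℝ)..t, d s := by
    intro t
    refine hJ ?_
    have hint : IntervalIntegrable d volume 0 t := hd.intervalIntegrable _ _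
    have h1 : ∫ s in (0 : ℝ)..t, J (d s) = J (w t) - J (w 0) :=
      intervalIntegral.integral_eq_sub_of_hasDerivAt (fun s _ => h s)
        ((J.continuous.comp hd).intervalIntegrable _ _)
    rw [_root_.map_add, ← J.intervalIntegral_comp_comm hint, h1]
    abel
  rw [funext key]
  exact (intervalIntegral.integral_hasDerivAt_right (hd.intervalIntegrable _ _)
    hd.stronglyMeasurable.stronglyMeasurableAtFilter hd.continuousAt).const_add _

namespace IsFormGroup

variable {J : E →L[ℂ] Y} {B : E →L[ℂ] E} {S : Y →L[ℂ] E} {m : ℝ} {U : ℝ → Y →L[ℂ] Y}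

theorem neg_apply (hU : IsFormGroup J B S m U) (t : ℝ) (y : Y) : U (-t) (U t y) = y := by
  have := hU.map_add (-t) t
  rw [neg_add_cancel, hU.map_zero] at this
  exact (congrArg (fun A : Y →L[ℂ] Y => A y) this).symm

theorem inner_map (hU : IsFormGroup J B S m U) (t : ℝ) (y z : Y) : ⟪U t y, U t z⟫ = ⟪y, z⟫ :=
  LinearIsometry.inner_map_map ⟨(U t : Y →ₗ[ℂ] Y), hU.norm_map t⟩ y z

theorem hasDerivAt_apply (hU : IsFormGroup J B S m U) (t : ℝ) (y : Y) :
    HasDerivAt (fun t => U t (J (S y))) (U t (-(Complex.I • (y - (m : ℂ) • J (S y))))) t := by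
  have h1 : HasDerivAt (fun s => U (s - t) (J (S y)))
      (-(Complex.I • (y - (m : ℂ) • J (S y)))) t := by
    have h0 := hU.hasDerivAt y
    rw [← sub_self t] at h0
    simpa using h0.comp_sub_const t t
  have h2 := ((U t).restrictScalars ℝ).hasFDerivAt.comp_hasDerivAt t h1
  refine h2.congr_of_eventuallyEq (Eventually.of_forall fun s => ?_)
  have := hU.map_add t (s - t)
  rw [add_sub_cancel] at this
  exact congrArg (fun A : Y →L[ℂ] Y => A (J (S y))) this

/-- On the range of `S` the candidate is `S y ↦ S (U t y)`. It preserves the form, so coercivity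
bounds it in the norm of `E` uniformly in `t`, and it extends by density. -/
theorem exists_restricted (hU : IsFormGroup J B S m U) :
    ∃ V : ℝ → E →L[ℂ] E, IsRestrictedGroup J B S m U V := by
  obtain ⟨c, hc, hcoer⟩ := hU.form.coercive
  have hd := hU.form.denseRange_solution hU.injective hU.solution
  set C := Real.sqrt (‖B‖ / c) with hC
  have hformb : ∀ v : E, (⟪B v, v⟫).re ≤ ‖B‖ * ‖v‖ ^ 2 := fun v => by
    calc (⟪B v, v⟫).re ≤ ‖B v‖ * ‖v‖ := (Complex.re_le_norm _).trans (norm_inner_le_norm _ _)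
      _ ≤ (‖B‖ * ‖v‖) * ‖v‖ := by gcongr; exact B.le_opNorm v
      _ = _ := by ring
  have hbound : ∀ {v w : E}, ⟪B v, v⟫ = ⟪B w, w⟫ → ‖v‖ ≤ C * ‖w‖ := by
    intro v w hvw
    have h1 : c * ‖v‖ ^ 2 ≤ ‖B‖ * ‖w‖ ^ 2 := by
      have := hcoer v
      rw [hvw] at this
      exact this.trans (hformb w)
    refine abs_le_of_sq_le_sq' ?_ (by positivity) |>.2
    rw [mul_pow, hC, Real.sq_sqrt (by positivity), div_mul_eq_mul_div, le_div_iff₀ hc]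
    linarith
  -- The form at `S y` is `⟨y, J S y⟩`, and `U t` is unitary and commutes with `J S`.
  have hSU : ∀ t y, ⟪B (S (U t y)), S (U t y)⟫ = ⟪B (S y), S y⟫ := by
    intro t y
    rw [hU.solution, hU.solution, ← hU.comm, hU.inner_map]
  have hb : ∀ t y, ‖((S ∘L U t : Y →L[ℂ] E) : Y →ₗ[ℂ] E) y‖ ≤ C * ‖(S : Y →ₗ[ℂ] E) y‖ :=
    fun t y => hbound (hSU t y)
  let V : ℝ → E →L[ℂ] E := fun t =>
    ((S ∘L U t : Y →L[ℂ] E) : Y →ₗ[ℂ] E).extendOfNorm (S : Y →ₗ[ℂ] E)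
  have hV : ∀ t y, V t (S y) = S (U t y) := fun t y =>
    LinearMap.extendOfNorm_eq (f := ((S ∘L U t : Y →L[ℂ] E) : Y →ₗ[ℂ] E))
      (e := (S : Y →ₗ[ℂ] E)) hd ⟨C, hb t⟩ y
  have hJV : ∀ t u, J (V t u) = U t (J u) := by
    intro t u
    refine congrFun (hd.equalizer (f := S) (g := fun u => J (V t u)) (h := fun u => U t (J u))
      (by fun_prop) (by fun_prop) ?_) u
    ext y
    simp only [Function.comp_apply, hV, hU.comm]
  have hform : ∀ t u v, ⟪B (V t u), V t v⟫ = ⟪B u, v⟫ := by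
    intro t u v
    refine congrFun (hd.equalizer (f := S) (g := fun u => ⟪B (V t u), V t v⟫)
      (h := fun u => ⟪B u, v⟫) (by fun_prop) (by fun_prop) ?_) u
    ext y
    simp only [Function.comp_apply, hV, hU.solution, hJV, hU.inner_map]
  have hVb : ∀ t u, ‖V t u‖ ≤ C * ‖u‖ := fun t u => hbound (hform t u u)
  have hVc : ∀ u, Continuous fun t => V t u := by
    intro u
    refine Metric.continuous_iff.2 fun t ε hε => ?_
    obtain ⟨y, hy⟩ := hd.exists_dist_lt u (ε := ε / (4 * (C + 1))) (by positivity)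
    have hcont : Continuous fun t => V t (S y) := by
      simp only [hV]
      exact S.continuous.comp (hU.continuous y)
    obtain ⟨δ, hδ, h⟩ := Metric.continuous_iff.1 hcont t (ε / 2) (by positivity)
    refine ⟨δ, hδ, fun s hs => ?_⟩
    have h1 := h s hs
    rw [dist_eq_norm] at hy h1 ⊢
    have e : V s u - V t u = V s (u - S y) - V t (u - S y) + (V s (S y) - V t (S y)) := by
      simp only [map_sub]; abel
    have h2 : C * ‖u - S y‖ ≤ ε / 4 := by
      calc C * ‖u - S y‖ ≤ (C + 1) * (ε / (4 * (C + 1))) := by gcongr; linarith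
        _ = ε / 4 := by
          have : C + 1 ≠ 0 := by positivity
          field_simp
    calc ‖V s u - V t u‖
        ≤ ‖V s (u - S y)‖ + ‖V t (u - S y)‖ + ‖V s (S y) - V t (S y)‖ := by
          rw [e]; exact (norm_add_le _ _).trans (by gcongr; exact norm_sub_le _ _)
      _ < ε := by linarith [hVb s (u - S y), hVb t (u - S y)]
  have hneg : ∀ t u, V (-t) (V t u) = u := fun t u =>
    hU.injective (by rw [hJV, hJV, hU.neg_apply])
  have hcomm : ∀ t u, V t (S (J u)) = S (J (V t u)) := fun t u => by rw [hV, hJV]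
  refine ⟨V, hJV, hform, ⟨C + 1, by positivity, fun t u => (hVb t u).trans ?_⟩, hVc, hneg, ?_,
    hcomm, ?_⟩
  · gcongr; linarith
  · intro t u
    simpa using hneg (-t) u
  · intro t u
    refine hasDerivAt_of_injective_comp hU.injective
      (w := fun t => V t (S (J u)))
      (d := fun t => -(Complex.I • (V t u - (m : ℂ) • V t (S (J u)))))
      (((hVc u).sub ((hVc _).const_smul _)).const_smul _).neg (fun s => ?_) t
    have h := hU.hasDerivAt_apply s (J u)
    simp only [_root_.map_neg, _root_.map_smul, _root_.map_sub] at h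
    simp only [_root_.map_neg, _root_.map_smul, _root_.map_sub, hJV]
    exact h

end IsFormGroup

/-- Construction of the group from the form. -/
theorem IsCoerciveForm.exists_formGroup {B : E →L[ℂ] E} (hB : IsCoerciveForm B) {J : E →L[ℂ] Y}
    (hJ : Function.Injective J) (hd : DenseRange J) {S : Y →L[ℂ] E}
    (hS : ∀ y v, ⟪B (S y), v⟫ = ⟪y, J v⟫) (m : ℝ) :
    ∃ U : ℝ → Y →L[ℂ] Y, IsFormGroup J B S m U := by
  obtain ⟨U, h0, hadd, hn, hc, hcomm, hder⟩ := exists_unitaryGroup (J ∘L S)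
    (hB.isSelfAdjoint_comp hS) (IsCoerciveForm.injective_comp hJ hd hS)
  -- The phase `e^{imt}` turns the generator `-iG⁻¹` into `-i(G⁻¹ - m)`.
  let φ : ℝ → ℂ := fun t => Complex.exp ((m * t : ℝ) * Complex.I)
  have hφ : Continuous φ := by fun_prop
  have hφn : ∀ t, ‖φ t‖ = 1 := fun t => Complex.norm_exp_ofReal_mul_I _
  refine ⟨fun t => φ t • U t, hB, hJ, hS, ?_, ?_, ?_, ?_, ?_, ?_⟩
  · simp [φ, h0]
  · intro s t
    have : φ (s + t) = φ s * φ t := by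
      simp only [φ, ← Complex.exp_add]
      congr 1
      push_cast; ring
    refine ContinuousLinearMap.ext fun y => ?_
    simp only [hadd, this, smul_apply, ContinuousLinearMap.comp_apply, _root_.map_smul, smul_smul,
      mul_comm (φ s)]
  · intro t y
    rw [smul_apply, norm_smul, hφn, one_mul, hn]
  · exact fun y => hφ.smul (hc y)
  · intro t y
    have := hcomm t y
    simp only [ContinuousLinearMap.comp_apply] at this
    simp only [smul_apply, _root_.map_smul, this]
  · intro y
    have h1 : HasDerivAt φ (m * Complex.I) 0 := by
      have h : HasDerivAt (fun t : ℝ => ((m * t : ℝ) : ℂ) * Complex.I) (m * Complex.I) 0 := by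
        have := ((hasDerivAt_id (0 : ℝ)).const_mul m).ofReal_comp.mul_const Complex.I
        simpa using this
      simpa [φ] using h.cexp
    have h2 := h1.smul (hder y)
    have e : φ 0 • -(Complex.I • y) + (m * Complex.I) • U 0 ((J ∘L S) y)
        = -(Complex.I • (y - (m : ℂ) • J (S y))) := by
      simp only [φ, h0, mul_zero, Complex.ofReal_zero, zero_mul, Complex.exp_zero, one_smul,
        ContinuousLinearMap.id_apply, ContinuousLinearMap.comp_apply, smul_sub, smul_smul]
      rw [mul_comm (m : ℂ)]
      abel
    rw [e] at h2
    exact h2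

end Form

/-! ## The nonlinear equation on the form domain -/

theorem contDiffOn_one_of_hasDerivWithinAt {E : Type*} [NormedAddCommGroup E] [NormedSpace ℝ E]
    {h d : ℝ → E} {s : Set ℝ} (hd : ContinuousOn d s)
    (hh : ∀ t ∈ s, HasDerivWithinAt h (d t) s t) : ContDiffOn ℝ 1 h s := by
  rw [show (1 : WithTop ℕ∞) = 0 + 1 from rfl, contDiffOn_succ_iff_hasFDerivWithinAt (by simp)]
  intro t ht
  refine ⟨s, by rw [insert_eq_of_mem ht]; exact self_mem_nhdsWithin, by simp,
    fun t => ContinuousLinearMap.toSpanSingleton ℝ (d t),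
    fun x hx => (hh x hx).hasFDerivWithinAt, ?_⟩
  rw [contDiffOn_zero]
  exact (ContinuousLinearMap.toSpanSingletonCLE (𝕜 := ℝ) (E := E)).continuous.comp_continuousOn hd

section Nonlinear

set_option linter.unusedSectionVars false

variable {E Y : Type*} [NormedAddCommGroup E] [InnerProductSpace ℂ E] [CompleteSpace E]
  [NormedAddCommGroup Y] [InnerProductSpace ℂ Y] [CompleteSpace Y]

local notation "⟪" x ", " y "⟫" => inner ℂ x y

variable {J : E →L[ℂ] Y} {B : E →L[ℂ] E} {S : Y →L[ℂ] E} {m : ℝ} {U : ℝ → Y →L[ℂ] Y}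
  {V : ℝ → E →L[ℂ] E} {F : E → E}

/-- Strong continuity handles the fixed vector `u`, and the uniform bound handles `V (p.2 - u)`. -/
theorem continuous_uncurry_of_bound {V : ℝ → E →L[ℂ] E} {C : ℝ}
    (hb : ∀ t u, ‖V t u‖ ≤ C * ‖u‖) (hc : ∀ u, Continuous fun t => V t u) :
    Continuous fun p : ℝ × E => V p.1 p.2 := by
  rw [continuous_iff_continuousAt]
  rintro ⟨t, u⟩
  have h1 : Tendsto (fun p : ℝ × E => V p.1 (p.2 - u)) (𝓝 (t, u)) (𝓝 0) := by
    refine squeeze_zero_norm (fun p => hb p.1 (p.2 - u)) ?_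
    have : Continuous fun p : ℝ × E => C * ‖p.2 - u‖ := by fun_prop
    simpa using this.tendsto (t, u)
  have h2 : Tendsto (fun p : ℝ × E => V p.1 u) (𝓝 (t, u)) (𝓝 (V t u)) :=
    ((hc u).comp continuous_fst).tendsto (t, u)
  have h3 := h1.add h2
  rw [zero_add] at h3
  refine h3.congr fun p => ?_
  rw [map_sub, sub_add_cancel]

/-- The vector field of the equation in the interaction picture. -/
def interactionField (V : ℝ → E →L[ℂ] E) (F : E → E) (t : ℝ) (u : E) : E :=
  V (-t) (Complex.I • F (V t u))

/-- The nonlinearity is bounded and continuous, and Lipschitz on bounded sets in the weak norm. -/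
abbrev IsAdmissibleNonlinearity (J : E →L[ℂ] Y) (F : E → E) : Prop :=
  IsAdmissibleField (J.restrictScalars ℝ) fun _ => F

namespace IsRestrictedGroup

variable (hU : IsFormGroup J B S m U) (hV : IsRestrictedGroup J B S m U V)

include hV in
theorem continuous_uncurry : Continuous fun p : ℝ × E => V p.1 p.2 := by
  obtain ⟨C, -, hb⟩ := hV.bound
  exact continuous_uncurry_of_bound hb hV.continuous

-- The weak norm is invariant because `U` is isometric, so the weak Lipschitz constant is unchanged.
-- In `E` the group is only bounded by `C`, so the constants of `F` are taken on the ball of radius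
-- `C M`.
include hU hV in
theorem isAdmissibleField (hF : IsAdmissibleNonlinearity J F) :
    IsAdmissibleField (J.restrictScalars ℝ) (interactionField V F) := by
  obtain ⟨C, hC, hb⟩ := hV.bound
  have hJV : ∀ t u v, ‖J (V t u) - J (V t v)‖ = ‖J u - J v‖ := fun t u v => by
    rw [hV.intertwine, hV.intertwine, ← map_sub, hU.norm_map]
  have hbM : ∀ {M t u}, ‖u‖ ≤ M → ‖V t u‖ ≤ C * M := fun {M t u} h =>
    (hb t u).trans (by gcongr)
  have hdiff : ∀ t u v, interactionField V F t u - interactionField V F t v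
      = V (-t) (Complex.I • (F (V t u) - F (V t v))) := fun t u v => by
    simp only [interactionField, smul_sub, map_sub]
  have hnI : ∀ t (w : E), ‖V t (Complex.I • w)‖ ≤ C * ‖w‖ := fun t w => by
    simpa [norm_smul] using hb t (Complex.I • w)
  have hFc : Continuous F := hF.continuous.comp (by fun_prop : Continuous fun u : E => ((0 : ℝ), u))
  refine ⟨?_, fun M => ?_, fun M => ?_, fun M => ?_⟩
  · have h1 : Continuous fun p : ℝ × E => Complex.I • F (V p.1 p.2) :=
      (hFc.comp hV.continuous_uncurry).const_smul _
    exact hV.continuous_uncurry.comp ((continuous_fst.neg).prodMk h1)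
  · obtain ⟨L, hL⟩ := hF.bound (C * M)
    refine ⟨C * L, fun t u hu => (hnI _ _).trans ?_⟩
    gcongr
    exact hL t _ (hbM hu)
  · obtain ⟨L, hL⟩ := hF.weakLipschitz (C * M)
    refine ⟨L, fun t u v hu hv => ?_⟩
    have h := hL t (V t u) (V t v) (hbM hu) (hbM hv)
    simp only [ContinuousLinearMap.coe_restrictScalars'] at h ⊢
    rw [hJV] at h
    rw [← map_sub, hdiff, hV.intertwine, hU.norm_map, map_smul, norm_smul, Complex.norm_I, one_mul,
      map_sub]
    exact h
  · obtain ⟨L, hL⟩ := hF.almostLipschitz (C * M)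
    refine ⟨C * (|L| * C), fun ε hε => ?_⟩
    obtain ⟨δ, hδ, h⟩ := hL (ε / C) (by positivity)
    refine ⟨δ, hδ, fun t u v hu hv huv => ?_⟩
    simp only [ContinuousLinearMap.coe_restrictScalars'] at h huv
    have h1 := h t (V t u) (V t v) (hbM hu) (hbM hv) (by rw [hJV]; exact huv)
    have h2 : ‖V t u - V t v‖ ≤ C * ‖u - v‖ := by rw [← map_sub]; exact hb _ _
    rw [hdiff]
    calc _ ≤ C * ‖F (V t u) - F (V t v)‖ := hnI _ _
      _ ≤ C * (|L| * (C * ‖u - v‖) + ε / C) := by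
          gcongr
          refine h1.trans ?_
          gcongr
          exact le_abs_self L
      _ = C * (|L| * C) * ‖u - v‖ + ε := by field_simp

end IsRestrictedGroup

/-- `Ψ ∈ C([0,T), E)` satisfies the Duhamel equation in `Y`. -/
structure IsMildSolution (J : E →L[ℂ] Y) (U : ℝ → Y →L[ℂ] Y) (F : E → E) (Ψ₀ : E) (T : EReal)
    (Ψ : ℝ → E) : Prop where
  continuousOn : ContinuousOn Ψ (timeInterval T)
  duhamel : ∀ t ∈ timeInterval T,
    J (Ψ t) = U t (J Ψ₀) + Complex.I • ∫ s in (0 : ℝ)..t, U (t - s) (J (F (Ψ s)))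

/-! ### Interaction picture, conservation laws, maximal and global mild solutions. -/

section Equivalence

variable (hU : IsFormGroup J B S m U) (hV : IsRestrictedGroup J B S m U V)
  (hF : IsAdmissibleNonlinearity J F)

include hU hV hF

/-- Writing `U (t - s) = U t U (-s)` takes `U t` out of the integral, and the remaining integrand
already takes values in `E`. -/
theorem duhamel_eq {Ψ : ℝ → E} (Ψ₀ : E) {t : ℝ} (ht : 0 ≤ t) (hc : ContinuousOn Ψ (Icc 0 t)) :
    U t (J Ψ₀) + Complex.I • ∫ s in (0 : ℝ)..t, U (t - s) (J (F (Ψ s)))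
      = J (V t (Ψ₀ + ∫ s in (0 : ℝ)..t, interactionField V F s (V (-s) (Ψ s)))) := by
  have hFc : Continuous F := hF.continuous.comp (by fun_prop : Continuous fun u : E => ((0 : ℝ), u))
  have hd : ContinuousOn (fun s => interactionField V F s (V (-s) (Ψ s))) (Icc 0 t) := by
    simp only [interactionField, hV.apply_neg]
    exact hV.continuous_uncurry.comp_continuousOn
      (continuousOn_id.neg.prodMk ((hFc.comp_continuousOn hc).const_smul _))
  have hint := hd.intervalIntegrable_of_Icc ht (μ := volume)
  rw [hV.intertwine, _root_.map_add, _root_.map_add]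
  congr 1
  have h1 := (U t ∘L J).intervalIntegral_comp_comm hint
  simp only [ContinuousLinearMap.comp_apply] at h1
  rw [← h1, ← intervalIntegral.integral_smul]
  refine intervalIntegral.integral_congr fun s _ => ?_
  have := congrArg (fun A : Y →L[ℂ] Y => A (J (F (Ψ s)))) (hU.map_add t (-s))
  simp only [ContinuousLinearMap.comp_apply, ← sub_eq_add_neg] at this
  simp only [interactionField, hV.apply_neg, hV.intertwine, _root_.map_smul, this]

theorem isMildSolution_iff {Ψ₀ : E} {T : EReal} {Ψ : ℝ → E} :
    IsMildSolution J U F Ψ₀ T Ψ ↔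
      IsIntegralSolution (interactionField V F) Ψ₀ T fun t => V (-t) (Ψ t) := by
  constructor
  · intro h
    refine ⟨hV.continuous_uncurry.comp_continuousOn (continuousOn_id.neg.prodMk h.continuousOn),
      fun t ht => ?_⟩
    have h1 := h.duhamel t ht
    rw [duhamel_eq hU hV hF Ψ₀ ht.1 (h.continuousOn.mono (Icc_subset_timeInterval ht))] at h1
    rw [hU.injective h1, hV.neg_apply]
  · intro h
    have hc : ContinuousOn Ψ (timeInterval T) := by
      have := hV.continuous_uncurry.comp_continuousOn (continuousOn_id.prodMk h.continuousOn)
      simpa only [id, Function.comp_def, hV.apply_neg] using this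
    refine ⟨hc, fun t ht => ?_⟩
    rw [duhamel_eq hU hV hF Ψ₀ ht.1 (hc.mono (Icc_subset_timeInterval ht)), ← h.eq t ht,
      hV.apply_neg]

/-- The derivative of `S J Ψ`, i.e. of `Ψ` in the dual of the form domain. -/
noncomputable def dualVelocity (J : E →L[ℂ] Y) (S : Y →L[ℂ] E) (m : ℝ) (F : E → E) (u : E) : E :=
  -(Complex.I • (u - (m : ℂ) • S (J u))) + Complex.I • S (J (F u))

/-- Differentiability of `Ψ` itself in `E` is not available, but `S` smooths enough. Since `S J`
commutes with `V`, the function equals `V s (S (J (u s)))` and a product rule applies. -/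
theorem IsMildSolution.hasDerivWithinAt {Ψ₀ : E} {T : EReal} {Ψ : ℝ → E}
    (h : IsMildSolution J U F Ψ₀ T Ψ) {t : ℝ} (ht : t ∈ timeInterval T) :
    HasDerivWithinAt (fun t => S (J (Ψ t))) (dualVelocity J S m F (Ψ t)) (Ici 0) t := by
  have hu := (isMildSolution_iff hU hV hF).1 h
  set u : ℝ → E := fun t => V (-t) (Ψ t) with hu_def
  have hΨ : ∀ t, Ψ t = V t (u t) := fun t => (hV.apply_neg t (Ψ t)).symm
  obtain ⟨C, hC, hb⟩ := hV.bound
  have hdu := hu.hasDerivWithinAt (hV.isAdmissibleField hU hF) ht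
  set u' := interactionField V F t (u t) with hu'
  let G : E →L[ℝ] E := (S ∘L J).restrictScalars ℝ
  have hg : HasDerivWithinAt (fun s => S (J (u s))) (S (J u')) (Ici 0) t :=
    G.hasFDerivAt.comp_hasDerivWithinAt t hdu
  have h1 : HasDerivWithinAt (fun s => V s (S (J (u t))))
      (-(Complex.I • (Ψ t - (m : ℂ) • S (J (Ψ t))))) (Ici 0) t := by
    have := (hV.hasDerivAt t (u t)).hasDerivWithinAt (s := Ici 0)
    rwa [hV.comm, ← hΨ] at this
  -- The product rule is done by hand because `V` is only strongly continuous: the uniform bound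
  -- carries the little-o through `V s`, and strong continuity is used only at the fixed vector `S
  -- (J u')`.
  have h2 : HasDerivWithinAt (fun s => V s (S (J (u s)) - S (J (u t))))
      (V t (S (J u'))) (Ici 0) t := by
    rw [hasDerivWithinAt_iff_isLittleO] at hg ⊢
    have e : ∀ s, V s (S (J (u s)) - S (J (u t))) - V t (S (J (u t)) - S (J (u t)))
        - (s - t) • V t (S (J u'))
        = V s (S (J (u s)) - S (J (u t)) - (s - t) • S (J u'))
          + (s - t) • (V s (S (J u')) - V t (S (J u'))) := by
      intro s
      have : V s ((s - t) • S (J u')) = (s - t) • V s (S (J u')) :=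
        ((V s).restrictScalars ℝ).map_smul _ _
      rw [map_sub (V s) _ ((s - t) • S (J u')), this, sub_self, _root_.map_zero, smul_sub]
      abel
    simp only [e]
    refine Asymptotics.IsLittleO.add ?_ ?_
    · exact (Asymptotics.IsBigO.of_bound C (Eventually.of_forall fun s => hb s _)).trans_isLittleO
        hg
    · have h3 : Tendsto (fun s => V s (S (J u')) - V t (S (J u'))) (𝓝[Ici 0] t) (𝓝 0) := by
        have := ((hV.continuous (S (J u'))).tendsto t).sub_const (V t (S (J u')))
        rw [sub_self] at this
        exact this.mono_left nhdsWithin_le_nhds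
      have h4 := (Asymptotics.isBigO_refl (fun s : ℝ => s - t) (𝓝[Ici 0] t)).smul_isLittleO
        ((Asymptotics.isLittleO_one_iff ℝ).2 h3)
      simpa using h4
  have h3 := h1.add h2
  refine (h3.congr_deriv ?_).congr_of_eventuallyEq (Eventually.of_forall fun s => ?_) ?_
  · rw [dualVelocity, hV.comm, hu', interactionField, hV.apply_neg, ← hΨ, map_smul, map_smul]
  · simp only [Pi.add_apply, map_sub, add_sub_cancel]
    rw [hV.comm, ← hΨ]
  · simp only [Pi.add_apply, map_sub, add_sub_cancel]
    rw [hV.comm, ← hΨ]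

theorem IsMildSolution.contDiffOn {Ψ₀ : E} {T : EReal} {Ψ : ℝ → E}
    (h : IsMildSolution J U F Ψ₀ T Ψ) :
    ContDiffOn ℝ 1 (fun t => S (J (Ψ t))) (timeInterval T) := by
  have hFc : Continuous F := hF.continuous.comp (by fun_prop : Continuous fun u : E => ((0 : ℝ), u))
  refine contDiffOn_one_of_hasDerivWithinAt (d := fun t => dualVelocity J S m F (Ψ t)) ?_
    fun t ht => (h.hasDerivWithinAt hU hV hF ht).mono fun s hs => hs.1
  have : Continuous (dualVelocity J S m F) := by
    unfold dualVelocity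
    fun_prop
  exact this.comp_continuousOn h.continuousOn

/-- In the interaction picture only the nonlinearity drives `u`, so the derivative of `‖J u‖²` is `2
Re (i ⟨JΨ, JF(Ψ)⟩)`, which vanishes by gauge invariance. -/
theorem IsMildSolution.norm_eq (hgauge : ∀ u, (⟪J u, J (F u)⟫).im = 0) {Ψ₀ : E} {T : EReal}
    {Ψ : ℝ → E} (h : IsMildSolution J U F Ψ₀ T Ψ) {t : ℝ} (ht : t ∈ timeInterval T) :
    ‖J (Ψ t)‖ = ‖J Ψ₀‖ := by
  have hu := (isMildSolution_iff hU hV hF).1 h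
  set u : ℝ → E := fun t => V (-t) (Ψ t) with hu_def
  have hΨ : ∀ t, Ψ t = V t (u t) := fun t => (hV.apply_neg t (Ψ t)).symm
  have hJu : ∀ s, ‖J (Ψ s)‖ = ‖J (u s)‖ := fun s => by rw [hΨ, hV.intertwine, hU.norm_map]
  have hc := hu.continuousOn.mono (Icc_subset_timeInterval ht)
  have h0 : u 0 = Ψ₀ := by simpa using hu.eq 0 ⟨le_rfl, lt_of_le_of_lt (by exact_mod_cast ht.1) ht.2⟩
  have key := constant_of_has_deriv_right_zero (f := fun s => (⟪J (u s), J (u s)⟫).re)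
    (a := 0) (b := t) ?_ ?_ t ⟨ht.1, le_rfl⟩
  · simp only [h0] at key
    rw [hJu]
    have e : ∀ y : Y, (⟪y, y⟫).re = ‖y‖ ^ 2 := fun y => (norm_sq_eq_re_inner (𝕜 := ℂ) y).symm
    rw [e, e] at key
    exact (sq_eq_sq₀ (norm_nonneg _) (norm_nonneg _)).1 key
  · exact Complex.continuous_re.comp_continuousOn
      ((J.continuous.comp_continuousOn hc).inner (𝕜 := ℂ) (J.continuous.comp_continuousOn hc))
  · intro s hs
    have hsT := Icc_subset_timeInterval ht (Ico_subset_Icc_self hs)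
    have hd := (hu.hasDerivWithinAt (hV.isAdmissibleField hU hF) hsT).mono (Ici_subset_Ici.2 hs.1)
    have hJd : HasDerivWithinAt (fun s => J (u s)) (J (interactionField V F s (u s))) (Ici s) s :=
      (J.restrictScalars ℝ).hasFDerivAt.comp_hasDerivWithinAt s hd
    have h1 := (hJd.inner ℂ hJd)
    have h2 := Complex.reCLM.hasFDerivAt.comp_hasDerivWithinAt s h1
    refine h2.congr_deriv ?_
    have e1 : ⟪J (u s), J (interactionField V F s (u s))⟫ = Complex.I * ⟪J (Ψ s), J (F (Ψ s))⟫ := by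
      rw [interactionField, ← hU.inner_map s, ← hV.intertwine, ← hV.intertwine, ← hΨ, hV.apply_neg,
        map_smul, inner_smul_right]
    have e2 : ⟪J (interactionField V F s (u s)), J (u s)⟫
        = starRingEnd ℂ (Complex.I * ⟪J (Ψ s), J (F (Ψ s))⟫) := by rw [← e1, inner_conj_symm]
    rw [e1, e2]
    have := hgauge (Ψ s)
    rw [Complex.reCLM_apply, Complex.add_re, Complex.conj_re, Complex.I_mul_re, this]
    simp

/-- A potential of the nonlinearity: `P v - P u = Re ⟪F u, v - u⟫ + O(‖v - u‖²)` in the weak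
norm. -/
def IsPotential (J : E →L[ℂ] Y) (F : E → E) (P : E → ℝ) : Prop :=
  ∀ M : ℝ, ∃ L : ℝ, ∀ u v : E, ‖u‖ ≤ M → ‖v‖ ≤ M →
    |P v - P u - (⟪J (F u), J (v - u)⟫).re| ≤ L * ‖J (v - u)‖ ^ 2

/-- The linear term depends only on `S J Ψ`, since `⟨J F, J w⟩ = ⟨B F, S J w⟩`. For the error, `‖J
w‖² = ⟨B S J w, w⟩ ≤ ‖B‖ ‖S J w‖ ‖w‖` with `w = Ψ s - Ψ t`: the first norm is `O(s - t)` and the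
second tends to `0`. -/
theorem IsMildSolution.hasDerivWithinAt_potential {P : E → ℝ} (hP : IsPotential J F P) {Ψ₀ : E}
    {T : EReal} {Ψ : ℝ → E} (h : IsMildSolution J U F Ψ₀ T Ψ) {t : ℝ} (ht : t ∈ timeInterval T) :
    HasDerivWithinAt (fun s => P (Ψ s)) (⟪F (Ψ t), B (dualVelocity J S m F (Ψ t))⟫).re
      (timeInterval T) t := by
  set d := dualVelocity J S m F (Ψ t) with hd_def
  have hh : HasDerivWithinAt (fun s => S (J (Ψ s))) d (timeInterval T) t :=
    (h.hasDerivWithinAt hU hV hF ht).mono fun s hs => hs.1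
  obtain ⟨L, hL⟩ := hP (‖Ψ t‖ + 1)
  have hO : (fun s => S (J (Ψ s)) - S (J (Ψ t))) =O[𝓝[timeInterval T] t] fun s => s - t :=
    hh.isBigO_sub.comp_tendsto (k := fun s => (s, t))
      (tendsto_id.prodMk (tendsto_pure.2 (Eventually.of_forall fun _ => rfl)))
  rw [hasDerivWithinAt_iff_isLittleO] at hh ⊢
  have e : ∀ s, P (Ψ s) - P (Ψ t) - (s - t) • (⟪F (Ψ t), B d⟫).re
      = (P (Ψ s) - P (Ψ t) - (⟪J (F (Ψ t)), J (Ψ s - Ψ t)⟫).re)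
        + (⟪B (F (Ψ t)), S (J (Ψ s)) - S (J (Ψ t)) - (s - t) • d⟫).re := by
    intro s
    have h1 : ⟪J (F (Ψ t)), J (Ψ s - Ψ t)⟫ = ⟪B (F (Ψ t)), S (J (Ψ s)) - S (J (Ψ t))⟫ := by
      rw [← inner_conj_symm, ← hU.solution, inner_conj_symm, hU.form.symm, map_sub, map_sub]
    have h2 : ⟪B (F (Ψ t)), (s - t) • d⟫ = ((s - t : ℝ) : ℂ) * ⟪F (Ψ t), B d⟫ := by
      rw [← Complex.coe_smul, inner_smul_right, hU.form.symm]
    rw [h1, inner_sub_right _ _ ((s - t) • d), h2, Complex.sub_re, Complex.re_ofReal_mul]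
    simp only [smul_eq_mul]
    ring
  simp only [e]
  refine Asymptotics.IsLittleO.add ?_ ?_
  · have hcont : Tendsto (fun s => Ψ s - Ψ t) (𝓝[timeInterval T] t) (𝓝 0) := by
      have := (h.continuousOn t ht).tendsto.sub_const (Ψ t)
      rwa [sub_self] at this
    have hev : ∀ᶠ s in 𝓝[timeInterval T] t, ‖Ψ s‖ ≤ ‖Ψ t‖ + 1 := by
      have := hcont.norm.eventually (gt_mem_nhds (show ‖(0 : E)‖ < 1 by simp))
      filter_upwards [this] with s hs
      have h3 := norm_add_le (Ψ t) (Ψ s - Ψ t)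
      rw [add_sub_cancel] at h3
      linarith
    have hbig : (fun s => P (Ψ s) - P (Ψ t) - (⟪J (F (Ψ t)), J (Ψ s - Ψ t)⟫).re)
        =O[𝓝[timeInterval T] t]
          fun s => ‖S (J (Ψ s)) - S (J (Ψ t))‖ * ‖Ψ s - Ψ t‖ := by
      refine Asymptotics.IsBigO.of_bound (|L| * ‖B‖) ?_
      filter_upwards [hev] with s hs
      have h3 := hL (Ψ t) (Ψ s) (by linarith) hs
      have h4 : ‖J (Ψ s - Ψ t)‖ ^ 2 ≤ ‖B‖ * (‖S (J (Ψ s)) - S (J (Ψ t))‖ * ‖Ψ s - Ψ t‖) := by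
        have : ‖J (Ψ s - Ψ t)‖ ^ 2 = (⟪J (Ψ s - Ψ t), J (Ψ s - Ψ t)⟫).re :=
          norm_sq_eq_re_inner (𝕜 := ℂ) _
        rw [this, ← hU.solution]
        calc _ ≤ ‖B (S (J (Ψ s - Ψ t)))‖ * ‖Ψ s - Ψ t‖ :=
              (Complex.re_le_norm _).trans (norm_inner_le_norm _ _)
          _ ≤ (‖B‖ * ‖S (J (Ψ s - Ψ t))‖) * ‖Ψ s - Ψ t‖ := by gcongr; exact B.le_opNorm _
          _ = _ := by rw [map_sub, map_sub]; ring
      rw [Real.norm_eq_abs, Real.norm_of_nonneg (by positivity)]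
      calc _ ≤ |L| * ‖J (Ψ s - Ψ t)‖ ^ 2 := h3.trans (by gcongr; exact le_abs_self L)
        _ ≤ |L| * (‖B‖ * (‖S (J (Ψ s)) - S (J (Ψ t))‖ * ‖Ψ s - Ψ t‖)) := by gcongr
        _ = _ := by ring
    refine hbig.trans_isLittleO ?_
    have hnorm0 : Tendsto (fun s => ‖Ψ s - Ψ t‖) (𝓝[timeInterval T] t) (𝓝 0) := by
      simpa using hcont.norm
    have h5 := hO.norm_left.mul_isLittleO ((Asymptotics.isLittleO_one_iff ℝ).2 hnorm0)
    simpa using h5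
  · refine Asymptotics.IsBigO.trans_isLittleO ?_ hh
    refine Asymptotics.IsBigO.of_bound ‖B (F (Ψ t))‖ (Eventually.of_forall fun s => ?_)
    rw [Real.norm_eq_abs]
    exact (Complex.abs_re_le_norm _).trans (norm_inner_le_norm _ _)

/-- Conservation of energy. -/
theorem IsMildSolution.energy_eq {P : E → ℝ} (hP : IsPotential J F P)
    (hgauge : ∀ u, (⟪J u, J (F u)⟫).im = 0) {Ψ₀ : E} {T : EReal}
    {Ψ : ℝ → E} (h : IsMildSolution J U F Ψ₀ T Ψ) {t : ℝ} (ht : t ∈ timeInterval T) :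
    (⟪B (Ψ t), Ψ t⟫).re - 2 * P (Ψ t) = (⟪B Ψ₀, Ψ₀⟫).re - 2 * P Ψ₀ := by
  have hu := (isMildSolution_iff hU hV hF).1 h
  set u : ℝ → E := fun t => V (-t) (Ψ t) with hu_def
  have hΨ : ∀ t, Ψ t = V t (u t) := fun t => (hV.apply_neg t (Ψ t)).symm
  have hBu : ∀ s, ⟪B (Ψ s), Ψ s⟫ = ⟪B (u s), u s⟫ := fun s => by rw [hΨ, hV.form_map]
  have hc := hu.continuousOn.mono (Icc_subset_timeInterval ht)
  have h0T : (0 : ℝ) ∈ timeInterval T := ⟨le_rfl, lt_of_le_of_lt (by exact_mod_cast ht.1) ht.2⟩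
  have h0 : u 0 = Ψ₀ := by simpa using hu.eq 0 h0T
  have h0' : Ψ 0 = Ψ₀ := by
    have := h.duhamel 0 h0T
    rw [intervalIntegral.integral_same, smul_zero, add_zero, hU.map_zero] at this
    exact hU.injective this
  have hderP := fun s hs => h.hasDerivWithinAt_potential hU hV hF hP (t := s) hs
  have key := constant_of_has_deriv_right_zero
    (f := fun s => (⟪B (u s), u s⟫).re - 2 * P (Ψ s))
    (a := 0) (b := t) ?_ ?_ t ⟨ht.1, le_rfl⟩
  · simp only [h0, h0'] at key
    rw [hBu]
    exact key
  · refine ContinuousOn.sub ?_ (ContinuousOn.mul continuousOn_const ?_)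
    · exact Complex.continuous_re.comp_continuousOn
        ((B.continuous.comp_continuousOn hc).inner (𝕜 := ℂ) hc)
    · intro s hs
      exact ((hderP s (Icc_subset_timeInterval ht hs)).continuousWithinAt).mono
        (Icc_subset_timeInterval ht)
  · intro s hs
    have hsT := Icc_subset_timeInterval ht (Ico_subset_Icc_self hs)
    have hd := (hu.hasDerivWithinAt (hV.isAdmissibleField hU hF) hsT).mono (Ici_subset_Ici.2 hs.1)
    have hBd : HasDerivWithinAt (fun s => B (u s)) (B (interactionField V F s (u s))) (Ici s) s :=
      (B.restrictScalars ℝ).hasFDerivAt.comp_hasDerivWithinAt s hd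
    have h1 := hBd.inner ℂ hd
    have h2 := Complex.reCLM.hasFDerivAt.comp_hasDerivWithinAt s h1
    have hmem : timeInterval T ∈ 𝓝[Ici s] s := by
      have := timeInterval_mem_nhdsWithin (T' := ⊤) hsT
      refine nhdsWithin_mono s (fun r hr => ?_) this
      exact ⟨hs.1.trans hr, EReal.coe_lt_top r⟩
    have h3 := (hderP s hsT).mono_of_mem_nhdsWithin hmem
    have h4 := h2.sub (h3.const_mul 2)
    refine h4.congr_deriv ?_
    -- With `z = ⟨BΨ, F(Ψ)⟩`, both the quadratic part and twice the potential have derivative `-2 Im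
    -- z`. The terms from the shift `m` and from `F` paired with itself are `i` times real numbers
    -- and drop out.
    have e1 : ⟪B (u s), interactionField V F s (u s)⟫ = Complex.I * ⟪B (Ψ s), F (Ψ s)⟫ := by
      rw [interactionField, ← hV.form_map s, ← hΨ, hV.apply_neg, inner_smul_right]
    have e2 : ⟪B (interactionField V F s (u s)), u s⟫
        = starRingEnd ℂ (Complex.I * ⟪B (Ψ s), F (Ψ s)⟫) := by
      rw [← e1, inner_conj_symm, hU.form.symm]
    have e3 : ⟪F (Ψ s), B (dualVelocity J S m F (Ψ s))⟫
        = -(Complex.I * ⟪F (Ψ s), B (Ψ s)⟫)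
          + Complex.I * m * ⟪J (F (Ψ s)), J (Ψ s)⟫
          + Complex.I * ⟪J (F (Ψ s)), J (F (Ψ s))⟫ := by
      have hs' : ∀ w : E, ⟪F (Ψ s), B (S (J w))⟫ = ⟪J (F (Ψ s)), J w⟫ := fun w => by
        rw [← inner_conj_symm, hU.solution, inner_conj_symm]
      simp only [dualVelocity, _root_.map_add, map_neg, map_smul, map_sub, inner_add_right,
        inner_neg_right, inner_smul_right, inner_sub_right, hs']
      ring
    rw [e1, e2, e3]
    have g1 : (⟪J (F (Ψ s)), J (Ψ s)⟫).im = 0 := by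
      rw [← inner_conj_symm, Complex.conj_im, hgauge, neg_zero]
    have g2 : (⟪J (F (Ψ s)), J (F (Ψ s))⟫).im = 0 := inner_self_im (𝕜 := ℂ) _
    have g3 : ⟪F (Ψ s), B (Ψ s)⟫ = starRingEnd ℂ ⟪B (Ψ s), F (Ψ s)⟫ :=
      (inner_conj_symm _ _).symm
    rw [g3]
    simp only [Complex.reCLM_apply, Complex.add_re, Complex.neg_re, Complex.conj_re,
      Complex.conj_im, Complex.I_mul_re, mul_assoc, Complex.im_ofReal_mul, g1, g2]
    ring

theorem exists_maximal_mild (Ψ₀ : E) : ∃ (Tstar : EReal) (Ψ : ℝ → E), 0 < Tstar ∧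
    IsMildSolution J U F Ψ₀ Tstar Ψ ∧
    (∀ (T : EReal) (Φ : ℝ → E), IsMildSolution J U F Ψ₀ T Φ →
      T ≤ Tstar ∧ EqOn Φ Ψ (timeInterval T)) ∧
    (Tstar = ⊤ ∨ ∃ τ : ℝ, Tstar = (τ : EReal) ∧ Tendsto (fun t => ‖Ψ t‖) (𝓝[<] τ) atTop) := by
  obtain ⟨Tstar, u, hpos, hu, hmax, hblow⟩ :=
    (hV.isAdmissibleField hU hF).exists_maximal hU.injective Ψ₀
  have hsol : IsMildSolution J U F Ψ₀ Tstar fun t => V t (u t) := by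
    rw [isMildSolution_iff hU hV hF]
    simpa only [hV.neg_apply] using hu
  refine ⟨Tstar, fun t => V t (u t), hpos, hsol, fun T Φ hΦ => ?_, hblow.imp_right ?_⟩
  · obtain ⟨h1, h2⟩ := hmax T _ ((isMildSolution_iff hU hV hF).1 hΦ)
    refine ⟨h1, fun t ht => ?_⟩
    change Φ t = V t (u t)
    rw [← h2 ht, hV.apply_neg]
  · rintro ⟨τ, hτ, h⟩
    refine ⟨τ, hτ, ?_⟩
    -- Blow-up of `u` passes to `V t (u t)` because `V (-t)` is bounded uniformly in `t`.
    obtain ⟨C, hC, hb⟩ := hV.bound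
    refine tendsto_atTop_mono (fun t => ?_) (h.atTop_div_const hC)
    rw [div_le_iff₀ hC, mul_comm]
    have := hb (-t) (V t (u t))
    rwa [hV.neg_apply] at this

/-- Global existence from a bound of the norm by mass and energy. -/
theorem exists_global_mild {P : E → ℝ} (hP : IsPotential J F P)
    (hgauge : ∀ u, (⟪J u, J (F u)⟫).im = 0)
    (hcoer : ∀ M K : ℝ, ∃ R, ∀ u : E, ‖J u‖ = M → (⟪B u, u⟫).re - 2 * P u = K → ‖u‖ ≤ R)
    (Ψ₀ : E) : ∃ Ψ : ℝ → E, IsMildSolution J U F Ψ₀ ⊤ Ψ := by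
  obtain ⟨Tstar, Ψ, hpos, hΨ, -, hblow⟩ := exists_maximal_mild hU hV hF Ψ₀
  rcases hblow with rfl | ⟨τ, rfl, hτ⟩
  · exact ⟨Ψ, hΨ⟩
  exfalso
  have hτ0 : 0 < τ := by exact_mod_cast hpos
  obtain ⟨R, hR⟩ := hcoer ‖J Ψ₀‖ ((⟪B Ψ₀, Ψ₀⟫).re - 2 * P Ψ₀)
  have h1 : ∀ᶠ t in 𝓝[<] τ, R + 1 ≤ ‖Ψ t‖ := hτ.eventually_ge_atTop _
  have h2 : ∀ᶠ t in 𝓝[<] τ, 0 < t ∧ t < τ :=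
    Eventually.and (mem_nhdsWithin_of_mem_nhds (Ioi_mem_nhds hτ0)) self_mem_nhdsWithin
  obtain ⟨t, h3, h4, h5⟩ := (h1.and h2).exists
  have ht : t ∈ timeInterval (τ : EReal) := mem_timeInterval_coe.2 ⟨h4.le, h5⟩
  have := hR (Ψ t) (hΨ.norm_eq hU hV hF hgauge ht) (hΨ.energy_eq hU hV hF hP hgauge ht)
  linarith

end Equivalence

end Nonlinear

/-! ## Primitives of integrable functions -/

section Primitive

set_option linter.unusedSectionVars false

theorem absolutelyContinuousOnInterval_of_dist_le {X : Type*} [PseudoMetricSpace X] {h : ℝ → X}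
    {w : ℝ → ℝ} {a b C : ℝ} (hw : AbsolutelyContinuousOnInterval w a b)
    (hdist : ∀ x ∈ uIcc a b, ∀ y ∈ uIcc a b, dist (h x) (h y) ≤ C * dist (w x) (w y)) :
    AbsolutelyContinuousOnInterval h a b := by
  unfold AbsolutelyContinuousOnInterval at hw ⊢
  have hw' := hw.const_mul C
  rw [mul_zero] at hw'
  refine squeeze_zero' (Eventually.of_forall fun E => Finset.sum_nonneg fun i _ => dist_nonneg) ?_
    hw'
  filter_upwards [eventually_inf_principal.2 (Eventually.of_forall fun E hE => hE)] with E hE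
  rw [Finset.mul_sum]
  refine Finset.sum_le_sum fun i hi => ?_
  obtain ⟨h1, h2⟩ := hE.1 i hi
  exact hdist _ h1 _ h2

variable {V W : Type*} [NormedAddCommGroup V] [NormedSpace ℝ V] [CompleteSpace V]
  [NormedAddCommGroup W] [NormedSpace ℝ W] [CompleteSpace W]

/-- On `[a, b]` the function `u` is a primitive of the integrable function `g`. -/
structure IsPrimitiveOn (u g : ℝ → V) (a b : ℝ) : Prop where
  intervalIntegrable : IntervalIntegrable g volume a b
  eq : ∀ x ∈ Icc a b, u x = u a + ∫ t in a..x, g t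

namespace IsPrimitiveOn

variable {u g : ℝ → V} {a b : ℝ}

theorem continuousOn (h : IsPrimitiveOn u g a b) : ContinuousOn u (Icc a b) := by
  have h1 : ContinuousOn (fun x => ∫ t in a..x, g t) (Icc a b) := by
    rcases le_or_gt a b with hab | hab
    · have := h.intervalIntegrable
      rw [intervalIntegrable_iff_integrableOn_Icc_of_le hab] at this
      have := intervalIntegral.continuousOn_primitive_interval
        (a := a) (b := b) (by rwa [uIcc_of_le hab] : IntegrableOn g (uIcc a b))
      rwa [uIcc_of_le hab] at this
    · rw [Icc_eq_empty (not_le.2 hab)]; exact continuousOn_empty _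
  exact (continuousOn_const.add h1).congr h.eq

theorem intervalIntegrable_sub (h : IsPrimitiveOn u g a b) {x y : ℝ} (hx : x ∈ Icc a b)
    (hy : y ∈ Icc a b) : IntervalIntegrable g volume x y := by
  refine h.intervalIntegrable.mono_set ?_
  rw [uIcc_of_le (hx.1.trans hx.2)]
  exact uIcc_subset_Icc hx hy

theorem sub_eq (h : IsPrimitiveOn u g a b) {x y : ℝ} (hx : x ∈ Icc a b) (hy : y ∈ Icc a b) :
    u y - u x = ∫ t in x..y, g t := by
  have ha : a ∈ Icc a b := ⟨le_rfl, hx.1.trans hx.2⟩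
  rw [h.eq x hx, h.eq y hy, add_sub_add_left_eq_sub,
    intervalIntegral.integral_interval_sub_left (h.intervalIntegrable_sub ha hy)
      (h.intervalIntegrable_sub ha hx)]

theorem congr_deriv {g' : ℝ → V} (h : IsPrimitiveOn u g a b) (hab : a ≤ b)
    (hg : ∀ᵐ x ∂volume.restrict (Ioc a b), g' x = g x) : IsPrimitiveOn u g' a b := by
  refine ⟨h.intervalIntegrable.congr_ae ?_, fun x hx => ?_⟩
  · rw [uIoc_of_le hab]
    filter_upwards [hg] with x hx using hx.symm
  · rw [h.eq x hx]
    congr 1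
    refine intervalIntegral.integral_congr_ae_restrict ?_
    rw [uIoc_of_le hx.1]
    filter_upwards [ae_restrict_of_ae_restrict_of_subset (Ioc_subset_Ioc_right hx.2) hg] with x hx
      using hx.symm

theorem of_contDiff {φ : ℝ → V} (hφ : ContDiff ℝ 1 φ) (a b : ℝ) :
    IsPrimitiveOn φ (deriv φ) a b := by
  have hc : Continuous (deriv φ) := hφ.continuous_deriv le_rfl
  refine ⟨hc.intervalIntegrable _ _, fun x _ => ?_⟩
  rw [intervalIntegral.integral_deriv_eq_sub (fun y _ => hφ.differentiable one_ne_zero y)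
    (hc.intervalIntegrable _ _), add_sub_cancel]

theorem prodMk {v h : ℝ → W} (hu : IsPrimitiveOn u g a b) (hv : IsPrimitiveOn v h a b) :
    IsPrimitiveOn (fun x => (u x, v x)) (fun x => (g x, h x)) a b := by
  have hint : ∀ {x y}, IntervalIntegrable g volume x y → IntervalIntegrable h volume x y →
      IntervalIntegrable (fun x => (g x, h x)) volume x y := fun h1 h2 =>
    ⟨h1.1.prodMk h2.1, h1.2.prodMk h2.2⟩
  refine ⟨hint hu.intervalIntegrable hv.intervalIntegrable, fun x hx => ?_⟩
  have ha : a ∈ Icc a b := ⟨le_rfl, hx.1.trans hx.2⟩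
  have h1 := hu.intervalIntegrable_sub ha hx
  have h2 := hv.intervalIntegrable_sub ha hx
  have e : ∫ t in a..x, (g t, h t) = (∫ t in a..x, g t, ∫ t in a..x, h t) := by
    rw [intervalIntegral.integral_of_le hx.1, intervalIntegral.integral_of_le hx.1,
      intervalIntegral.integral_of_le hx.1]
    exact integral_pair h1.1 h2.1
  rw [e, hu.eq x hx, hv.eq x hx]
  rfl

theorem intervalIntegrable_fderiv {F : V → W} (hF : ContDiff ℝ 1 F) (h : IsPrimitiveOn u g a b)
    (hab : a ≤ b) : IntervalIntegrable (fun x => fderiv ℝ F (u x) (g x)) volume a b := by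
  have hc : ContinuousOn (fun x => fderiv ℝ F (u x)) (Icc a b) :=
    (hF.continuous_fderiv one_ne_zero).comp_continuousOn h.continuousOn
  have hg : IntegrableOn g (Icc a b) :=
    (intervalIntegrable_iff_integrableOn_Icc_of_le hab).1 h.intervalIntegrable
  rw [intervalIntegrable_iff_integrableOn_Icc_of_le hab]
  obtain ⟨L, hL⟩ := isCompact_Icc.exists_bound_of_continuousOn hc
  refine Integrable.mono' (hg.norm.const_mul L) ?_ ?_
  · have h1 := hc.aestronglyMeasurable (μ := volume) measurableSet_Icc
    exact (ContinuousLinearMap.id ℝ (V →L[ℝ] W)).aestronglyMeasurable_comp₂ h1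
      hg.aestronglyMeasurable
  · filter_upwards [ae_restrict_mem measurableSet_Icc] with x hx
    exact ((fderiv ℝ F (u x)).le_opNorm _).trans (by gcongr; exact hL x hx)

/-- The chain rule. -/
theorem comp {F : V → W} (hF : ContDiff ℝ 1 F) (h : IsPrimitiveOn u g a b) (hab : a ≤ b) :
    IsPrimitiveOn (fun x => F (u x)) (fun x => fderiv ℝ F (u x) (g x)) a b := by
  have hint := h.intervalIntegrable_fderiv hF hab
  have hgn := h.intervalIntegrable.norm
  set w : ℝ → ℝ := fun x => ∫ t in a..x, ‖g t‖ with hw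
  have hwac : AbsolutelyContinuousOnInterval w a b :=
    hgn.absolutelyContinuousOnInterval_intervalIntegral left_mem_uIcc
  have ha : a ∈ Icc a b := ⟨le_rfl, hab⟩
  have hsubI : ∀ {x y}, x ∈ Icc a b → y ∈ Icc a b → uIcc x y ⊆ uIcc a b := fun hx hy => by
    rw [uIcc_of_le hab]; exact uIcc_subset_Icc hx hy
  have hwsub : ∀ x ∈ Icc a b, ∀ y ∈ Icc a b, w y - w x = ∫ t in x..y, ‖g t‖ := fun x hx y hy =>
    intervalIntegral.integral_interval_sub_left (hgn.mono_set (hsubI ha hy))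
      (hgn.mono_set (hsubI ha hx))
  set I : ℝ → W := fun x => ∫ t in a..x, fderiv ℝ F (u t) (g t) with hI
  have hIsub : ∀ x ∈ Icc a b, ∀ y ∈ Icc a b,
      I y - I x = ∫ t in x..y, fderiv ℝ F (u t) (g t) := fun x hx y hy =>
    intervalIntegral.integral_interval_sub_left (hint.mono_set (hsubI ha hy))
      (hint.mono_set (hsubI ha hx))
  have hcomp : IsCompact (u '' Icc a b) := isCompact_Icc.image_of_continuousOn h.continuousOn
  obtain ⟨K, hK⟩ :=
    hF.locallyLipschitz.locallyLipschitzOn.exists_lipschitzOnWith_of_compact hcomp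
  have hc : ContinuousOn (fun x => fderiv ℝ F (u x)) (Icc a b) :=
    (hF.continuous_fderiv one_ne_zero).comp_continuousOn h.continuousOn
  obtain ⟨L, hL⟩ := isCompact_Icc.exists_bound_of_continuousOn hc
  -- The increments of `F ∘ u - I` are dominated by those of the absolutely continuous `w = ∫ ‖g‖`:
  -- the first term because `F` is Lipschitz on the compact image of `u`, the second because `F'` is
  -- bounded there.
  have hdist : ∀ x ∈ Icc a b, ∀ y ∈ Icc a b, x ≤ y →
      dist (F (u x) - I x) (F (u y) - I y) ≤ (K + L) * dist (w x) (w y) := by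
    intro x hx y hy hxy
    have hw1 : dist (w x) (w y) = ∫ t in x..y, ‖g t‖ := by
      rw [dist_comm, Real.dist_eq, hwsub x hx y hy, abs_of_nonneg
        (intervalIntegral.integral_nonneg hxy fun t _ => norm_nonneg _)]
    have h1 : ‖F (u y) - F (u x)‖ ≤ K * ∫ t in x..y, ‖g t‖ := by
      have := hK.dist_le_mul _ (mem_image_of_mem u hy) _ (mem_image_of_mem u hx)
      rw [dist_eq_norm, dist_eq_norm, h.sub_eq hx hy] at this
      refine this.trans ?_
      gcongr
      exact intervalIntegral.norm_integral_le_integral_norm hxy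
    have h2 : ‖I y - I x‖ ≤ L * ∫ t in x..y, ‖g t‖ := by
      rw [hIsub x hx y hy, ← intervalIntegral.integral_const_mul]
      refine intervalIntegral.norm_integral_le_of_norm_le hxy ?_
        ((hgn.mono_set (hsubI hx hy)).const_mul L)
      refine Eventually.of_forall fun t ht => ((fderiv ℝ F (u t)).le_opNorm _).trans ?_
      gcongr
      exact hL t ⟨hx.1.trans ht.1.le, ht.2.trans hy.2⟩
    rw [dist_comm, dist_eq_norm, hw1]
    calc ‖F (u y) - I y - (F (u x) - I x)‖ = ‖(F (u y) - F (u x)) - (I y - I x)‖ := by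
          congr 1; abel
      _ ≤ _ := norm_sub_le _ _
      _ ≤ (K + L) * ∫ t in x..y, ‖g t‖ := by rw [add_mul]; exact add_le_add h1 h2
  have hac : AbsolutelyContinuousOnInterval (fun x => F (u x) - I x) a b := by
    refine absolutelyContinuousOnInterval_of_dist_le (C := K + L) hwac fun x hx y hy => ?_
    rw [uIcc_of_le hab] at hx hy
    rcases le_total x y with hxy | hxy
    · exact hdist x hx y hy hxy
    · rw [dist_comm, dist_comm (w x)]; exact hdist y hy x hx hxy
  -- By Lebesgue differentiation `u' = g` and `I' = F'(u) g` almost everywhere. An absolutely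
  -- continuous function with zero derivative almost everywhere is constant.
  have hder : ∀ᵐ x, x ∈ uIcc a b → HasDerivAt (fun x => F (u x) - I x) 0 x := by
    have hea : ∀ᵐ x : ℝ, x ≠ a := by simp [ae_iff, measure_singleton]
    have heb : ∀ᵐ x : ℝ, x ≠ b := by simp [ae_iff, measure_singleton]
    filter_upwards [h.intervalIntegrable.ae_hasDerivAt_integral, hint.ae_hasDerivAt_integral,
      hea, heb] with x h1 h2 h3 h4 hx
    have hx' := hx
    rw [uIcc_of_le hab] at hx'
    have hnhds : Icc a b ∈ 𝓝 x :=
      Icc_mem_nhds (lt_of_le_of_ne hx'.1 h3.symm) (lt_of_le_of_ne hx'.2 h4)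
    have hu : HasDerivAt u (g x) x := by
      refine ((h1 hx a left_mem_uIcc).const_add (u a)).congr_of_eventuallyEq ?_
      filter_upwards [hnhds] with y hy using h.eq y hy
    have hFu := (hF.differentiable one_ne_zero (u x)).hasFDerivAt.comp_hasDerivAt x hu
    have := hFu.sub (h2 hx a left_mem_uIcc)
    rw [sub_self] at this
    exact this
  obtain ⟨C, hC⟩ := hac.const_of_ae_hasDerivAt_zero hder
  refine ⟨hint, fun x hx => ?_⟩
  have h1 := hC a left_mem_uIcc
  have h2 := hC x (by rwa [uIcc_of_le hab])
  have h3 : I a = 0 := intervalIntegral.integral_same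
  simp only [h3, sub_zero] at h1
  rw [h1, ← h2]
  exact (sub_add_cancel _ _).symm

theorem mul {u v g h : ℝ → ℂ} (hu : IsPrimitiveOn u g a b) (hv : IsPrimitiveOn v h a b)
    (hab : a ≤ b) : IsPrimitiveOn (fun x => u x * v x) (fun x => g x * v x + u x * h x) a b := by
  have hF : ContDiff ℝ 1 fun p : ℂ × ℂ => p.1 * p.2 := contDiff_fst.mul contDiff_snd
  refine ((hu.prodMk hv).comp hF hab).congr_deriv hab (Eventually.of_forall fun x => ?_)
  have h1 : HasFDerivAt (𝕜 := ℝ) (fun p : ℂ × ℂ => p.1 * p.2) _ (u x, v x) :=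
    hasFDerivAt_fst.mul hasFDerivAt_snd
  rw [h1.fderiv]
  simp
  ring

theorem conj {u g : ℝ → ℂ} (hu : IsPrimitiveOn u g a b) (hab : a ≤ b) :
    IsPrimitiveOn (fun x => starRingEnd ℂ (u x)) (fun x => starRingEnd ℂ (g x)) a b := by
  have hF : ContDiff ℝ 1 fun z : ℂ => starRingEnd ℂ z := Complex.conjCLE.contDiff
  refine (hu.comp hF hab).congr_deriv hab (Eventually.of_forall fun x => ?_)
  have h1 : HasFDerivAt (𝕜 := ℝ) (fun z : ℂ => starRingEnd ℂ z)
    (Complex.conjCLE : ℂ →L[ℝ] ℂ) (u x) := Complex.conjCLE.hasFDerivAt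
  rw [h1.fderiv]
  rfl

end IsPrimitiveOn

end Primitive

/-! ## Weak derivatives on the half-line -/

section WeakDerivative

theorem exists_subset_Icc_of_isCompact {K : Set ℝ} (hK : IsCompact K) (h : K ⊆ Ioi 0) :
    ∃ a R : ℝ, 0 < a ∧ a < R ∧ K ⊆ Icc a R := by
  rcases K.eq_empty_or_nonempty with rfl | hne
  · exact ⟨1, 2, one_pos, one_lt_two, empty_subset _⟩
  obtain ⟨a, ha⟩ := hK.exists_isLeast hne
  obtain ⟨b, hb⟩ := hK.exists_isGreatest hne
  refine ⟨a, b + 1, h ha.1, by linarith [ha.2 hb.1], fun x hx => ⟨ha.2 hx, ?_⟩⟩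
  linarith [hb.2 hx]

theorem halfLine_restrict {s : Set ℝ} (hs : MeasurableSet s) (h : s ⊆ Ioi 0) :
    halfLine.restrict s = volume.restrict s := by
  rw [halfLine, Measure.restrict_restrict hs, inter_eq_left.2 h]

theorem integrableOn_coe (f : L2Half) {s : Set ℝ} (hs : MeasurableSet s) (h : s ⊆ Ioi 0)
    (hfin : volume s ≠ ⊤) : IntegrableOn f s volume := by
  have h1 : MemLp f 2 (volume.restrict s) := by
    rw [← halfLine_restrict hs h]; exact (Lp.memLp f).restrict s
  have : IsFiniteMeasure (volume.restrict s) := ⟨by simpa using hfin.lt_top⟩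
  exact memLp_one_iff_integrable.1 (h1.mono_exponent (by norm_num))

theorem intervalIntegrable_coe (f : L2Half) {a b : ℝ} (ha : 0 ≤ a) (hb : 0 ≤ b) :
    IntervalIntegrable f volume a b := by
  rw [intervalIntegrable_iff]
  refine integrableOn_coe f measurableSet_uIoc (fun x hx => ?_) (by simp [uIoc])
  exact lt_of_le_of_lt (le_min ha hb) hx.1

theorem setIntegral_halfLine_eq {k : ℝ → ℂ} {R : ℝ} (hR : 0 ≤ R) (h : ∀ x, R < x → k x = 0) :
    ∫ x, k x ∂halfLine = ∫ x in (0 : ℝ)..R, k x := by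
  rw [intervalIntegral.integral_of_le hR]
  refine setIntegral_eq_of_subset_of_forall_sdiff_eq_zero measurableSet_Ioi Ioc_subset_Ioi_self ?_
  intro x hx
  exact h x (not_le.1 fun hle => hx.2 ⟨hx.1, hle⟩)

theorem integrable_halfLine_of_continuousOn {k : ℝ → ℂ} {R : ℝ} (hk : ContinuousOn k (Ici 0))
    (h : ∀ x, R < x → k x = 0) : Integrable k halfLine := by
  have h1 : IntegrableOn k (Icc 0 R) volume :=
    (hk.mono Icc_subset_Ici_self).integrableOn_compact isCompact_Icc
  have h2 : IntegrableOn k (Ici 0) volume := by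
    refine h1.of_forall_sdiff_eq_zero measurableSet_Ici fun x hx => ?_
    exact h x (not_le.1 fun hle => hx.2 ⟨hx.1, hle⟩)
  exact h2.mono_set Ioi_subset_Ici_self

theorem continuousOn_Ici_of_isPrimitiveOn {u g : ℝ → ℂ} (h : ∀ R > 0, IsPrimitiveOn u g 0 R) :
    ContinuousOn u (Ici 0) := by
  intro x hx
  have hx0 : (0 : ℝ) ≤ x := hx
  refine ((h (x + 1) (by linarith)).continuousOn x ⟨hx0, by linarith⟩).mono_of_mem_nhdsWithin ?_
  filter_upwards [self_mem_nhdsWithin, mem_nhdsWithin_of_mem_nhds (Iio_mem_nhds (lt_add_one x))]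
    with y hy hy'
  exact ⟨hy, le_of_lt hy'⟩

theorem isPrimitiveOn_integral (g : L2Half) (c : ℂ) {R : ℝ} (hR : 0 ≤ R) :
    IsPrimitiveOn (fun x => c + ∫ t in (0 : ℝ)..x, g t) g 0 R :=
  ⟨intervalIntegrable_coe g le_rfl hR, fun x _ => by simp⟩

theorem isPrimitiveOn_ofReal {φ : ℝ → ℝ} (hφ : ContDiff ℝ ∞ φ) (a b : ℝ) :
    IsPrimitiveOn (fun x => (φ x : ℂ)) (fun x => ((deriv φ x : ℝ) : ℂ)) a b := by
  have h1 : ContDiff ℝ 1 fun x => (φ x : ℂ) :=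
    Complex.ofRealCLM.contDiff.comp (hφ.of_le (by exact_mod_cast le_top))
  have h2 : deriv (fun x => (φ x : ℂ)) = fun x => ((deriv φ x : ℝ) : ℂ) := by
    ext x
    exact ((hφ.differentiable (by simp) x).hasDerivAt.ofReal_comp).deriv
  rw [← h2]
  exact IsPrimitiveOn.of_contDiff h1 a b

theorem integral_test_isPrimitiveOn {u g : ℝ → ℂ} (h : ∀ R > 0, IsPrimitiveOn u g 0 R)
    {φ : ℝ → ℝ} (h1 : ContDiff ℝ ∞ φ) (h2 : HasCompactSupport φ) (h3 : tsupport φ ⊆ Ioi 0) :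
    ∫ x, (((deriv φ x : ℝ) : ℂ) * u x + ((φ x : ℝ) : ℂ) * g x) ∂halfLine = 0 := by
  obtain ⟨a, R, ha, haR, hsub⟩ := exists_subset_Icc_of_isCompact h2 h3
  have hφ : ∀ x, x ∉ Icc a R → φ x = 0 := fun x hx =>
    image_eq_zero_of_notMem_tsupport fun hx' => hx (hsub hx')
  have hφ' : ∀ x, x ∉ Icc a R → deriv φ x = 0 := fun x hx => by
    by_contra hne
    exact hx (hsub (support_deriv_subset hne))
  -- The endpoint `R + 1` lies outside the support, so `φ u` vanishes at both ends.
  have hR : 0 < R + 1 := by linarith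
  rw [setIntegral_halfLine_eq hR.le]
  · have hp := (isPrimitiveOn_ofReal h1 0 (R + 1)).mul (h _ hR) hR.le
    have := hp.sub_eq (x := 0) (y := R + 1) ⟨le_rfl, hR.le⟩ ⟨hR.le, le_rfl⟩
    rw [← this, hφ 0 (fun hx => by linarith [hx.1]), hφ (R + 1) (fun hx => by linarith [hx.2])]
    simp
  · intro x hx
    have hx' : x ∉ Icc a R := fun h => by linarith [h.2]
    rw [hφ x hx', hφ' x hx']
    simp

theorem isWeakDeriv_of_isPrimitiveOn {f g : L2Half} {u : ℝ → ℂ}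
    (h : ∀ R > 0, IsPrimitiveOn u g 0 R) (hf : f =ᵐ[halfLine] u) : IsWeakDeriv f g := by
  intro φ h1 h2 h3
  have hd : Continuous (deriv φ) := h1.continuous_deriv (by simp)
  have key := integral_test_isPrimitiveOn h h1 h2 h3
  have e : ∫ x, (((deriv φ x : ℝ) : ℂ) * u x + ((φ x : ℝ) : ℂ) * g x) ∂halfLine
      = ∫ x, (((deriv φ x : ℝ) : ℂ) * f x + ((φ x : ℝ) : ℂ) * g x) ∂halfLine := by
    refine integral_congr_ae ?_
    filter_upwards [hf] with x hx
    rw [hx]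
  rw [e, integral_add (integrable_test_mul hd h2.deriv f) (integrable_test_mul h1.continuous h2 g)]
    at key
  exact eq_neg_of_add_eq_zero_left key

/-- A smooth function with compact support in `(0, ∞)` and vanishing integral is the derivative of
such a function. -/
theorem exists_test_primitive {φ : ℝ → ℝ} (h1 : ContDiff ℝ ∞ φ) (h2 : HasCompactSupport φ)
    (h3 : tsupport φ ⊆ Ioi 0) (h0 : ∫ x, φ x = 0) :
    ∃ ψ : ℝ → ℝ, ContDiff ℝ ∞ ψ ∧ HasCompactSupport ψ ∧ tsupport ψ ⊆ Ioi 0 ∧ deriv ψ = φ := by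
  obtain ⟨a, R, ha, haR, hsub⟩ := exists_subset_Icc_of_isCompact h2 h3
  have hφ : ∀ x, x ∉ Icc a R → φ x = 0 := fun x hx =>
    image_eq_zero_of_notMem_tsupport fun hx' => hx (hsub hx')
  set ψ : ℝ → ℝ := fun x => ∫ t in (0 : ℝ)..x, φ t with hψ
  have hder : ∀ x, HasDerivAt ψ (φ x) x := fun x =>
    (h1.continuous.integral_hasStrictDerivAt 0 x).hasDerivAt
  have hderiv : deriv ψ = φ := funext fun x => (hder x).deriv
  have hsupp : Function.support ψ ⊆ Icc a R := by
    intro x hx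
    by_contra hx'
    refine hx ?_
    rw [mem_Icc, not_and_or, not_le, not_le] at hx'
    rcases hx' with hxa | hxR
    · refine intervalIntegral.integral_zero_ae (Eventually.of_forall fun t ht => hφ t fun h => ?_)
      have : t ≤ max 0 x := ht.2
      have : t < a := lt_of_le_of_lt this (max_lt ha hxa)
      linarith [h.1]
    · have hx0 : 0 ≤ x := by linarith
      change ∫ t in (0 : ℝ)..x, φ t = 0
      rw [intervalIntegral.integral_of_le hx0, ← h0]
      refine setIntegral_eq_integral_of_forall_compl_eq_zero fun t ht => hφ t fun h => ht ?_
      exact ⟨by linarith [h.1], by linarith [h.2]⟩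
  have hts : tsupport ψ ⊆ Icc a R := closure_minimal hsupp isClosed_Icc
  refine ⟨ψ, ?_, ?_, fun x hx => lt_of_lt_of_le ha (hts hx).1, hderiv⟩
  · rw [contDiff_infty_iff_deriv, hderiv]
    exact ⟨fun x => (hder x).differentiableAt, h1⟩
  · exact HasCompactSupport.of_support_subset_isCompact isCompact_Icc hsupp

/-- Du Bois-Reymond's lemma on the half-line. -/
theorem ae_eq_const_of_integral_deriv_eq_zero {h : ℝ → ℂ}
    (hloc : LocallyIntegrableOn h (Ioi 0) volume)
    (hint : ∀ χ : ℝ → ℝ, Continuous χ → HasCompactSupport χ → tsupport χ ⊆ Ioi 0 →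
      Integrable (fun x => ((χ x : ℝ) : ℂ) * h x) halfLine)
    (hh : ∀ φ : ℝ → ℝ, ContDiff ℝ ∞ φ → HasCompactSupport φ → tsupport φ ⊆ Ioi 0 →
      ∫ x, ((deriv φ x : ℝ) : ℂ) * h x ∂halfLine = 0) :
    ∃ C : ℂ, ∀ᵐ x ∂halfLine, h x = C := by
  -- Centre `2` and outer radius `1` keep the support in `[1, 3]`, inside the open half-line.
  let b : ContDiffBump (2 : ℝ) := ⟨1 / 2, 1, by norm_num, by norm_num⟩
  set χ : ℝ → ℝ := b.normed volume with hχ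
  have c1 : ContDiff ℝ ∞ χ := b.contDiff_normed
  have c2 : HasCompactSupport χ := b.hasCompactSupport_normed
  have c3 : tsupport χ ⊆ Ioi 0 := by
    rw [hχ, b.tsupport_normed_eq]
    intro x hx
    rw [Metric.mem_closedBall, Real.dist_eq] at hx
    have : b.rOut = 1 := rfl
    rw [this] at hx
    have := (abs_le.1 hx).1
    change 0 < x
    linarith
  have c4 : ∫ x, χ x = 1 := b.integral_normed
  set C : ℂ := ∫ x, ((χ x : ℝ) : ℂ) * h x ∂halfLine with hC
  refine ⟨C, ?_⟩
  have hloc' : LocallyIntegrableOn (fun x => h x - C) (Ioi 0) volume :=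
    hloc.sub (continuousOn_const.locallyIntegrableOn measurableSet_Ioi)
  have key := isOpen_Ioi.ae_eq_zero_of_integral_contDiff_smul_eq_zero hloc' ?_
  · rw [halfLine, ae_restrict_iff' measurableSet_Ioi]
    filter_upwards [key] with x hx hx0
    exact sub_eq_zero.1 (hx hx0)
  intro φ h1 h2 h3
  -- Subtracting `A χ` from `φ` makes the integral vanish, so the difference is the derivative of a
  -- test function and is annihilated by `h`.
  set A : ℝ := ∫ x, φ x with hA
  have i1 : Integrable φ := h1.continuous.integrable_of_hasCompactSupport h2
  have i2 : Integrable χ := c1.continuous.integrable_of_hasCompactSupport c2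
  have d3 : tsupport (fun x => φ x - A * χ x) ⊆ Ioi 0 := by
    refine (tsupport_sub φ fun x => A * χ x).trans (union_subset h3 ?_)
    exact (tsupport_mul_subset_right (f := fun _ => A) (g := χ)).trans c3
  obtain ⟨ψ, p1, p2, p3, p4⟩ := exists_test_primitive (φ := fun x => φ x - A * χ x)
    (h1.sub (contDiff_const.mul c1)) (h2.sub c2.mul_left) d3
    (by rw [integral_sub i1 (i2.const_mul A), integral_const_mul, c4, mul_one, sub_self])
  have h4 := hh ψ p1 p2 p3
  rw [p4] at h4
  have j1 := hint φ h1.continuous h2 h3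
  have j2 := hint χ c1.continuous c2 c3
  have e1 : ∫ x, ((φ x - A * χ x : ℝ) : ℂ) * h x ∂halfLine
      = ∫ x, ((φ x : ℝ) : ℂ) * h x ∂halfLine - A * C := by
    rw [hC, ← integral_const_mul, ← integral_sub j1 (j2.const_mul _)]
    refine integral_congr_ae (Eventually.of_forall fun x => ?_)
    push_cast
    ring
  rw [e1] at h4
  have e2 : ∫ x, φ x • (h x - C) = ∫ x, φ x • (h x - C) ∂halfLine := by
    refine (setIntegral_eq_integral_of_forall_compl_eq_zero fun x hx => ?_).symm
    rw [image_eq_zero_of_notMem_tsupport fun hx' => hx (h3 hx'), zero_smul]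
  have e3 : ∫ x, ((φ x : ℝ) : ℂ) ∂halfLine = A := by
    rw [integral_complex_ofReal]
    congr 1
    refine setIntegral_eq_integral_of_forall_compl_eq_zero fun x hx => ?_
    exact image_eq_zero_of_notMem_tsupport fun hx' => hx (h3 hx')
  have i3 : Integrable (fun x => ((φ x : ℝ) : ℂ)) halfLine := i1.ofReal.restrict
  calc ∫ x, φ x • (h x - C) = ∫ x, (((φ x : ℝ) : ℂ) * h x - ((φ x : ℝ) : ℂ) * C) ∂halfLine := by
        rw [e2]
        refine integral_congr_ae (Eventually.of_forall fun x => ?_)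
        simp only [Complex.real_smul, mul_sub]
    _ = 0 := by rw [integral_sub j1 (i3.mul_const C), integral_mul_const, e3, h4]

theorem locallyIntegrableOn_coe (f : L2Half) : LocallyIntegrableOn f (Ioi 0) volume := by
  rw [locallyIntegrableOn_iff isOpen_Ioi.isLocallyClosed]
  intro K hK hKc
  exact integrableOn_coe f hKc.measurableSet hK hKc.measure_lt_top.ne

/-- A function with a weak derivative is a primitive of it. -/
theorem IsWeakDeriv.exists_primitive {f g : L2Half} (h : IsWeakDeriv f g) :
    ∃ c : ℂ, f =ᵐ[halfLine] fun x => c + ∫ t in (0 : ℝ)..x, g t := by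
  set u : ℝ → ℂ := fun x => 0 + ∫ t in (0 : ℝ)..x, g t with hu
  have hprim : ∀ R > 0, IsPrimitiveOn u g 0 R := fun R hR => isPrimitiveOn_integral g 0 hR.le
  have huc : ContinuousOn u (Ici 0) := continuousOn_Ici_of_isPrimitiveOn hprim
  have hui : ∀ χ : ℝ → ℝ, Continuous χ → HasCompactSupport χ → tsupport χ ⊆ Ioi 0 →
      Integrable (fun x => ((χ x : ℝ) : ℂ) * u x) halfLine := by
    intro χ hc hs hsub
    obtain ⟨a, R, -, -, hR⟩ := exists_subset_Icc_of_isCompact hs hsub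
    refine integrable_halfLine_of_continuousOn (R := R)
      ((Complex.continuous_ofReal.comp hc).continuousOn.mul huc) fun x hx => ?_
    rw [image_eq_zero_of_notMem_tsupport fun hx' => absurd (hR hx').2 (not_le.2 hx)]
    simp
  have hint : ∀ χ : ℝ → ℝ, Continuous χ → HasCompactSupport χ → tsupport χ ⊆ Ioi 0 →
      Integrable (fun x => ((χ x : ℝ) : ℂ) * (f x - u x)) halfLine := by
    intro χ hc hs hsub
    simp only [mul_sub]
    exact (integrable_test_mul hc hs f).sub (hui χ hc hs hsub)
  have hh : ∀ φ : ℝ → ℝ, ContDiff ℝ ∞ φ → HasCompactSupport φ → tsupport φ ⊆ Ioi 0 →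
      ∫ x, ((deriv φ x : ℝ) : ℂ) * (f x - u x) ∂halfLine = 0 := by
    intro φ h1 h2 h3
    have hd : Continuous (deriv φ) := h1.continuous_deriv (by simp)
    have hd3 : tsupport (deriv φ) ⊆ Ioi 0 :=
      (closure_minimal (support_deriv_subset (f := φ)) (isClosed_tsupport φ)).trans h3
    have i1 := integrable_test_mul hd h2.deriv f
    have i2 := hui _ hd h2.deriv hd3
    have i3 := integrable_test_mul h1.continuous h2 g
    have e1 := integral_test_isPrimitiveOn hprim h1 h2 h3
    rw [integral_add i2 i3] at e1
    simp only [mul_sub]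
    rw [integral_sub i1 i2, h φ h1 h2 h3, eq_neg_of_add_eq_zero_left e1, sub_self]
  -- The difference of `f` and the primitive `u` of `g` has weak derivative `0`.
  obtain ⟨C, hC⟩ := ae_eq_const_of_integral_deriv_eq_zero ((locallyIntegrableOn_coe f).sub
    ((huc.mono Ioi_subset_Ici_self).locallyIntegrableOn measurableSet_Ioi)) hint hh
  refine ⟨C, ?_⟩
  filter_upwards [hC] with x hx
  rw [← hx, hu]
  simp

end WeakDerivative

/-! ## The Sobolev space of the half-line -/

section Sobolev

local notation "⟪" x ", " y "⟫" => inner ℂ x y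

theorem norm_sq_eq_integral (f : L2Half) : ‖f‖ ^ 2 = ∫ x, ‖f x‖ ^ 2 ∂halfLine := by
  have h1 : (‖f‖ : ℂ) ^ 2 = ⟪f, f⟫ := (inner_self_eq_norm_sq_to_K f).symm
  have h2 : ⟪f, f⟫ = ∫ x, ((‖f x‖ ^ 2 : ℝ) : ℂ) ∂halfLine := by
    rw [L2.inner_def]
    refine integral_congr_ae (Eventually.of_forall fun x => ?_)
    simp only [inner_self_eq_norm_sq_to_K]
    push_cast
    rfl
  rw [h2, integral_complex_ofReal] at h1
  exact_mod_cast h1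

theorem integrable_norm_sq (f : L2Half) : Integrable (fun x => ‖f x‖ ^ 2) halfLine :=
  (memLp_two_iff_integrable_sq_norm (Lp.memLp f).1).1 (Lp.memLp f)

/-- Cauchy–Schwarz against the indicator function of `(x, y]`. -/
theorem norm_integral_sq_le (g : L2Half) {x y : ℝ} (hx : 0 ≤ x) (hxy : x ≤ y) :
    ‖∫ t in x..y, g t‖ ^ 2 ≤ (y - x) * ‖g‖ ^ 2 := by
  have hsub : Ioc x y ⊆ Ioi 0 := fun t ht => lt_of_le_of_lt hx ht.1
  have hμ : halfLine (Ioc x y) = ENNReal.ofReal (y - x) := by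
    rw [halfLine, Measure.restrict_apply measurableSet_Ioc, inter_eq_left.2 hsub, Real.volume_Ioc]
  have hμ' : halfLine (Ioc x y) ≠ ⊤ := by rw [hμ]; exact ENNReal.ofReal_ne_top
  have h1 := L2.inner_indicatorConstLp_one (𝕜 := ℂ) measurableSet_Ioc hμ' g
  rw [halfLine_restrict measurableSet_Ioc hsub, ← intervalIntegral.integral_of_le hxy] at h1
  have h2 : ‖indicatorConstLp 2 measurableSet_Ioc hμ' (1 : ℂ)‖ ^ 2 = y - x := by
    rw [norm_indicatorConstLp (by norm_num) (by norm_num), Measure.real, hμ,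
      ENNReal.toReal_ofReal (by linarith), norm_one, one_mul]
    simp only [ENNReal.toReal_ofNat]
    rw [← Real.sqrt_eq_rpow, Real.sq_sqrt (by linarith)]
  rw [← h1, ← h2, ← mul_pow]
  gcongr
  exact norm_inner_le_norm _ _

/-- The bound of the values of a primitive by the norms of the function and its derivative. -/
theorem norm_sq_le_of_isPrimitiveOn {f g : L2Half} {u : ℝ → ℂ}
    (hu : ∀ R > 0, IsPrimitiveOn u g 0 R) (hf : f =ᵐ[halfLine] u) {x h : ℝ} (hx : 0 ≤ x)
    (hh : 0 < h) : ‖u x‖ ^ 2 ≤ 2 * (h⁻¹ * ‖f‖ ^ 2 + h * ‖g‖ ^ 2) := by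
  have hxh : 0 < x + h := by linarith
  have hsub : Ioc x (x + h) ⊆ Ioi 0 := fun t ht => lt_of_le_of_lt hx ht.1
  -- This is integrated over `y` in an interval of length `h` and divided by `h`.
  have hpt : ∀ y ∈ Ioc x (x + h), ‖u x‖ ^ 2 ≤ 2 * ‖u y‖ ^ 2 + 2 * (h * ‖g‖ ^ 2) := by
    intro y hy
    have h1 := (hu (x + h) hxh).sub_eq (x := x) (y := y) ⟨hx, by linarith⟩
      ⟨by linarith [hy.1], hy.2⟩
    have h2 := norm_integral_sq_le g hx hy.1.le
    rw [← h1] at h2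
    have h3 : ‖u x‖ ≤ ‖u y‖ + ‖u y - u x‖ := by
      have := norm_sub_le (u y) (u y - u x)
      rwa [sub_sub_cancel] at this
    have h4 : (y - x) * ‖g‖ ^ 2 ≤ h * ‖g‖ ^ 2 := by
      gcongr; linarith [hy.2]
    calc ‖u x‖ ^ 2 ≤ (‖u y‖ + ‖u y - u x‖) ^ 2 := by gcongr
      _ ≤ 2 * ‖u y‖ ^ 2 + 2 * ‖u y - u x‖ ^ 2 := by
          linarith [sq_nonneg (‖u y‖ - ‖u y - u x‖)]
      _ ≤ _ := by linarith
  have hi : IntegrableOn (fun y => ‖u y‖ ^ 2) (Ioc x (x + h)) halfLine := by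
    refine (integrable_norm_sq f).integrableOn.congr ?_
    filter_upwards [ae_restrict_of_ae hf] with y hy
    rw [hy]
  have hc : ∀ c : ℝ, IntegrableOn (fun _ => c) (Ioc x (x + h)) halfLine := fun c =>
    integrableOn_const (by
      rw [halfLine, Measure.restrict_apply measurableSet_Ioc, inter_eq_left.2 hsub]; simp)
  have hvol : (halfLine.restrict (Ioc x (x + h))).real univ = h := by
    rw [halfLine_restrict measurableSet_Ioc hsub]
    simp [Measure.real, hh.le]
  have hint : ∫ _ in Ioc x (x + h), ‖u x‖ ^ 2 ∂halfLine
      ≤ ∫ y in Ioc x (x + h), (2 * ‖u y‖ ^ 2 + 2 * (h * ‖g‖ ^ 2)) ∂halfLine :=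
    setIntegral_mono_on (hc _) ((hi.const_mul 2).add (hc _)) measurableSet_Ioc hpt
  rw [integral_add (hi.const_mul 2) (hc _), integral_const, integral_const, hvol,
    integral_const_mul] at hint
  have hle : ∫ y in Ioc x (x + h), ‖u y‖ ^ 2 ∂halfLine ≤ ‖f‖ ^ 2 := by
    rw [norm_sq_eq_integral]
    calc ∫ y in Ioc x (x + h), ‖u y‖ ^ 2 ∂halfLine = ∫ y in Ioc x (x + h), ‖f y‖ ^ 2 ∂halfLine := by
          refine integral_congr_ae ?_
          filter_upwards [ae_restrict_of_ae hf] with y hy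
          rw [hy]
      _ ≤ _ := setIntegral_le_integral (integrable_norm_sq f)
          (Eventually.of_forall fun y => by positivity)
  simp only [smul_eq_mul] at hint
  have h5 : h * ‖u x‖ ^ 2 ≤ 2 * ‖f‖ ^ 2 + h * (2 * (h * ‖g‖ ^ 2)) := by linarith
  have h6 : ‖u x‖ ^ 2 ≤ (2 * ‖f‖ ^ 2 + h * (2 * (h * ‖g‖ ^ 2))) / h := by
    rw [le_div_iff₀ hh]; linarith
  refine h6.trans (le_of_eq ?_)
  field_simp

/-! ### Continuous representatives, point evaluation and interpolation bounds. -/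

namespace H1Half

/-- The function underlying an element of `H¹(ℝ⁺)`. -/
abbrev fn (p : H1Half) : L2Half := (p : WithLp 2 (L2Half × L2Half)).fst

/-- The weak derivative of an element of `H¹(ℝ⁺)`. -/
abbrev dv (p : H1Half) : L2Half := (p : WithLp 2 (L2Half × L2Half)).snd

/-- The continuous representative of an element of `H¹(ℝ⁺)`. -/
noncomputable def rep (p : H1Half) (x : ℝ) : ℂ :=
  (IsWeakDeriv.exists_primitive (f := (fn p)) (g := (dv p)) p.2).choose + ∫ t in (0 : ℝ)..x, (dv p) t

theorem fn_ae_eq_rep (p : H1Half) : (fn p) =ᵐ[halfLine] (rep p) :=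
  (IsWeakDeriv.exists_primitive (f := (fn p)) (g := (dv p)) p.2).choose_spec

theorem isPrimitiveOn_rep (p : H1Half) : ∀ R > 0, IsPrimitiveOn (rep p) (dv p) 0 R := fun _ hR =>
  isPrimitiveOn_integral (dv p) _ (le_of_lt hR)

theorem continuousOn_rep (p : H1Half) : ContinuousOn (rep p) (Ici 0) :=
  continuousOn_Ici_of_isPrimitiveOn (isPrimitiveOn_rep p)

theorem eqOn_rep (p : H1Half) {u : ℝ → ℂ} (hu : ContinuousOn u (Ici 0))
    (h : (fn p) =ᵐ[halfLine] u) : EqOn u (rep p) (Ici 0) := by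
  have h1 : u =ᵐ[volume.restrict (Ici 0)] (rep p) := by
    rw [← restrict_Ioi_eq_restrict_Ici]
    exact h.symm.trans (fn_ae_eq_rep p)
  refine Measure.eqOn_of_ae_eq h1 hu (continuousOn_rep p) ?_
  rw [interior_Ici, closure_Ioi]

theorem hasBoundaryValue_iff (p : H1Half) {c : ℂ} : HasBoundaryValue (fn p) c ↔ (rep p) 0 = c := by
  constructor
  · rintro ⟨u, hu, h, rfl⟩
    exact ((eqOn_rep p) hu h self_mem_Ici).symm
  · rintro rfl
    exact ⟨(rep p), (continuousOn_rep p), (fn_ae_eq_rep p), rfl⟩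

theorem rep_add (p q : H1Half) {x : ℝ} (hx : 0 ≤ x) : (rep (p + q)) x = (rep p) x + (rep q) x := by
  refine ((eqOn_rep (p + q)) ((continuousOn_rep p).add (continuousOn_rep q)) ?_ hx).symm
  filter_upwards [Lp.coeFn_add (fn p) (fn q), (fn_ae_eq_rep p), (fn_ae_eq_rep q)] with x h1 h2 h3
  change ((fn p) + (fn q) : L2Half) x = _
  rw [h1, Pi.add_apply, Pi.add_apply, h2, h3]

theorem rep_smul (a : ℂ) (p : H1Half) {x : ℝ} (hx : 0 ≤ x) : (rep (a • p)) x = a * (rep p) x := by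
  refine ((eqOn_rep (a • p)) (continuousOn_const.mul (continuousOn_rep p)) ?_ hx).symm
  filter_upwards [Lp.coeFn_smul a (fn p), (fn_ae_eq_rep p)] with x h1 h2
  change (a • (fn p) : L2Half) x = _
  rw [h1, Pi.smul_apply, h2, smul_eq_mul]
  rfl

theorem norm_sq_eq (p : H1Half) : ‖p‖ ^ 2 = ‖fn p‖ ^ 2 + ‖dv p‖ ^ 2 :=
  WithLp.prod_norm_sq_eq_of_L2 (p : WithLp 2 (L2Half × L2Half))

theorem norm_fn_le (p : H1Half) : ‖fn p‖ ≤ ‖p‖ := by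
  refine abs_le_of_sq_le_sq' ?_ (norm_nonneg _) |>.2
  rw [(norm_sq_eq p)]; linarith [sq_nonneg ‖dv p‖]

theorem norm_dv_le (p : H1Half) : ‖dv p‖ ≤ ‖p‖ := by
  refine abs_le_of_sq_le_sq' ?_ (norm_nonneg _) |>.2
  rw [(norm_sq_eq p)]; linarith [sq_nonneg ‖fn p‖]

theorem norm_rep_sq_le_add (p : H1Half) {x h : ℝ} (hx : 0 ≤ x) (hh : 0 < h) :
    ‖(rep p) x‖ ^ 2 ≤ 2 * (h⁻¹ * ‖fn p‖ ^ 2 + h * ‖dv p‖ ^ 2) :=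
  norm_sq_le_of_isPrimitiveOn (isPrimitiveOn_rep p) (fn_ae_eq_rep p) hx hh

/-- The choice `h = ‖fn p‖ / ‖p‖` balances the two terms of the trace bound. This interpolation
turns `L²`-smallness into uniform smallness and gives the Gagliardo–Nirenberg bound. -/
theorem norm_rep_sq_le (p : H1Half) {x : ℝ} (hx : 0 ≤ x) :
    ‖(rep p) x‖ ^ 2 ≤ 4 * (‖fn p‖ * ‖p‖) := by
  rcases (norm_nonneg (fn p)).eq_or_lt with h0 | hpos
  · have hfn : (fn p) = 0 := norm_eq_zero.1 h0.symm
    have h1 : (fn p) =ᵐ[halfLine] fun _ => (0 : ℂ) := by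
      rw [hfn]; exact Lp.coeFn_zero ℂ 2 halfLine
    have h2 := (eqOn_rep p) continuousOn_const h1 hx
    rw [← h2]
    rw [norm_zero, zero_pow two_ne_zero]
    positivity
  · have hp : 0 < ‖p‖ := hpos.trans_le (norm_fn_le p)
    have h1 := (norm_rep_sq_le_add p) hx (div_pos hpos hp)
    refine h1.trans ?_
    have h2 : ‖dv p‖ ^ 2 ≤ ‖p‖ ^ 2 := by gcongr; exact (norm_dv_le p)
    calc 2 * ((‖fn p‖ / ‖p‖)⁻¹ * ‖fn p‖ ^ 2 + ‖fn p‖ / ‖p‖ * ‖dv p‖ ^ 2)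
        ≤ 2 * ((‖fn p‖ / ‖p‖)⁻¹ * ‖fn p‖ ^ 2 + ‖fn p‖ / ‖p‖ * ‖p‖ ^ 2) := by gcongr
      _ = 4 * (‖fn p‖ * ‖p‖) := by field_simp; ring

theorem norm_rep_le (p : H1Half) {x : ℝ} (hx : 0 ≤ x) : ‖(rep p) x‖ ≤ 2 * ‖p‖ := by
  refine abs_le_of_sq_le_sq' ?_ (by positivity) |>.2
  have := (norm_fn_le p)
  calc ‖(rep p) x‖ ^ 2 ≤ 4 * (‖fn p‖ * ‖p‖) := (norm_rep_sq_le p) hx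
    _ ≤ 4 * (‖p‖ * ‖p‖) := by gcongr
    _ = (2 * ‖p‖) ^ 2 := by ring

/-- Evaluation at a point of the closed half-line. -/
noncomputable def evalL (x : ℝ) (hx : 0 ≤ x) : H1Half →L[ℂ] ℂ :=
  LinearMap.mkContinuous
    { toFun := fun p => (rep p) x
      map_add' := fun p q => rep_add p q hx
      map_smul' := fun a p => rep_smul a p hx } 2 fun p => (norm_rep_le p) hx

theorem evalL_apply {x : ℝ} (hx : 0 ≤ x) (p : H1Half) : evalL x hx p = (rep p) x := rfl

/-- Construct an element of `H¹(ℝ⁺)` from a function and its weak derivative. -/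
def mk (f g : L2Half) (h : IsWeakDeriv f g) : H1Half := ⟨WithLp.toLp 2 (f, g), h⟩

theorem ext_fn_dv {p q : H1Half} (h1 : (fn p) = (fn q)) (h2 : (dv p) = (dv q)) : p = q := by
  have : (p - q : H1Half) = 0 := by
    rw [← norm_eq_zero, ← sq_eq_zero_iff, norm_sq_eq]
    have e1 : (fn (p - q)) = (fn p) - (fn q) := rfl
    have e2 : (dv (p - q)) = (dv p) - (dv q) := rfl
    rw [e1, e2, h1, h2]
    simp
  exact sub_eq_zero.1 this

end H1Half

theorem continuous_integral_test {χ : ℝ → ℝ} (hc : Continuous χ) (hs : HasCompactSupport χ) :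
    Continuous fun f : L2Half => ∫ x, ((χ x : ℝ) : ℂ) * f x ∂halfLine := by
  have h1 : MemLp (fun x => ((χ x : ℝ) : ℂ)) 2 halfLine := by
    have : MemLp χ 2 halfLine := hc.memLp_of_hasCompactSupport hs
    exact this.ofReal
  have h2 : (fun f : L2Half => ∫ x, ((χ x : ℝ) : ℂ) * f x ∂halfLine) = fun f => ⟪h1.toLp, f⟫ := by
    ext f
    rw [L2.inner_def]
    refine integral_congr_ae ?_
    filter_upwards [h1.coeFn_toLp] with x hx
    rw [hx, RCLike.inner_apply, Complex.conj_ofReal, mul_comm]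
  rw [h2]
  fun_prop

/-- For each test function the defining identity is a closed condition, both sides being continuous
in `L²`. -/
theorem isClosed_H1Half : IsClosed (H1Half : Set (WithLp 2 (L2Half × L2Half))) := by
  have : (H1Half : Set (WithLp 2 (L2Half × L2Half))) = ⋂ (φ : ℝ → ℝ) (_ : ContDiff ℝ ∞ φ)
      (_ : HasCompactSupport φ) (_ : tsupport φ ⊆ Ioi 0), {p |
        ∫ x, ((deriv φ x : ℝ) : ℂ) * p.fst x ∂halfLine
          = -∫ x, ((φ x : ℝ) : ℂ) * p.snd x ∂halfLine} := by
    ext p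
    simp only [mem_iInter]
    rfl
  rw [this]
  refine isClosed_iInter fun φ => isClosed_iInter fun h1 => isClosed_iInter fun h2 =>
    isClosed_iInter fun _ => ?_
  have hf : Continuous fun p : WithLp 2 (L2Half × L2Half) => p.fst :=
    (WithLp.fstL 2 ℂ L2Half L2Half).continuous
  have hs : Continuous fun p : WithLp 2 (L2Half × L2Half) => p.snd :=
    (WithLp.sndL 2 ℂ L2Half L2Half).continuous
  exact isClosed_eq
    ((continuous_integral_test (h1.continuous_deriv (by simp)) h2.deriv).comp hf)
    ((continuous_integral_test h1.continuous h2).comp hs).neg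

noncomputable instance : CompleteSpace H1Half := isClosed_H1Half.completeSpace_coe

end Sobolev

theorem IsSolution.mono {N : ℕ} {α μ : ℝ} {Ψ₀ : Energy N} {T T' : EReal} {Ψ : ℝ → Energy N}
    (h : IsSolution N α μ Ψ₀ T Ψ) (hT : T' ≤ T) : IsSolution N α μ Ψ₀ T' Ψ :=
  ⟨h.continuousOn.mono (timeInterval_mono hT), h.contDiffOn.mono (timeInterval_mono hT),
    fun t ht => h.duhamel t (timeInterval_mono hT ht)⟩

noncomputable local instance (N : ℕ) : NormedAddCommGroup (Energy N) :=
  Submodule.normedAddCommGroup (energySpace N)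

noncomputable local instance (N : ℕ) : SeminormedAddCommGroup (Energy N) :=
  NormedAddCommGroup.toSeminormedAddCommGroup

noncomputable local instance (N : ℕ) : InnerProductSpace ℂ (Energy N) :=
  @Submodule.innerProductSpace ℂ (H1Graph N) _ _ (PiLp.innerProductSpace fun _ : Fin N => H1Half)
    (energySpace N)

noncomputable local instance (N : ℕ) : Inner ℂ (Energy N) :=
  InnerProductSpace.toInner (𝕜 := ℂ) (E := Energy N)

theorem mem_energySpace_iff {N : ℕ} {Ψ : H1Graph N} :
    Ψ ∈ energySpace N ↔ ∃ c : ℂ, ∀ j, (H1Half.rep (Ψ j)) 0 = c :=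
  exists_congr fun _ => forall_congr' fun j => (H1Half.hasBoundaryValue_iff (Ψ j))

theorem isClosed_energySpace (N : ℕ) : IsClosed (energySpace N : Set (H1Graph N)) := by
  have : (energySpace N : Set (H1Graph N)) = ⋂ (j : Fin N) (k : Fin N),
      {Ψ | H1Half.evalL 0 le_rfl (Ψ j) = H1Half.evalL 0 le_rfl (Ψ k)} := by
    ext Ψ
    simp only [SetLike.mem_coe, mem_energySpace_iff, mem_iInter, H1Half.evalL_apply]
    constructor
    · rintro ⟨c, hc⟩ j k
      exact (hc j).trans (hc k).symm
    · intro h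
      rcases N.eq_zero_or_pos with rfl | hN
      · exact ⟨0, fun j => j.elim0⟩
      · exact ⟨(H1Half.rep (Ψ ⟨0, hN⟩)) 0, fun j => h j _⟩
  rw [this]
  refine isClosed_iInter fun j => isClosed_iInter fun k => ?_
  have hj : ∀ j : Fin N, Continuous fun Ψ : H1Graph N => Ψ j := fun j =>
    (PiLp.proj 2 (fun _ : Fin N => H1Half) (𝕜 := ℂ) j).continuous
  exact isClosed_eq ((H1Half.evalL 0 le_rfl).continuous.comp (hj j))
    ((H1Half.evalL 0 le_rfl).continuous.comp (hj k))

noncomputable instance (N : ℕ) : CompleteSpace (Energy N) :=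
  (isClosed_energySpace N).completeSpace_coe

/-! ## Integration by parts and test functions -/

section TestFunctions

local notation "⟪" x ", " y "⟫" => inner ℂ x y

namespace H1Half

theorem integrable_conj_mul (f g : L2Half) :
    Integrable (fun x => (starRingEnd ℂ) (f x) * g x) halfLine := by
  refine (L2.integrable_inner (𝕜 := ℂ) f g).congr (Eventually.of_forall fun x => ?_)
  simp only [RCLike.inner_apply]
  ring

theorem integral_conj_mul (f g : L2Half) :
    ∫ x, (starRingEnd ℂ) (f x) * g x ∂halfLine = ⟪f, g⟫ := by
  rw [L2.inner_def]
  refine integral_congr_ae (Eventually.of_forall fun x => ?_)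
  simp only [RCLike.inner_apply]
  ring

/-- Integration by parts. The product `h` is a primitive of an integrable function, so it has a
limit at infinity; since `h` is also integrable, the limit is `0` and only the boundary term at the
origin survives. -/
theorem inner_dv_add_inner_fn (p q : H1Half) :
    ⟪dv p, fn q⟫ + ⟪fn p, dv q⟫ = -((starRingEnd ℂ) (rep p 0) * rep q 0) := by
  set h : ℝ → ℂ := fun x => (starRingEnd ℂ) (rep p x) * rep q x with hh
  set g : ℝ → ℂ := fun x => (starRingEnd ℂ) (dv p x) * fn q x + (starRingEnd ℂ) (fn p x) * dv q x
    with hg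
  have hgi : Integrable g halfLine := (integrable_conj_mul _ _).add (integrable_conj_mul _ _)
  have hgI : ∫ x, g x ∂halfLine = ⟪dv p, fn q⟫ + ⟪fn p, dv q⟫ := by
    rw [hg, integral_add (integrable_conj_mul _ _) (integrable_conj_mul _ _), integral_conj_mul,
      integral_conj_mul]
  have hprim : ∀ R > 0, IsPrimitiveOn h g 0 R := by
    intro R hR
    refine IsPrimitiveOn.congr_deriv
      (IsPrimitiveOn.mul ((isPrimitiveOn_rep p R hR).conj hR.le) (isPrimitiveOn_rep q R hR) hR.le)
      hR.le ?_
    have hsub : Ioc 0 R ⊆ Ioi (0 : ℝ) := fun x hx => hx.1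
    filter_upwards [ae_restrict_of_ae_restrict_of_subset hsub (fn_ae_eq_rep p),
      ae_restrict_of_ae_restrict_of_subset hsub (fn_ae_eq_rep q)] with x h1 h2
    simp only [hg, h1, h2]
  have hlim : Tendsto h atTop (𝓝 (h 0 + ∫ x, g x ∂halfLine)) := by
    have h1 := (intervalIntegral_tendsto_integral_Ioi 0 hgi tendsto_id).const_add (h 0)
    refine h1.congr' ?_
    filter_upwards [eventually_gt_atTop 0] with R hR
    exact ((hprim R hR).eq R ⟨hR.le, le_rfl⟩).symm
  have hint : IntegrableOn h (Ioi 0) := by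
    refine (integrable_conj_mul (fn p) (fn q)).congr ?_
    filter_upwards [fn_ae_eq_rep p, fn_ae_eq_rep q] with x h1 h2
    rw [h1, h2]
  have h0 := IntegrableAtFilter.eq_zero_of_tendsto (μ := volume) ⟨Ioi 0, Ioi_mem_atTop 0, hint⟩
    (fun s hs => by
      obtain ⟨a, ha⟩ := mem_atTop_sets.1 hs
      exact top_le_iff.1 ((Real.volume_Ici (a := a)).symm.le.trans (measure_mono ha))) hlim
  rw [hgI] at h0
  exact (neg_eq_of_add_eq_zero_right h0).symm

/-- Construct an element of `H¹(ℝ⁺)` from a square integrable primitive of a square integrable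
function. -/
theorem exists_of_isPrimitiveOn {u g : ℝ → ℂ} (h : ∀ R > 0, IsPrimitiveOn u g 0 R)
    (hu : MemLp u 2 halfLine) (hg : MemLp g 2 halfLine) :
    ∃ p : H1Half, fn p =ᵐ[halfLine] u ∧ dv p =ᵐ[halfLine] g ∧ EqOn (rep p) u (Ici 0) := by
  have hw : IsWeakDeriv hu.toLp hg.toLp := by
    refine isWeakDeriv_of_isPrimitiveOn (u := u) (fun R hR => ?_) hu.coeFn_toLp
    refine (h R hR).congr_deriv hR.le ?_
    exact ae_restrict_of_ae_restrict_of_subset (fun x hx => hx.1) hg.coeFn_toLp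
  refine ⟨mk _ _ hw, hu.coeFn_toLp, hg.coeFn_toLp, ?_⟩
  exact (eqOn_rep (mk _ _ hw) (continuousOn_Ici_of_isPrimitiveOn h) hu.coeFn_toLp).symm

theorem exists_of_test {χ : ℝ → ℝ} (h1 : ContDiff ℝ ∞ χ) (h2 : HasCompactSupport χ) :
    ∃ p : H1Half, (fn p =ᵐ[halfLine] fun x => ((χ x : ℝ) : ℂ)) ∧
      (dv p =ᵐ[halfLine] fun x => ((deriv χ x : ℝ) : ℂ)) ∧
      EqOn (rep p) (fun x => ((χ x : ℝ) : ℂ)) (Ici 0) := by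
  have hd : Continuous (deriv χ) := h1.continuous_deriv (by simp)
  have m1 : MemLp χ 2 halfLine := h1.continuous.memLp_of_hasCompactSupport h2
  have m2 : MemLp (deriv χ) 2 halfLine := hd.memLp_of_hasCompactSupport h2.deriv
  exact exists_of_isPrimitiveOn (fun R hR => isPrimitiveOn_ofReal h1 0 R) m1.ofReal m2.ofReal

/-- Test functions supported in the open half-line are among the admissible `q`, and they already
determine `f`. -/
theorem eq_zero_of_inner_fn_eq_zero {f : L2Half}
    (h : ∀ q : H1Half, rep q 0 = 0 → ⟪fn q, f⟫ = 0) : f = 0 := by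
  rw [Lp.eq_zero_iff_ae_eq_zero]
  have key := isOpen_Ioi.ae_eq_zero_of_integral_contDiff_smul_eq_zero (μ := volume)
    (U := Ioi (0 : ℝ)) (locallyIntegrableOn_coe f) fun φ h1 h2 h3 => ?_
  · exact (ae_restrict_iff' measurableSet_Ioi).2 key
  · obtain ⟨q, q1, -, q3⟩ := exists_of_test h1 h2
    have h0 : φ 0 = 0 := by
      by_contra hne
      exact lt_irrefl (0 : ℝ) (h3 (subset_tsupport _ hne))
    have hq := h q (by rw [q3 self_mem_Ici]; simp [h0])
    rw [← integral_conj_mul] at hq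
    rw [← hq, ← setIntegral_eq_integral_of_forall_compl_eq_zero (s := Ioi (0 : ℝ))]
    · refine integral_congr_ae ?_
      filter_upwards [q1] with x hx
      rw [hx, Complex.conj_ofReal, Complex.real_smul]
    · intro x hx
      have : φ x = 0 := by
        by_contra hne
        exact hx (h3 (subset_tsupport _ hne))
      rw [this, zero_smul]

theorem rep_sub (p q : H1Half) {x : ℝ} (hx : 0 ≤ x) : rep (p - q) x = rep p x - rep q x :=
  map_sub (evalL x hx) p q

/-- The weak derivative is determined by the function. -/
theorem fn_injective : Function.Injective fn := by
  intro p q h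
  have hfn : fn (p - q) = 0 := sub_eq_zero.2 h
  have hdv : dv (p - q) = 0 := by
    -- The interpolation bound removes the boundary term in the integration by parts below.
    have h0 : rep (p - q) 0 = 0 := by
      have h1 := norm_rep_sq_le (p - q) (le_refl 0)
      rw [hfn, norm_zero, zero_mul, mul_zero] at h1
      exact norm_eq_zero.1 (pow_eq_zero_iff two_ne_zero |>.1 (le_antisymm h1 (sq_nonneg _)))
    refine eq_zero_of_inner_fn_eq_zero fun r _ => ?_
    have := inner_dv_add_inner_fn r (p - q)
    rw [hfn, h0, inner_zero_right, zero_add, mul_zero, neg_zero] at this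
    exact this
  exact ext_fn_dv h (sub_eq_zero.1 hdv)

theorem isWeakDeriv_of_inner {f g : L2Half}
    (h : ∀ q : H1Half, rep q 0 = 0 → ⟪dv q, f⟫ = -⟪fn q, g⟫) : IsWeakDeriv f g := by
  intro φ h1 h2 h3
  obtain ⟨q, q1, q2, q3⟩ := exists_of_test h1 h2
  have h0 : φ 0 = 0 := by
    by_contra hne
    exact lt_irrefl (0 : ℝ) (h3 (subset_tsupport _ hne))
  have hq := h q (by rw [q3 self_mem_Ici]; simp [h0])
  rw [← integral_conj_mul, ← integral_conj_mul] at hq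
  convert hq using 1
  · refine integral_congr_ae ?_
    filter_upwards [q2] with x hx
    rw [hx, Complex.conj_ofReal]
  · congr 1
    refine integral_congr_ae ?_
    filter_upwards [q1] with x hx
    rw [hx, Complex.conj_ofReal]

theorem exists_rep_zero_eq_one : ∃ p : H1Half, rep p 0 = 1 := by
  let b : ContDiffBump (0 : ℝ) := ⟨1, 2, by norm_num, by norm_num⟩
  obtain ⟨p, -, -, h⟩ := exists_of_test b.contDiff b.hasCompactSupport
  refine ⟨p, ?_⟩
  rw [h self_mem_Ici]
  simp only [b.one_of_mem_closedBall (Metric.mem_closedBall_self zero_le_one), Complex.ofReal_one]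

end H1Half

end TestFunctions

/-! ## Composition with a continuously differentiable function -/

section Composition

local notation "⟪" x ", " y "⟫" => inner ℂ x y

theorem exists_bound_fderiv {F : ℂ → ℂ} (hF : ContDiff ℝ 1 F) (R : ℝ) :
    ∃ K, 0 ≤ K ∧ (∀ z, ‖z‖ ≤ R → ‖fderiv ℝ F z‖ ≤ K) ∧
      ∀ z w, ‖z‖ ≤ R → ‖w‖ ≤ R → ‖F z - F w‖ ≤ K * ‖z - w‖ := by
  obtain ⟨K, hK⟩ := (isCompact_closedBall (0 : ℂ) R).exists_bound_of_continuousOn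
    (hF.continuous_fderiv one_ne_zero).continuousOn
  have hK' : ∀ z, ‖z‖ ≤ R → ‖fderiv ℝ F z‖ ≤ max K 0 := fun z hz =>
    (hK z (by simpa using hz)).trans (le_max_left _ _)
  refine ⟨max K 0, le_max_right _ _, hK', fun z w hz hw => ?_⟩
  exact (convex_closedBall (0 : ℂ) R).norm_image_sub_le_of_norm_fderiv_le (𝕜 := ℝ)
    (fun x _ => hF.differentiable one_ne_zero x) (fun x hx => hK' x (by simpa using hx))
    (by simpa using hw) (by simpa using hz)

theorem exists_modulus_fderiv {F : ℂ → ℂ} (hF : ContDiff ℝ 1 F) (R : ℝ) {ε : ℝ} (hε : 0 < ε) :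
    ∃ δ > 0, ∀ z w, ‖z‖ ≤ R → ‖w‖ ≤ R → ‖z - w‖ ≤ δ → ‖fderiv ℝ F z - fderiv ℝ F w‖ ≤ ε := by
  have h := (isCompact_closedBall (0 : ℂ) R).uniformContinuousOn_of_continuous
    (hF.continuous_fderiv one_ne_zero).continuousOn
  obtain ⟨δ, hδ, h⟩ := Metric.uniformContinuousOn_iff.1 h ε hε
  refine ⟨δ / 2, by positivity, fun z w hz hw hzw => ?_⟩
  rw [← dist_eq_norm]
  refine (h z (by simpa using hz) w (by simpa using hw) ?_).le
  rw [dist_eq_norm]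
  linarith

/-- A pointwise bound by a linear combination of two functions, in norm. -/
theorem norm_le_of_ae_le {f g k : L2Half} {a b : ℝ} (ha : 0 ≤ a) (hb : 0 ≤ b)
    (h : ∀ᵐ x ∂halfLine, ‖f x‖ ≤ a * ‖g x‖ + b * ‖k x‖) : ‖f‖ ≤ 2 * (a * ‖g‖ + b * ‖k‖) := by
  have h1 : ∫ x, ‖f x‖ ^ 2 ∂halfLine
      ≤ ∫ x, (2 * a ^ 2 * ‖g x‖ ^ 2 + 2 * b ^ 2 * ‖k x‖ ^ 2) ∂halfLine := by
    refine integral_mono_ae (integrable_norm_sq f)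
      (((integrable_norm_sq g).const_mul _).add ((integrable_norm_sq k).const_mul _)) ?_
    filter_upwards [h] with x hx
    calc ‖f x‖ ^ 2 ≤ (a * ‖g x‖ + b * ‖k x‖) ^ 2 := by gcongr
      _ ≤ 2 * a ^ 2 * ‖g x‖ ^ 2 + 2 * b ^ 2 * ‖k x‖ ^ 2 := by
          linarith [sq_nonneg (a * ‖g x‖ - b * ‖k x‖)]
  rw [integral_add ((integrable_norm_sq g).const_mul _) ((integrable_norm_sq k).const_mul _),
    integral_const_mul, integral_const_mul, ← norm_sq_eq_integral, ← norm_sq_eq_integral,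
    ← norm_sq_eq_integral] at h1
  refine abs_le_of_sq_le_sq' ?_ (by positivity) |>.2
  have : 0 ≤ (a * ‖g‖) * (b * ‖k‖) := by positivity
  linarith [sq_nonneg (a * ‖g‖), sq_nonneg (b * ‖k‖)]

namespace H1Half

theorem aestronglyMeasurable_rep (p : H1Half) : AEStronglyMeasurable (rep p) halfLine :=
  (Lp.aestronglyMeasurable (fn p)).congr (fn_ae_eq_rep p)

/-- The values of `p` lie in a ball of radius `2‖p‖`, where `F'` is bounded by some `K`; with `F 0 =
0` both `F ∘ p` and its derivative are then dominated by `K` times functions in `L²`. -/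
theorem exists_comp {F : ℂ → ℂ} (hF : ContDiff ℝ 1 F) (h0 : F 0 = 0) (p : H1Half) :
    ∃ q : H1Half, (fn q =ᵐ[halfLine] fun x => F (rep p x)) ∧
      (dv q =ᵐ[halfLine] fun x => fderiv ℝ F (rep p x) (dv p x)) ∧
      EqOn (rep q) (fun x => F (rep p x)) (Ici 0) := by
  obtain ⟨K, hK0, hK, hlip⟩ := exists_bound_fderiv hF (2 * ‖p‖)
  refine exists_of_isPrimitiveOn (fun R hR => (isPrimitiveOn_rep p R hR).comp hF hR.le) ?_ ?_
  · refine (Lp.memLp (fn p)).of_le_mul (c := K)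
      (hF.continuous.comp_aestronglyMeasurable (aestronglyMeasurable_rep p)) ?_
    filter_upwards [fn_ae_eq_rep p, ae_restrict_mem measurableSet_Ioi] with x hx hx0
    have := hlip (rep p x) 0 (norm_rep_le p (le_of_lt hx0)) (by simp)
    rw [hx]
    rwa [h0, sub_zero, sub_zero] at this
  · refine (Lp.memLp (dv p)).of_le_mul (c := K) ?_ ?_
    · have h1 := (hF.continuous_fderiv one_ne_zero).comp_aestronglyMeasurable
        (aestronglyMeasurable_rep p)
      exact (isBoundedBilinearMap_apply (𝕜 := ℝ) (E := ℂ) (F := ℂ)).continuous.comp_aestronglyMeasurable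
        (h1.prodMk (Lp.aestronglyMeasurable (dv p)))
    · filter_upwards [ae_restrict_mem measurableSet_Ioi] with x hx0
      refine (ContinuousLinearMap.le_opNorm _ _).trans ?_
      gcongr
      exact hK _ (norm_rep_le p (le_of_lt hx0))

/-- The composition `F ∘ p` in `H¹(ℝ⁺)`. -/
noncomputable def comp {F : ℂ → ℂ} (hF : ContDiff ℝ 1 F) (h0 : F 0 = 0) (p : H1Half) : H1Half :=
  (exists_comp hF h0 p).choose

section

variable {F : ℂ → ℂ} (hF : ContDiff ℝ 1 F) (h0 : F 0 = 0)

theorem fn_comp (p : H1Half) : fn (comp hF h0 p) =ᵐ[halfLine] fun x => F (rep p x) :=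
  (exists_comp hF h0 p).choose_spec.1

theorem dv_comp (p : H1Half) :
    dv (comp hF h0 p) =ᵐ[halfLine] fun x => fderiv ℝ F (rep p x) (dv p x) :=
  (exists_comp hF h0 p).choose_spec.2.1

theorem rep_comp (p : H1Half) {x : ℝ} (hx : 0 ≤ x) : rep (comp hF h0 p) x = F (rep p x) :=
  (exists_comp hF h0 p).choose_spec.2.2 hx

theorem norm_le_add (p : H1Half) : ‖p‖ ≤ ‖fn p‖ + ‖dv p‖ := by
  refine abs_le_of_sq_le_sq' ?_ (by positivity) |>.2
  rw [norm_sq_eq]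
  linarith [mul_nonneg (norm_nonneg (fn p)) (norm_nonneg (dv p))]

/-- Composition is Lipschitz on bounded sets with respect to the `L²` norm, and almost Lipschitz
with respect to the `H¹` norm. -/
theorem comp_estimates (M : ℝ) : ∃ K, 0 ≤ K ∧ (∀ p q : H1Half, ‖p‖ ≤ M → ‖q‖ ≤ M →
      ‖fn (comp hF h0 p) - fn (comp hF h0 q)‖ ≤ K * ‖fn p - fn q‖) ∧
    (∀ p : H1Half, ‖p‖ ≤ M → ‖comp hF h0 p‖ ≤ K) ∧
    ∀ ε > 0, ∃ δ > 0, ∀ p q : H1Half, ‖p‖ ≤ M → ‖q‖ ≤ M → ‖fn p - fn q‖ ≤ δ →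
      ‖comp hF h0 p - comp hF h0 q‖ ≤ K * ‖p - q‖ + ε := by
  obtain ⟨K, hK0, hK, hlip⟩ := exists_bound_fderiv hF (2 * M)
  have hrep : ∀ p : H1Half, ‖p‖ ≤ M → ∀ x, 0 ≤ x → ‖rep p x‖ ≤ 2 * M := fun p hp x hx =>
    (norm_rep_le p hx).trans (by linarith)
  have hfn : ∀ p q : H1Half, ‖p‖ ≤ M → ‖q‖ ≤ M →
      ‖fn (comp hF h0 p) - fn (comp hF h0 q)‖ ≤ K * ‖fn p - fn q‖ := by
    intro p q hp hq
    refine Lp.norm_le_mul_norm_of_ae_le_mul ?_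
    filter_upwards [fn_comp hF h0 p, fn_comp hF h0 q, fn_ae_eq_rep p, fn_ae_eq_rep q,
      Lp.coeFn_sub (fn p) (fn q), Lp.coeFn_sub (fn (comp hF h0 p)) (fn (comp hF h0 q)),
      ae_restrict_mem measurableSet_Ioi] with x h1 h2 h3 h4 h5 h6 h7
    rw [h6, h5, Pi.sub_apply, Pi.sub_apply, h1, h2, h3, h4]
    exact hlip _ _ (hrep p hp x (le_of_lt h7)) (hrep q hq x (le_of_lt h7))
  have hdv : ∀ p q : H1Half, ‖p‖ ≤ M → ‖q‖ ≤ M → ∀ η, 0 ≤ η →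
      (∀ x, 0 ≤ x → ‖fderiv ℝ F (rep p x) - fderiv ℝ F (rep q x)‖ ≤ η) →
      ‖dv (comp hF h0 p) - dv (comp hF h0 q)‖ ≤ 2 * (K * ‖dv p - dv q‖ + η * ‖dv q‖) := by
    intro p q hp hq η hη0 hη
    refine norm_le_of_ae_le hK0 hη0 ?_
    filter_upwards [dv_comp hF h0 p, dv_comp hF h0 q, Lp.coeFn_sub (dv p) (dv q),
      Lp.coeFn_sub (dv (comp hF h0 p)) (dv (comp hF h0 q)),
      ae_restrict_mem measurableSet_Ioi] with x h1 h2 h5 h6 h7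
    rw [h6, h5, Pi.sub_apply, Pi.sub_apply, h1, h2]
    -- The second summand is controlled only by the modulus of continuity of `F'`; this is where the
    -- extra `ε` arises.
    have e : fderiv ℝ F (rep p x) (dv p x) - fderiv ℝ F (rep q x) (dv q x)
        = fderiv ℝ F (rep p x) (dv p x - dv q x)
          + (fderiv ℝ F (rep p x) - fderiv ℝ F (rep q x)) (dv q x) := by
      rw [map_sub, sub_apply]; ring
    rw [e]
    refine (norm_add_le _ _).trans (add_le_add ?_ ?_)
    · refine (ContinuousLinearMap.le_opNorm _ _).trans ?_
      gcongr
      exact hK _ (hrep p hp x (le_of_lt h7))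
    · refine (ContinuousLinearMap.le_opNorm _ _).trans ?_
      gcongr
      exact hη x (le_of_lt h7)
  have hcomb : ∀ p q : H1Half, ‖p‖ ≤ M → ‖q‖ ≤ M → ∀ η, 0 ≤ η →
      (∀ x, 0 ≤ x → ‖fderiv ℝ F (rep p x) - fderiv ℝ F (rep q x)‖ ≤ η) →
      ‖comp hF h0 p - comp hF h0 q‖ ≤ 3 * K * ‖p - q‖ + 2 * η * M := by
    intro p q hp hq η hη0 hη
    have h1 : ‖fn p - fn q‖ ≤ ‖p - q‖ := norm_fn_le (p - q)
    have h2 : ‖dv p - dv q‖ ≤ ‖p - q‖ := norm_dv_le (p - q)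
    have h3 : ‖dv q‖ ≤ M := (norm_dv_le q).trans hq
    calc ‖comp hF h0 p - comp hF h0 q‖
        ≤ ‖fn (comp hF h0 p) - fn (comp hF h0 q)‖ + ‖dv (comp hF h0 p) - dv (comp hF h0 q)‖ :=
          norm_le_add (comp hF h0 p - comp hF h0 q)
      _ ≤ K * ‖fn p - fn q‖ + 2 * (K * ‖dv p - dv q‖ + η * ‖dv q‖) :=
          add_le_add (hfn p q hp hq) (hdv p q hp hq η hη0 hη)
      _ ≤ K * ‖p - q‖ + 2 * (K * ‖p - q‖ + η * M) := by gcongr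
      _ = _ := by ring
  -- The bound of `‖comp p‖` uses `hcomb` with `q = 0` and `η = 2K`: it contributes `3KM + 4KM`,
  -- plus the norm of the composition at `0`.
  refine ⟨3 * K + 7 * K * |M| + ‖comp hF h0 0‖, by positivity, fun p q hp hq => ?_, fun p hp => ?_,
    fun ε hε => ?_⟩
  · refine (hfn p q hp hq).trans ?_
    gcongr
    have := norm_nonneg (comp hF h0 0)
    have : 0 ≤ 7 * K * |M| := by positivity
    linarith
  · have hM : 0 ≤ M := (norm_nonneg p).trans hp
    have h1 := hcomb p 0 hp (by simpa using hM) (2 * K) (by positivity) (fun x hx => by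
      refine (norm_sub_le _ _).trans ?_
      have a := hK _ (hrep p hp x hx)
      have b := hK _ (hrep 0 (by simpa using hM) x hx)
      linarith)
    rw [sub_zero] at h1
    have h2 : ‖comp hF h0 p‖ ≤ ‖comp hF h0 p - comp hF h0 0‖ + ‖comp hF h0 0‖ := by
      simpa using norm_add_le (comp hF h0 p - comp hF h0 0) (comp hF h0 0)
    have h3 : 3 * K * ‖p‖ ≤ 3 * K * M := by gcongr
    rw [abs_of_nonneg hM]
    linarith
  · obtain ⟨δ, hδ, hmod⟩ := exists_modulus_fderiv hF (2 * M) (ε := ε / (2 * (|M| + 1)))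
      (by positivity)
    -- By interpolation `|p(x) - q(x)|² ≤ 4 ‖fn (p - q)‖ ‖p - q‖` with `‖p - q‖ ≤ 2(M + 1)`, so this
    -- radius forces `|p(x) - q(x)| ≤ δ`.
    refine ⟨δ ^ 2 / (8 * (|M| + 1)), by positivity, fun p q hp hq hpq => ?_⟩
    have hM : 0 ≤ M := (norm_nonneg p).trans hp
    rw [abs_of_nonneg hM] at hmod hpq ⊢
    have h1 := hcomb p q hp hq _ (by positivity) (fun x hx => hmod _ _ (hrep p hp x hx)
      (hrep q hq x hx) (by
        refine abs_le_of_sq_le_sq' ?_ hδ.le |>.2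
        rw [← rep_sub p q hx]
        refine (norm_rep_sq_le (p - q) hx).trans ?_
        have a : ‖p - q‖ ≤ 2 * (M + 1) := (norm_sub_le _ _).trans (by linarith)
        calc 4 * (‖fn (p - q)‖ * ‖p - q‖) ≤ 4 * (δ ^ 2 / (8 * (M + 1)) * (2 * (M + 1))) := by
              gcongr
              exact hpq
          _ = δ ^ 2 := by field_simp; ring))
    refine h1.trans (add_le_add ?_ ?_)
    · gcongr
      have := norm_nonneg (comp hF h0 0)
      have : 0 ≤ 7 * K * M := by positivity
      linarith
    · have : 2 * (ε / (2 * (M + 1))) * M = ε * (M / (M + 1)) := by field_simp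
      rw [this]
      have : M / (M + 1) ≤ 1 := by
        rw [div_le_one (by positivity)]; linarith
      calc ε * (M / (M + 1)) ≤ ε * 1 := by gcongr
        _ = ε := mul_one ε

variable {G : ℂ → ℝ} (hG : ∀ z, HasFDerivAt G (innerSL ℝ (F z)) z) (hG0 : G 0 = 0)

-- The gradient `F` of `G` is Lipschitz on the ball, and the mean value inequality along the segment
-- yields the quadratic remainder.
include hF hG in
theorem potential_taylor (R : ℝ) : ∃ L, 0 ≤ L ∧ ∀ z w : ℂ, ‖z‖ ≤ R → ‖w‖ ≤ R →
    |G w - G z - (⟪F z, w - z⟫).re| ≤ L * ‖w - z‖ ^ 2 := by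
  obtain ⟨K, hK0, -, hlip⟩ := exists_bound_fderiv hF R
  refine ⟨K, hK0, fun z w hz hw => ?_⟩
  have hs : segment ℝ z w ⊆ Metric.closedBall 0 R :=
    (convex_closedBall (0 : ℂ) R).segment_subset (by simpa using hz) (by simpa using hw)
  have h := (convex_segment (𝕜 := ℝ) z w).norm_image_sub_le_of_norm_hasFDerivWithin_le'
    (f := G) (f' := fun x => innerSL ℝ (F x)) (φ := innerSL ℝ (F z)) (C := K * ‖w - z‖)
    (fun x _ => (hG x).hasFDerivWithinAt) (fun x hx => ?_)
    (left_mem_segment ℝ z w) (right_mem_segment ℝ z w)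
  · rw [Real.norm_eq_abs, innerSL_apply_apply] at h
    have e : (⟪F z, w - z⟫).re = inner ℝ (F z) (w - z) := rfl
    rw [e]
    refine h.trans (le_of_eq (by ring))
  · rw [← map_sub, innerSL_apply_norm]
    refine (hlip x z (by simpa using hs hx) hz).trans ?_
    gcongr
    exact norm_sub_le_of_mem_segment hx

include hF hG hG0 h0 in
theorem integrable_potential (p : H1Half) : Integrable (fun x => G (rep p x)) halfLine := by
  obtain ⟨L, hL, h⟩ := potential_taylor hF hG (2 * ‖p‖)
  have hGc : Continuous G := continuous_iff_continuousAt.2 fun z => (hG z).continuousAt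
  refine ((integrable_norm_sq (fn p)).const_mul L).mono'
    (hGc.comp_aestronglyMeasurable (aestronglyMeasurable_rep p)) ?_
  filter_upwards [fn_ae_eq_rep p, ae_restrict_mem measurableSet_Ioi] with x hx hx0
  have := h 0 (rep p x) (by simp) (norm_rep_le p (le_of_lt hx0))
  rw [h0, hG0, inner_zero_left, Complex.zero_re, sub_zero, sub_zero, sub_zero] at this
  rwa [Real.norm_eq_abs, hx]

-- The pointwise Taylor bound is integrated. The `H¹` bound serves only to keep all values in one
-- ball, so the error involves just the `L²` norm.
include hG hG0 in
theorem potential_estimate (M : ℝ) : ∃ L, 0 ≤ L ∧ ∀ p q : H1Half, ‖p‖ ≤ M → ‖q‖ ≤ M →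
    |(∫ x, G (rep q x) ∂halfLine) - (∫ x, G (rep p x) ∂halfLine)
      - (⟪fn (comp hF h0 p), fn q - fn p⟫).re| ≤ L * ‖fn q - fn p‖ ^ 2 := by
  obtain ⟨L, hL, h⟩ := potential_taylor hF hG (2 * M)
  refine ⟨L, hL, fun p q hp hq => ?_⟩
  have ip := integrable_potential hF h0 hG hG0 p
  have iq := integrable_potential hF h0 hG hG0 q
  have ii := (L2.integrable_inner (𝕜 := ℂ) (fn (comp hF h0 p)) (fn q - fn p))
  have e : (⟪fn (comp hF h0 p), fn q - fn p⟫).re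
      = ∫ x, (⟪(fn (comp hF h0 p) : ℝ → ℂ) x, (fn q - fn p : L2Half) x⟫).re ∂halfLine := by
    rw [L2.inner_def]
    exact (integral_re ii).symm
  have is : Integrable (fun x => G (rep q x) - G (rep p x)) halfLine := iq.sub ip
  have ir : Integrable (fun x => (⟪(fn (comp hF h0 p) : ℝ → ℂ) x,
      (fn q - fn p : L2Half) x⟫).re) halfLine := ii.re
  rw [e, ← integral_sub iq ip, ← integral_sub is ir, norm_sq_eq_integral,
    ← integral_const_mul, ← Real.norm_eq_abs]
  refine norm_integral_le_of_norm_le ((integrable_norm_sq _).const_mul L) ?_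
  filter_upwards [fn_comp hF h0 p, fn_ae_eq_rep p, fn_ae_eq_rep q, Lp.coeFn_sub (fn q) (fn p),
    ae_restrict_mem measurableSet_Ioi] with x h1 h2 h3 h4 h5
  rw [h4, Pi.sub_apply, h1, h2, h3, Real.norm_eq_abs]
  exact h _ _ ((norm_rep_le p (le_of_lt h5)).trans (by linarith))
    ((norm_rep_le q (le_of_lt h5)).trans (by linarith))

end

end H1Half

end Composition

/-! ## The power nonlinearity -/

section Power

/-- The function `z ↦ |z|^{2μ} z`. -/
noncomputable def powerFun (μ : ℝ) (z : ℂ) : ℂ := ((‖z‖ ^ (2 * μ) : ℝ) : ℂ) * z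

variable {μ : ℝ}

theorem powerFun_zero : powerFun μ 0 = 0 := mul_zero _

theorem norm_powerFun (μ : ℝ) (z : ℂ) : ‖powerFun μ z‖ = ‖z‖ ^ (2 * μ) * ‖z‖ := by
  rw [powerFun, norm_mul, Complex.norm_real, Real.norm_of_nonneg (by positivity)]

/-- Powers of `‖z‖²`, which is smooth everywhere, are easier to differentiate than powers of `‖z‖`.
-/
theorem powerFun_eq (μ : ℝ) (z : ℂ) : powerFun μ z = (‖z‖ ^ 2) ^ μ • z := by
  rw [powerFun, Complex.real_smul, ← Real.rpow_natCast, ← Real.rpow_mul (norm_nonneg z)]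
  norm_num

theorem hasFDerivAt_powerFun (μ : ℝ) {z : ℂ} (hz : z ≠ 0) :
    HasFDerivAt (powerFun μ) ((‖z‖ ^ 2) ^ μ • ContinuousLinearMap.id ℝ ℂ +
      ((μ * (‖z‖ ^ 2) ^ (μ - 1)) • (2 : ℝ) • innerSL ℝ z).smulRight z) z := by
  have h0 : ‖z‖ ^ 2 ≠ 0 := by positivity
  have h1 : HasFDerivAt (fun w : ℂ => ‖w‖ ^ 2) ((2 : ℝ) • innerSL ℝ z) z := by
    have := (hasStrictFDerivAt_norm_sq z).hasFDerivAt
    refine this.congr_fderiv ?_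
    ext w
    simp [two_mul]
    ring
  have h2 := (h1.rpow_const (p := μ) (Or.inl h0)).smul (hasFDerivAt_id z)
  refine (h2.congr_of_eventuallyEq (Eventually.of_forall fun w => powerFun_eq μ w))

theorem norm_fderiv_powerFun_le (hμ : 0 < μ) {z : ℂ} (hz : z ≠ 0) :
    ‖fderiv ℝ (powerFun μ) z‖ ≤ (1 + 2 * μ) * (‖z‖ ^ 2) ^ μ := by
  have h0 : 0 < ‖z‖ ^ 2 := by positivity
  rw [(hasFDerivAt_powerFun μ hz).fderiv]
  refine (norm_add_le _ _).trans ?_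
  rw [ContinuousLinearMap.norm_smulRight_apply, norm_smul, norm_smul, norm_smul,
    innerSL_apply_norm, Real.norm_of_nonneg (by positivity), Real.norm_of_nonneg (by positivity),
    Real.norm_of_nonneg (by positivity)]
  have h1 : ‖ContinuousLinearMap.id ℝ ℂ‖ ≤ 1 := ContinuousLinearMap.norm_id_le
  have h2 : (‖z‖ ^ 2) ^ μ = (‖z‖ ^ 2) ^ (μ - 1) * ‖z‖ ^ 2 := by
    rw [← Real.rpow_add_one h0.ne', sub_add_cancel]
  calc (‖z‖ ^ 2) ^ μ * ‖ContinuousLinearMap.id ℝ ℂ‖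
        + μ * (‖z‖ ^ 2) ^ (μ - 1) * (2 * ‖z‖) * ‖z‖
      ≤ (‖z‖ ^ 2) ^ μ * 1 + 2 * μ * ((‖z‖ ^ 2) ^ (μ - 1) * ‖z‖ ^ 2) := by
        refine add_le_add (by gcongr) (le_of_eq (by ring))
    _ = _ := by rw [← h2]; ring

theorem hasFDerivAt_powerFun_zero (hμ : 0 < μ) :
    HasFDerivAt (powerFun μ) (0 : ℂ →L[ℝ] ℂ) 0 := by
  rw [hasFDerivAt_iff_isLittleO_nhds_zero]
  have h1 : Tendsto (fun z : ℂ => ‖z‖ ^ (2 * μ)) (𝓝 0) (𝓝 0) := by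
    have : Continuous fun z : ℂ => ‖z‖ ^ (2 * μ) :=
      continuous_norm.rpow_const fun _ => Or.inr (by positivity)
    simpa [Real.zero_rpow (by positivity : 2 * μ ≠ 0)] using this.tendsto 0
  have h2 := ((Asymptotics.isLittleO_one_iff ℝ).2 h1).mul_isBigO
    (Asymptotics.isBigO_refl (fun z : ℂ => ‖z‖) (𝓝 0))
  simp only [one_mul] at h2
  refine Asymptotics.IsLittleO.of_norm_left ?_
  refine (Asymptotics.isLittleO_norm_right.1 h2).congr_left fun z => ?_
  rw [zero_add, powerFun_zero, sub_zero, zero_apply, sub_zero, norm_powerFun]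

/-- Away from `0` the function is smooth. At `0` its derivative is `0`, and the bound `(1 +
2μ)|z|^{2μ}` for nearby derivatives gives continuity there. -/
theorem contDiff_powerFun (hμ : 0 < μ) : ContDiff ℝ 1 (powerFun μ) := by
  rw [contDiff_one_iff_fderiv]
  refine ⟨fun z => ?_, ?_⟩
  · rcases eq_or_ne z 0 with rfl | hz
    · exact (hasFDerivAt_powerFun_zero hμ).differentiableAt
    · exact (hasFDerivAt_powerFun μ hz).differentiableAt
  rw [continuous_iff_continuousAt]
  intro z
  rcases eq_or_ne z 0 with rfl | hz
  · rw [ContinuousAt, (hasFDerivAt_powerFun_zero hμ).fderiv, tendsto_zero_iff_norm_tendsto_zero]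
    have h1 : Tendsto (fun z : ℂ => (1 + 2 * μ) * (‖z‖ ^ 2) ^ μ) (𝓝 0) (𝓝 0) := by
      have : Continuous fun z : ℂ => (1 + 2 * μ) * (‖z‖ ^ 2) ^ μ :=
        continuous_const.mul ((continuous_norm.pow 2).rpow_const fun _ => Or.inr hμ.le)
      simpa [Real.zero_rpow hμ.ne'] using this.tendsto 0
    refine squeeze_zero (fun _ => norm_nonneg _) (fun z => ?_) h1
    rcases eq_or_ne z 0 with rfl | hz
    · rw [(hasFDerivAt_powerFun_zero hμ).fderiv, norm_zero]; positivity
    · exact norm_fderiv_powerFun_le hμ hz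
  · have h0 : ‖z‖ ^ 2 ≠ 0 := by positivity
    have hc : ContDiffAt ℝ 1 (powerFun μ) z := by
      refine ContDiffAt.congr_of_eventuallyEq ?_ (Eventually.of_forall fun w => powerFun_eq μ w)
      exact ((contDiff_norm_sq ℝ).contDiffAt.rpow_const_of_ne h0).smul contDiffAt_id
    exact (hc.fderiv_right (m := 0) le_rfl).continuousAt

/-- The function `z ↦ |z|^{2μ+2} / (2μ+2)`, whose gradient is `|z|^{2μ} z`. -/
noncomputable def potentialFun (μ : ℝ) (z : ℂ) : ℝ := ‖z‖ ^ (2 * μ + 2) / (2 * μ + 2)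

theorem potentialFun_zero (hμ : 0 < μ) : potentialFun μ 0 = 0 := by
  rw [potentialFun, norm_zero, Real.zero_rpow (by positivity), zero_div]

theorem hasFDerivAt_potentialFun (hμ : 0 < μ) (z : ℂ) :
    HasFDerivAt (potentialFun μ) (innerSL ℝ (powerFun μ z)) z := by
  have h := (hasFDerivAt_norm_rpow z (p := 2 * μ + 2) (by linarith)).const_mul (2 * μ + 2)⁻¹
  have h0 : 2 * μ + 2 ≠ 0 := by positivity
  refine (h.congr_of_eventuallyEq (Eventually.of_forall fun w => ?_)).congr_fderiv ?_
  · exact div_eq_inv_mul _ _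
  · ext w
    simp only [smul_apply, innerSL_apply_apply, smul_eq_mul]
    rw [← mul_assoc, inv_mul_cancel_left₀ h0, add_sub_cancel_right, powerFun, ← Complex.real_smul,
      real_inner_smul_left]

theorem potentialFun_le (hμ : 0 < μ) (z : ℂ) :
    potentialFun μ z ≤ (‖z‖ ^ 2) ^ μ * ‖z‖ ^ 2 := by
  have e : (‖z‖ ^ 2) ^ μ * ‖z‖ ^ 2 = ‖z‖ ^ (2 * μ + 2) := by
    rw [← Real.rpow_natCast, ← Real.rpow_mul (norm_nonneg z), ← Real.rpow_add_of_nonneg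
      (norm_nonneg z) (by positivity) (by positivity)]
    norm_num
  rw [e, potentialFun]
  exact div_le_self (by positivity) (by linarith)

namespace H1Half

/-- The composition lies in `L²`, so the default branch of `powerHalf` is never taken on `H¹(ℝ⁺)`.
-/
theorem fn_comp_powerFun (hμ : 0 < μ) (p : H1Half) :
    fn (comp (contDiff_powerFun hμ) powerFun_zero p) = powerHalf μ (fn p) := by
  have h1 : (fun x => ((‖fn p x‖ ^ (2 * μ) : ℝ) : ℂ) * fn p x)
      =ᵐ[halfLine] fn (comp (contDiff_powerFun hμ) powerFun_zero p) := by
    filter_upwards [fn_comp (contDiff_powerFun hμ) powerFun_zero p, fn_ae_eq_rep p] with x hx hx'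
    rw [hx, hx']
    rfl
  have h2 := (memLp_congr_ae h1).2 (Lp.memLp _)
  rw [powerHalf, dif_pos h2]
  exact Lp.ext (h1.symm.trans h2.coeFn_toLp.symm)

/-- Gagliardo–Nirenberg: `2μ` powers are estimated by the interpolated supremum bound, and the
remaining two are integrated. -/
theorem integral_potentialFun_le (hμ : 0 < μ) (p : H1Half) :
    ∫ x, potentialFun μ (rep p x) ∂halfLine ≤ (4 * (‖fn p‖ * ‖p‖)) ^ μ * ‖fn p‖ ^ 2 := by
  rw [norm_sq_eq_integral, ← integral_const_mul]
  refine integral_mono_ae (integrable_potential (contDiff_powerFun hμ) powerFun_zero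
    (hasFDerivAt_potentialFun hμ) (potentialFun_zero hμ) p)
    ((integrable_norm_sq _).const_mul _) ?_
  filter_upwards [fn_ae_eq_rep p, ae_restrict_mem measurableSet_Ioi] with x hx hx0
  refine (potentialFun_le hμ _).trans ?_
  rw [hx]
  gcongr
  exact norm_rep_sq_le p (le_of_lt hx0)

end H1Half

end Power

/-! ## The energy space of the star graph -/

section Graph

local notation "⟪" x ", " y "⟫" => inner ℂ x y

open H1Half

variable {N : ℕ}

/-- The component of an element of the energy space on an edge. -/
abbrev edge (u : Energy N) (j : Fin N) : H1Half := (u : H1Graph N) j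

theorem exists_rep_edge_zero (u : Energy N) : ∃ c : ℂ, ∀ j, rep (edge u j) 0 = c :=
  mem_energySpace_iff.1 u.2

/-- The element of the energy space with given components. -/
def ofEdges (p : Fin N → H1Half) (h : ∃ c : ℂ, ∀ j, rep (p j) 0 = c) : Energy N :=
  ⟨WithLp.toLp 2 p, mem_energySpace_iff.2 h⟩

theorem toL2_apply (u : Energy N) (j : Fin N) : toL2 N u j = fn (edge u j) := rfl

/-- The weak derivative on the energy space. -/
noncomputable def derivL (N : ℕ) : Energy N →L[ℂ] L2Graph N :=
  (PiLp.continuousLinearEquiv 2 ℂ (fun _ : Fin N => L2Half)).symm.toContinuousLinearMap ∘L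
    ContinuousLinearMap.pi (fun j =>
      WithLp.sndL 2 ℂ L2Half L2Half ∘L H1Half.subtypeL ∘L
        PiLp.proj 2 (fun _ : Fin N => H1Half) j ∘L (energySpace N).subtypeL)

theorem derivL_apply (u : Energy N) (j : Fin N) : derivL N u j = dv (edge u j) := rfl

/-- The value at the vertex, for functions in the energy space. -/
noncomputable def vertexL (N : ℕ) [NeZero N] : Energy N →L[ℂ] ℂ :=
  evalL 0 le_rfl ∘L PiLp.proj 2 (fun _ : Fin N => H1Half) (0 : Fin N) ∘L (energySpace N).subtypeL

theorem rep_edge_zero [NeZero N] (u : Energy N) (j : Fin N) : rep (edge u j) 0 = vertexL N u := by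
  obtain ⟨c, hc⟩ := exists_rep_edge_zero u
  exact (hc j).trans (hc 0).symm

theorem inner_toL2_left (u : Energy N) (Θ : L2Graph N) :
    ⟪toL2 N u, Θ⟫ = ∑ j, ⟪fn (edge u j), Θ j⟫ := PiLp.inner_apply _ _

theorem norm_sq_energy (u : Energy N) : ‖u‖ ^ 2 = ∑ j, ‖edge u j‖ ^ 2 :=
  PiLp.norm_sq_eq_of_L2 (fun _ : Fin N => H1Half) (u : H1Graph N)

theorem norm_sq_toL2_add (u : Energy N) : ‖u‖ ^ 2 = ‖toL2 N u‖ ^ 2 + ‖derivL N u‖ ^ 2 := by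
  rw [norm_sq_energy, PiLp.norm_sq_eq_of_L2, PiLp.norm_sq_eq_of_L2, ← Finset.sum_add_distrib]
  exact Finset.sum_congr rfl fun j _ => norm_sq_eq _

theorem norm_edge_le (u : Energy N) (j : Fin N) : ‖edge u j‖ ≤ ‖u‖ :=
  PiLp.norm_apply_le (u : H1Graph N) j

theorem norm_le_sum_edge (u : Energy N) : ‖u‖ ≤ ∑ j, ‖edge u j‖ := by
  refine abs_le_of_sq_le_sq' ?_ (by positivity) |>.2
  rw [norm_sq_energy]
  exact Finset.sum_sq_le_sq_sum_of_nonneg fun _ _ => norm_nonneg _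

theorem norm_toL2_le_sum (Θ : L2Graph N) : ‖Θ‖ ≤ ∑ j, ‖Θ j‖ := by
  refine abs_le_of_sq_le_sq' ?_ (by positivity) |>.2
  rw [PiLp.norm_sq_eq_of_L2]
  exact Finset.sum_sq_le_sq_sum_of_nonneg fun _ _ => norm_nonneg _

theorem toL2_injective : Function.Injective (toL2 N) := by
  intro u v h
  refine Subtype.ext (PiLp.ext fun j => fn_injective ?_)
  exact congrArg (fun Θ : L2Graph N => Θ j) h

/-- The element of the energy space supported on one edge. -/
noncomputable def single (j : Fin N) (q : H1Half) (hq : rep q 0 = 0) : Energy N :=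
  ofEdges (fun k => if k = j then q else 0) ⟨0, fun k => by
    split_ifs
    · exact hq
    · exact map_zero (evalL 0 le_rfl)⟩

theorem edge_single (j k : Fin N) (q : H1Half) (hq : rep q 0 = 0) :
    edge (single j q hq) k = if k = j then q else 0 := rfl

theorem inner_toL2_single (Θ : L2Graph N) (j : Fin N) (q : H1Half) (hq : rep q 0 = 0) :
    ⟪Θ, toL2 N (single j q hq)⟫ = ⟪Θ j, fn q⟫ := by
  rw [PiLp.inner_apply, Finset.sum_eq_single j]
  · rw [toL2_apply, edge_single, if_pos rfl]
  · intro k _ hk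
    rw [toL2_apply, edge_single, if_neg hk]
    exact inner_zero_right _
  · simp

theorem inner_derivL_single (Θ : L2Graph N) (j : Fin N) (q : H1Half) (hq : rep q 0 = 0) :
    ⟪Θ, derivL N (single j q hq)⟫ = ⟪Θ j, dv q⟫ := by
  rw [PiLp.inner_apply, Finset.sum_eq_single j]
  · rw [derivL_apply, edge_single, if_pos rfl]
  · intro k _ hk
    rw [derivL_apply, edge_single, if_neg hk]
    exact inner_zero_right _
  · simp

/-- Elements supported on a single edge and vanishing at the vertex satisfy the continuity
condition, and they suffice to annihilate the orthogonal complement. -/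
theorem denseRange_toL2 : DenseRange (toL2 N) := by
  have h : (LinearMap.range (toL2 N : Energy N →ₗ[ℂ] L2Graph N))ᗮ = ⊥ := by
    rw [eq_bot_iff]
    intro Θ hΘ
    refine PiLp.ext fun j => eq_zero_of_inner_fn_eq_zero fun q hq => ?_
    have := (Submodule.mem_orthogonal' _ _).1 hΘ _ ⟨single j q hq, rfl⟩
    rw [← inner_conj_symm, ← inner_toL2_single (hq := hq)]
    exact (congrArg (starRingEnd ℂ) this).trans (map_zero _)
  have h' := Submodule.topologicalClosure_eq_top_iff.2 h
  intro y
  have : y ∈ (LinearMap.range (toL2 N : Energy N →ₗ[ℂ] L2Graph N)).topologicalClosure := by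
    rw [h']; trivial
  exact this

/-! ## The form of the Hamiltonian -/

section Form

variable [NeZero N]

theorem norm_vertexL_sq_le (u : Energy N) {h : ℝ} (hh : 0 < h) :
    ‖vertexL N u‖ ^ 2 ≤ 2 * (h⁻¹ * ‖toL2 N u‖ ^ 2 + h * ‖derivL N u‖ ^ 2) := by
  refine (norm_rep_sq_le_add (edge u 0) le_rfl hh).trans ?_
  gcongr
  · exact PiLp.norm_apply_le (toL2 N u) 0
  · exact PiLp.norm_apply_le (derivL N u) 0

/-- The operator on the energy space representing the form
`∑ⱼ (uⱼ', vⱼ') + α u(0) v(0) + m (u, v)`. -/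
noncomputable def formOp (N : ℕ) [NeZero N] (α m : ℝ) : Energy N →L[ℂ] Energy N :=
  ContinuousLinearMap.adjoint (derivL N) ∘L derivL N +
    (α : ℂ) • (ContinuousLinearMap.adjoint (vertexL N) ∘L vertexL N) +
    (m : ℂ) • (ContinuousLinearMap.adjoint (toL2 N) ∘L toL2 N)

theorem inner_formOp_left (α m : ℝ) (u v : Energy N) :
    ⟪formOp N α m u, v⟫ = ⟪derivL N u, derivL N v⟫
      + α * ((starRingEnd ℂ) (vertexL N u) * vertexL N v) + m * ⟪toL2 N u, toL2 N v⟫ := by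
  simp only [formOp, add_apply, smul_apply, ContinuousLinearMap.comp_apply, inner_add_left,
    inner_smul_left, ContinuousLinearMap.adjoint_inner_left, Complex.conj_ofReal,
    RCLike.inner_apply]
  ring

/-- A shift making the form of the Hamiltonian coercive. -/
noncomputable def formShift (α : ℝ) : ℝ := 8 * |α| * (|α| + 1) + 1 / 2

theorem isCoerciveForm_formOp (α : ℝ) : IsCoerciveForm (formOp N α (formShift α)) := by
  refine ⟨fun u v => ?_, 1 / 2, by norm_num, fun u => ?_⟩
  · rw [← inner_conj_symm u, inner_formOp_left, inner_formOp_left]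
    simp only [map_add, map_mul, Complex.conj_ofReal, inner_conj_symm, Complex.conj_conj]
    ring
  · have e : (⟪formOp N α (formShift α) u, u⟫).re = ‖derivL N u‖ ^ 2 + α * ‖vertexL N u‖ ^ 2
        + formShift α * ‖toL2 N u‖ ^ 2 := by
      have h : ∀ y : L2Graph N, (⟪y, y⟫).re = ‖y‖ ^ 2 := fun y => inner_self_eq_norm_sq (𝕜 := ℂ) y
      rw [inner_formOp_left, Complex.add_re, Complex.add_re, Complex.re_ofReal_mul,
        Complex.re_ofReal_mul, ← Complex.normSq_eq_conj_mul_self, Complex.ofReal_re,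
        Complex.normSq_eq_norm_sq, h, h]
    have hpos : 0 < 4 * (|α| + 1) := by positivity
    -- With `h = 1 / (4(|α| + 1))` the vertex term costs at most half of the derivative term. Its
    -- `L²` part has coefficient `8|α|(|α| + 1)`, which `formShift` covers with `1/2` to spare.
    have h1 := norm_vertexL_sq_le u (inv_pos.2 hpos)
    rw [inv_inv] at h1
    have h2 : -(|α| * ‖vertexL N u‖ ^ 2) ≤ α * ‖vertexL N u‖ ^ 2 := by
      rw [← neg_mul]
      gcongr
      exact neg_abs_le α
    have h3 : |α| * (4 * (|α| + 1))⁻¹ ≤ 1 / 4 := by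
      rw [← div_eq_mul_inv, div_le_iff₀ hpos]; linarith
    have h4 : |α| * ‖vertexL N u‖ ^ 2 ≤ 8 * |α| * (|α| + 1) * ‖toL2 N u‖ ^ 2
        + 1 / 2 * ‖derivL N u‖ ^ 2 := by
      calc |α| * ‖vertexL N u‖ ^ 2 ≤ |α| * (2 * (4 * (|α| + 1) * ‖toL2 N u‖ ^ 2
            + (4 * (|α| + 1))⁻¹ * ‖derivL N u‖ ^ 2)) := by gcongr
        _ = 8 * |α| * (|α| + 1) * ‖toL2 N u‖ ^ 2
            + 2 * (|α| * (4 * (|α| + 1))⁻¹) * ‖derivL N u‖ ^ 2 := by ring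
        _ ≤ 8 * |α| * (|α| + 1) * ‖toL2 N u‖ ^ 2 + 2 * (1 / 4) * ‖derivL N u‖ ^ 2 := by gcongr
        _ = _ := by ring
    rw [e, norm_sq_toL2_add, formShift]
    linarith

/-- Integration by parts on each edge leaves the boundary term `∑ⱼ ψⱼ'(0)`, which the vertex
condition turns into the `α` term. Conversely, test elements on one edge vanishing at the vertex
identify the second derivative, and one with vertex value `1` recovers the vertex condition. -/
theorem hamiltonianGraph_iff (α : ℝ) (Ψ Θ : L2Graph N) : HamiltonianGraph N α Ψ Θ ↔
    ∃ u : Energy N, toL2 N u = Ψ ∧ ∀ v, ⟪derivL N u, derivL N v⟫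
      + α * ((starRingEnd ℂ) (vertexL N u) * vertexL N v) = ⟪Θ, toL2 N v⟫ := by
  constructor
  · rintro ⟨Ψ', Ψ'', c, d, h1, h2, h3, h4, h5, rfl⟩
    let p : Fin N → H1Half := fun j => mk (Ψ j) (Ψ' j) (h1 j)
    let w : Fin N → H1Half := fun j => mk (Ψ' j) (Ψ'' j) (h2 j)
    have hp : ∀ j, rep (p j) 0 = c := fun j => (hasBoundaryValue_iff (p j)).1 (h3 j)
    have hw : ∀ j, rep (w j) 0 = d j := fun j => (hasBoundaryValue_iff (w j)).1 (h4 j)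
    refine ⟨ofEdges p ⟨c, hp⟩, PiLp.ext fun j => rfl, fun v => ?_⟩
    have hc : vertexL N (ofEdges p ⟨c, hp⟩) = c := hp 0
    have key : ∀ j, ⟪Ψ' j, dv (edge v j)⟫
        = ⟪-Ψ'' j, fn (edge v j)⟫ - (starRingEnd ℂ) (d j) * vertexL N v := fun j => by
      have := inner_dv_add_inner_fn (w j) (edge v j)
      rw [hw, rep_edge_zero] at this
      rw [inner_neg_left, ← sub_eq_zero]
      change ⟪Ψ'' j, fn (edge v j)⟫ + ⟪Ψ' j, dv (edge v j)⟫ = _ at this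
      linear_combination this
    have e1 : ⟪derivL N (ofEdges p ⟨c, hp⟩), derivL N v⟫ = ∑ j, ⟪Ψ' j, dv (edge v j)⟫ :=
      PiLp.inner_apply _ _
    have e2 : ⟪-Ψ'', toL2 N v⟫ = ∑ j, ⟪-Ψ'' j, fn (edge v j)⟫ := PiLp.inner_apply _ _
    rw [e1, e2, Finset.sum_congr rfl fun j _ => key j, Finset.sum_sub_distrib, ← Finset.sum_mul,
      ← map_sum, h5, hc, map_mul, Complex.conj_ofReal]
    ring
  · rintro ⟨u, rfl, hu⟩
    have hwd : ∀ j, IsWeakDeriv (dv (edge u j)) (-Θ j) := fun j => by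
      refine isWeakDeriv_of_inner fun q hq => ?_
      have h1 := hu (single j q hq)
      have h2 : vertexL N (single j q hq) = 0 := by
        rw [← rep_edge_zero _ j, edge_single, if_pos rfl, hq]
      rw [h2, mul_zero, mul_zero, add_zero, inner_derivL_single, inner_toL2_single] at h1
      rw [inner_neg_right, neg_neg, ← inner_conj_symm, ← inner_conj_symm (fn q)]
      exact congrArg (starRingEnd ℂ) h1
    let w : Fin N → H1Half := fun j => mk (dv (edge u j)) (-Θ j) (hwd j)
    refine ⟨derivL N u, -Θ, vertexL N u, fun j => rep (w j) 0, fun j => (edge u j).2, hwd,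
      fun j => (hasBoundaryValue_iff (edge u j)).2 (rep_edge_zero u j),
      fun j => (hasBoundaryValue_iff (w j)).2 rfl, ?_, (neg_neg Θ).symm⟩
    -- The same profile with value `1` at the vertex is placed on every edge, so the boundary terms
    -- add up to `∑ⱼ ψⱼ'(0)`.
    obtain ⟨p, hp⟩ := exists_rep_zero_eq_one
    have h1 := hu (ofEdges (fun _ => p) ⟨1, fun _ => hp⟩)
    have h2 : vertexL N (ofEdges (fun _ => p) ⟨1, fun _ => hp⟩) = 1 := hp
    have e1 : ⟪derivL N u, derivL N (ofEdges (fun _ => p) ⟨1, fun _ => hp⟩)⟫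
        = ∑ j, ⟪dv (edge u j), dv p⟫ := PiLp.inner_apply _ _
    have e2 : ⟪Θ, toL2 N (ofEdges (fun _ => p) ⟨1, fun _ => hp⟩)⟫ = ∑ j, ⟪Θ j, fn p⟫ :=
      PiLp.inner_apply _ _
    have key : ∀ j, (starRingEnd ℂ) (rep (w j) 0) = ⟪Θ j, fn p⟫ - ⟪dv (edge u j), dv p⟫ :=
      fun j => by
        have := inner_dv_add_inner_fn (w j) p
        change ⟪-Θ j, fn p⟫ + ⟪dv (edge u j), dv p⟫ = _ at this
        rw [hp, inner_neg_left] at this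
        linear_combination this
    rw [h2, e1, e2] at h1
    have h3 : (starRingEnd ℂ) (∑ j, rep (w j) 0) = (starRingEnd ℂ) (α * vertexL N u) := by
      rw [map_sum, Finset.sum_congr rfl fun j _ => key j, Finset.sum_sub_distrib, ← h1, map_mul,
        Complex.conj_ofReal]
      ring
    exact (starRingEnd ℂ).injective h3

/-- The Hamiltonian is the operator associated with its form. -/
theorem hamiltonianGraph_iff_eq {α m : ℝ} (hB : IsCoerciveForm (formOp N α m))
    {S : L2Graph N →L[ℂ] Energy N} (hS : ∀ y v, ⟪formOp N α m (S y), v⟫ = ⟪y, toL2 N v⟫)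
    (Ψ Θ : L2Graph N) : HamiltonianGraph N α Ψ Θ ↔ Ψ = toL2 N (S (Θ + (m : ℂ) • Ψ)) := by
  rw [hamiltonianGraph_iff]
  constructor
  · rintro ⟨u, rfl, hu⟩
    congr 1
    refine hB.bijective.1 (ext_inner_right ℂ fun v => ?_)
    rw [hS, inner_formOp_left, hu, inner_add_left, inner_smul_left, Complex.conj_ofReal]
  · intro h
    refine ⟨S (Θ + (m : ℂ) • Ψ), h.symm, fun v => ?_⟩
    have h1 := hS (Θ + (m : ℂ) • Ψ) v
    rw [inner_formOp_left, ← h, inner_add_left, inner_smul_left, Complex.conj_ofReal] at h1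
    exact add_right_cancel h1

end Form

end Graph

/-! ## The nonlinearity on the energy space -/

section GraphNonlinearity

local notation "⟪" x ", " y "⟫" => inner ℂ x y

open H1Half

variable {N : ℕ} {μ : ℝ}

/-- The nonlinear term `|Ψ|^{2μ} Ψ` as an element of the energy space. -/
noncomputable def energyPower (hμ : 0 < μ) (u : Energy N) : Energy N :=
  ofEdges (fun j => comp (contDiff_powerFun hμ) powerFun_zero (edge u j)) <| by
    obtain ⟨c, hc⟩ := exists_rep_edge_zero u
    exact ⟨powerFun μ c, fun j => by rw [rep_comp _ _ _ le_rfl, hc j]⟩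

theorem edge_energyPower (hμ : 0 < μ) (u : Energy N) (j : Fin N) :
    edge (energyPower hμ u) j = comp (contDiff_powerFun hμ) powerFun_zero (edge u j) := rfl

theorem toL2_energyPower (hμ : 0 < μ) (u : Energy N) :
    toL2 N (energyPower hμ u) = power N μ (toL2 N u) :=
  PiLp.ext fun j => fn_comp_powerFun hμ (edge u j)

theorem norm_fn_edge_le (u : Energy N) (j : Fin N) : ‖fn (edge u j)‖ ≤ ‖toL2 N u‖ :=
  PiLp.norm_apply_le (toL2 N u) j

theorem norm_fn_edge_sub_le (u v : Energy N) (j : Fin N) :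
    ‖fn (edge u j) - fn (edge v j)‖ ≤ ‖toL2 N u - toL2 N v‖ :=
  PiLp.norm_apply_le (toL2 N u - toL2 N v) j

/-- Convergence in `E` implies weak closeness, so the error `ε` may be taken arbitrarily small. -/
theorem continuous_of_almostLipschitz {E Y : Type*} [NormedAddCommGroup E] [NormedSpace ℂ E]
    [NormedAddCommGroup Y] [NormedSpace ℂ Y] {J : E →L[ℂ] Y} {F : E → E}
    (h : ∀ M : ℝ, ∃ L : ℝ, ∀ ε > 0, ∃ δ > 0, ∀ u v : E, ‖u‖ ≤ M → ‖v‖ ≤ M → ‖J u - J v‖ ≤ δ →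
      ‖F u - F v‖ ≤ L * ‖u - v‖ + ε) : Continuous F := by
  rw [continuous_iff_continuousAt]
  intro u
  obtain ⟨L, hL⟩ := h (‖u‖ + 1)
  rw [ContinuousAt, tendsto_iff_norm_sub_tendsto_zero, Metric.tendsto_nhds]
  intro ε hε
  obtain ⟨δ, hδ, h⟩ := hL (ε / 2) (by positivity)
  have h1 : Tendsto (fun v : E => ‖v - u‖) (𝓝 u) (𝓝 0) :=
    tendsto_iff_norm_sub_tendsto_zero.1 tendsto_id
  have h2 : Tendsto (fun v : E => L * ‖v - u‖ + ε / 2) (𝓝 u) (𝓝 (ε / 2)) := by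
    simpa using (h1.const_mul L).add_const (ε / 2)
  have h3 : Tendsto (fun v : E => ‖J v - J u‖) (𝓝 u) (𝓝 0) :=
    tendsto_iff_norm_sub_tendsto_zero.1 (J.continuous.tendsto u)
  filter_upwards [h3.eventually_lt_const hδ, h1.eventually_lt_const one_pos,
    h2.eventually_lt_const (half_lt_self hε)] with v v1 v2 v3
  rw [dist_zero_right, norm_norm]
  refine (h v u ?_ (by linarith) v1.le).trans_lt v3
  linarith [norm_le_norm_add_norm_sub' v u]

theorem isAdmissible_energyPower (hμ : 0 < μ) :
    IsAdmissibleNonlinearity (toL2 N) (energyPower (N := N) hμ) := by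
  have hest := comp_estimates (contDiff_powerFun hμ) powerFun_zero
  have halmost : ∀ M : ℝ, ∃ L : ℝ, ∀ ε > 0, ∃ δ > 0, ∀ u v : Energy N, ‖u‖ ≤ M → ‖v‖ ≤ M →
      ‖toL2 N u - toL2 N v‖ ≤ δ →
      ‖energyPower hμ u - energyPower hμ v‖ ≤ L * ‖u - v‖ + ε := by
    intro M
    obtain ⟨K, hK, -, -, hc⟩ := hest M
    refine ⟨N * K, fun ε hε => ?_⟩
    -- The errors of the `N` edges add up to at most `ε`; `N + 1` avoids assuming `N ≠ 0`.
    obtain ⟨δ, hδ, h⟩ := hc (ε / (N + 1)) (by positivity)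
    refine ⟨δ, hδ, fun u v hu hv huv => ?_⟩
    have hj : ∀ j, ‖edge (energyPower hμ u - energyPower hμ v) j‖ ≤ K * ‖u - v‖ + ε / (N + 1) := by
      intro j
      refine (h (edge u j) (edge v j) ((norm_edge_le u j).trans hu) ((norm_edge_le v j).trans hv)
        ((norm_fn_edge_sub_le u v j).trans huv)).trans ?_
      gcongr
      exact norm_edge_le (u - v) j
    calc ‖energyPower hμ u - energyPower hμ v‖
        ≤ ∑ j, ‖edge (energyPower hμ u - energyPower hμ v) j‖ := norm_le_sum_edge _
      _ ≤ ∑ _j : Fin N, (K * ‖u - v‖ + ε / (N + 1)) := Finset.sum_le_sum fun j _ => hj j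
      _ = N * K * ‖u - v‖ + ε * (N / (N + 1)) := by
          rw [Finset.sum_const, Finset.card_univ, Fintype.card_fin, nsmul_eq_mul]; ring
      _ ≤ N * K * ‖u - v‖ + ε * 1 := by
          gcongr
          rw [div_le_one (by positivity)]; linarith
      _ = _ := by rw [mul_one]
  have hcont : Continuous (energyPower (N := N) hμ) := continuous_of_almostLipschitz halmost
  refine ⟨hcont.comp continuous_snd, fun M => ?_, fun M => ?_, fun M => ?_⟩
  · obtain ⟨K, hK, -, hb, -⟩ := hest M
    refine ⟨N * K, fun _ u hu => ?_⟩
    calc ‖energyPower hμ u‖ ≤ ∑ j, ‖edge (energyPower hμ u) j‖ := norm_le_sum_edge _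
      _ ≤ ∑ _j : Fin N, K := Finset.sum_le_sum fun j _ => hb _ ((norm_edge_le u j).trans hu)
      _ = N * K := by rw [Finset.sum_const, Finset.card_univ, Fintype.card_fin, nsmul_eq_mul]
  · obtain ⟨K, hK, hl, -, -⟩ := hest M
    refine ⟨N * K, fun _ u v hu hv => ?_⟩
    change ‖toL2 N (energyPower hμ u) - toL2 N (energyPower hμ v)‖ ≤ N * K * ‖toL2 N u - toL2 N v‖
    have hj : ∀ j, ‖(toL2 N (energyPower hμ u) - toL2 N (energyPower hμ v)) j‖
        ≤ K * ‖toL2 N u - toL2 N v‖ := by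
      intro j
      refine (hl (edge u j) (edge v j) ((norm_edge_le u j).trans hu)
        ((norm_edge_le v j).trans hv)).trans ?_
      gcongr
      exact norm_fn_edge_sub_le u v j
    refine (norm_toL2_le_sum _).trans ((Finset.sum_le_sum fun j _ => hj j).trans (le_of_eq ?_))
    rw [Finset.sum_const, Finset.card_univ, Fintype.card_fin, nsmul_eq_mul]; ring
  · obtain ⟨L, hL⟩ := halmost M
    refine ⟨L, fun ε hε => ?_⟩
    obtain ⟨δ, hδ, h⟩ := hL ε hε
    exact ⟨δ, hδ, fun _ u v hu hv huv => h u v hu hv huv⟩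

/-- Gauge invariance: the integrand is `|ψⱼ|^{2μ} |ψⱼ|²`, which is real. -/
theorem inner_energyPower_im (hμ : 0 < μ) (u : Energy N) :
    (⟪toL2 N u, toL2 N (energyPower hμ u)⟫).im = 0 := by
  rw [← Complex.conj_eq_iff_im, inner_conj_symm, PiLp.inner_apply, PiLp.inner_apply]
  refine Finset.sum_congr rfl fun j _ => ?_
  rw [L2.inner_def, L2.inner_def]
  refine integral_congr_ae ?_
  filter_upwards [fn_comp (contDiff_powerFun hμ) powerFun_zero (edge u j),
    fn_ae_eq_rep (edge u j)] with x h1 h2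
  rw [toL2_apply, toL2_apply, edge_energyPower, h1, h2, RCLike.inner_apply, RCLike.inner_apply,
    powerFun, map_mul, Complex.conj_ofReal]
  ring

/-- The potential energy `∑ⱼ ∫ |ψⱼ|^{2μ+2} / (2μ+2)`. -/
noncomputable def potentialEnergy (μ : ℝ) (u : Energy N) : ℝ :=
  ∑ j, ∫ x, potentialFun μ (rep (edge u j) x) ∂halfLine

theorem isPotential_potentialEnergy (hμ : 0 < μ) :
    IsPotential (toL2 N) (energyPower hμ) (potentialEnergy (N := N) μ) := by
  intro M
  obtain ⟨L, hL, h⟩ := potential_estimate (contDiff_powerFun hμ) powerFun_zero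
    (hasFDerivAt_potentialFun hμ) (potentialFun_zero hμ) M
  refine ⟨L, fun u v hu hv => ?_⟩
  rw [inner_toL2_left, PiLp.norm_sq_eq_of_L2, potentialEnergy, potentialEnergy,
    ← Finset.sum_sub_distrib, Complex.re_sum, ← Finset.sum_sub_distrib, Finset.mul_sum]
  exact (Finset.abs_sum_le_sum_abs _ _).trans (Finset.sum_le_sum fun j _ =>
    h (edge u j) (edge v j) ((norm_edge_le u j).trans hu) ((norm_edge_le v j).trans hv))

theorem potentialEnergy_le (hμ : 0 < μ) (u : Energy N) :
    potentialEnergy μ u ≤ N * (4 * ‖toL2 N u‖) ^ μ * ‖toL2 N u‖ ^ 2 * ‖u‖ ^ μ := by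
  have hj : ∀ j, ∫ x, potentialFun μ (rep (edge u j) x) ∂halfLine
      ≤ (4 * ‖toL2 N u‖) ^ μ * ‖toL2 N u‖ ^ 2 * ‖u‖ ^ μ := by
    intro j
    refine (integral_potentialFun_le hμ (edge u j)).trans ?_
    calc (4 * (‖fn (edge u j)‖ * ‖edge u j‖)) ^ μ * ‖fn (edge u j)‖ ^ 2
        ≤ (4 * (‖toL2 N u‖ * ‖u‖)) ^ μ * ‖toL2 N u‖ ^ 2 := by
          gcongr
          · exact norm_fn_edge_le u j
          · exact norm_edge_le u j
          · exact norm_fn_edge_le u j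
      _ = _ := by
          rw [← mul_assoc, Real.mul_rpow (by positivity) (norm_nonneg _)]; ring
  refine (Finset.sum_le_sum fun j _ => hj j).trans (le_of_eq ?_)
  rw [Finset.sum_const, Finset.card_univ, Fintype.card_fin, nsmul_eq_mul]
  ring

/-- Factoring out `x²` leaves `c - C x^{μ-2}`, which tends to `c > 0`; here subcriticality enters.
-/
theorem exists_bound_of_sq_le {c C K : ℝ} (hc : 0 < c) (hμ2 : μ < 2) :
    ∃ R : ℝ, ∀ x : ℝ, c * x ^ 2 ≤ K + C * x ^ μ → x ≤ R := by
  have h1 : Tendsto (fun x : ℝ => x ^ (2 : ℝ) * (c - C * x ^ (-(2 - μ)))) atTop atTop := by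
    refine (tendsto_rpow_atTop two_pos).atTop_mul_pos (C := c) hc ?_
    simpa using (tendsto_const_nhds (x := c)).sub
      ((tendsto_rpow_neg_atTop (by linarith : 0 < 2 - μ)).const_mul C)
  obtain ⟨R, hR⟩ := ((h1.eventually_gt_atTop K).and (eventually_gt_atTop 0)).exists_forall_of_atTop
  refine ⟨R, fun x hx => ?_⟩
  by_contra! hlt
  obtain ⟨h2, hx0⟩ := hR x hlt.le
  have h3 : x ^ (2 : ℝ) * x ^ (-(2 - μ)) = x ^ μ := by
    rw [← Real.rpow_add hx0]; ring_nf
  have h4 : x ^ (2 : ℝ) = x ^ 2 := Real.rpow_two x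
  have h5 : x ^ (2 : ℝ) * (c - C * x ^ (-(2 - μ))) = c * x ^ 2 - C * x ^ μ := by
    rw [← h3, ← h4]; ring
  linarith

/-- In the subcritical case mass and energy control the norm. -/
theorem exists_norm_bound [NeZero N] {B : Energy N →L[ℂ] Energy N} (hB : IsCoerciveForm B)
    (hμ : 0 < μ) (hμ2 : μ < 2) (M K : ℝ) : ∃ R, ∀ u : Energy N, ‖toL2 N u‖ = M →
      (⟪B u, u⟫).re - 2 * potentialEnergy μ u = K → ‖u‖ ≤ R := by
  obtain ⟨c, hc, h⟩ := hB.coercive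
  obtain ⟨R, hR⟩ := exists_bound_of_sq_le (K := K) (C := 2 * (N * (4 * M) ^ μ * M ^ 2)) hc hμ2
  refine ⟨R, fun u hM hK => hR _ ?_⟩
  have h1 := potentialEnergy_le hμ u
  rw [hM] at h1
  linarith [h u]

end GraphNonlinearity

/-! ## The unitary group of the Hamiltonian -/

section Propagator

local notation "⟪" x ", " y "⟫" => inner ℂ x y

/-- The functional `⟨JΨ, J·⟩` equals `⟨B S J Ψ, ·⟩`, so it is the image of the `C¹` function `S J Ψ`
under a continuous real-linear map. That map is only conjugate-linear over `ℂ`. -/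
theorem IsMildSolution.contDiffOn_dual {E Y : Type*} [NormedAddCommGroup E]
    [InnerProductSpace ℂ E] [CompleteSpace E] [NormedAddCommGroup Y] [InnerProductSpace ℂ Y]
    [CompleteSpace Y] {J : E →L[ℂ] Y} {B : E →L[ℂ] E} {S : Y →L[ℂ] E} {m : ℝ}
    {U : ℝ → Y →L[ℂ] Y} {V : ℝ → E →L[ℂ] E} {F : E → E} (hU : IsFormGroup J B S m U)
    (hV : IsRestrictedGroup J B S m U V) (hF : IsAdmissibleNonlinearity J F) {Ψ₀ : E} {T : EReal}
    {Ψ : ℝ → E} (h : IsMildSolution J U F Ψ₀ T Ψ) :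
    ContDiffOn ℝ 1 (fun t => (innerSL ℂ (J (Ψ t))) ∘L J) (timeInterval T) := by
  let f : E →+ StrongDual ℂ E :=
    { toFun := fun w => innerSL ℂ (B w)
      map_zero' := by rw [_root_.map_zero, _root_.map_zero]
      map_add' := fun v w => by rw [_root_.map_add, _root_.map_add] }
  have hf : Continuous f := (innerSL ℂ).continuous.comp B.continuous
  have h1 := (AddMonoidHom.toRealLinearMap f hf).contDiff.comp_contDiffOn
    (h.contDiffOn hU hV hF)
  refine h1.congr fun t _ => ContinuousLinearMap.ext fun v => ?_
  exact (hU.solution (J (Ψ t)) v).symm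

variable {N : ℕ} [NeZero N] {α m : ℝ} {S : L2Graph N →L[ℂ] Energy N}

/-- That the generator is no larger than `-iH` is seen by applying the resolvent `J S`, which
commutes with `U`, to an orbit differentiable at `0`: the two expressions for the derivative of `J S
U t Ψ` force `Ψ` into the range of `J S`. -/
theorem isUnitaryGroup_of_isFormGroup {U : ℝ → L2Graph N →L[ℂ] L2Graph N}
    (hU : IsFormGroup (toL2 N) (formOp N α m) S m U) : IsUnitaryGroup N α U := by
  refine ⟨hU.map_zero, hU.map_add, hU.norm_map, hU.continuous, fun Ψ Θ => ?_⟩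
  rw [hamiltonianGraph_iff_eq hU.form hU.solution]
  constructor
  · intro h
    have h1 := hU.hasDerivAt (Θ + (m : ℂ) • Ψ)
    rwa [← h, add_sub_cancel_right] at h1
  · intro h
    have h1 : HasDerivAt (fun t => toL2 N (S (U t Ψ))) (toL2 N (S (-(Complex.I • Θ)))) 0 :=
      ((toL2 N ∘L S).restrictScalars ℝ).hasFDerivAt.comp_hasDerivAt 0 h
    have h2 := hU.hasDerivAt Ψ
    simp only [hU.comm] at h2
    have h3 := h1.unique h2
    rw [map_neg, map_neg, neg_inj, map_smul, map_smul] at h3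
    have h4 := smul_right_injective _ Complex.I_ne_zero h3
    rw [map_add, map_add, h4, map_smul, map_smul, sub_add_cancel]

/-- The propagator is known only through its generator, so commutation with the resolvent has to be
recovered: `U t` maps differentiable orbits to differentiable orbits, hence preserves the domain and
commutes with `H`. -/
theorem isFormGroup_of_isUnitaryGroup (hB : IsCoerciveForm (formOp N α m))
    (hS : ∀ y v, ⟪formOp N α m (S y), v⟫ = ⟪y, toL2 N v⟫)
    {U : ℝ → L2Graph N →L[ℂ] L2Graph N} (hU : IsUnitaryGroup N α U) :
    IsFormGroup (toL2 N) (formOp N α m) S m U := by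
  have hder : ∀ y, HasDerivAt (fun t => U t (toL2 N (S y)))
      (-(Complex.I • (y - (m : ℂ) • toL2 N (S y)))) 0 := fun y => by
    rw [← hU.generator, hamiltonianGraph_iff_eq hB hS, sub_add_cancel]
  refine ⟨hB, toL2_injective, hS, hU.map_zero, hU.map_add, hU.norm_map, hU.continuous,
    fun t y => ?_, hder⟩
  have h1 : HasDerivAt (fun s => U t (U s (toL2 N (S y))))
      (U t (-(Complex.I • (y - (m : ℂ) • toL2 N (S y))))) 0 :=
    ((U t).restrictScalars ℝ).hasFDerivAt.comp_hasDerivAt 0 (hder y)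
  have h2 : ∀ s Φ, U t (U s Φ) = U s (U t Φ) := fun s Φ => by
    rw [← ContinuousLinearMap.comp_apply, ← hU.map_add, add_comm, hU.map_add,
      ContinuousLinearMap.comp_apply]
  simp only [h2] at h1
  rw [map_neg, map_smul, ← hU.generator, hamiltonianGraph_iff_eq hB hS, map_sub, map_smul,
    sub_add_cancel] at h1
  exact h1

theorem isUnitaryGroup_propagator (N : ℕ) [NeZero N] (α : ℝ) :
    IsUnitaryGroup N α (propagator N α) := by
  have hex : ∃ U, IsUnitaryGroup N α U := by
    have hB := isCoerciveForm_formOp (N := N) α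
    obtain ⟨S, hS⟩ := hB.exists_solution (toL2 N)
    obtain ⟨U, hU⟩ := hB.exists_formGroup toL2_injective denseRange_toL2 hS (formShift α)
    exact ⟨U, isUnitaryGroup_of_isFormGroup hU⟩
  rw [propagator, dif_pos hex]
  exact hex.choose_spec

variable {μ : ℝ}

theorem isSolution_iff_isMildSolution (α : ℝ) (hμ : 0 < μ) {Ψ₀ : Energy N} {T : EReal}
    {Ψ : ℝ → Energy N} : IsSolution N α μ Ψ₀ T Ψ ↔
      IsMildSolution (toL2 N) (propagator N α) (energyPower hμ) Ψ₀ T Ψ := by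
  constructor
  · intro h
    refine ⟨h.continuousOn, fun t ht => ?_⟩
    simp only [toL2_energyPower]
    exact h.duhamel t ht
  · intro h
    have hB := isCoerciveForm_formOp (N := N) α
    obtain ⟨S, hS⟩ := hB.exists_solution (toL2 N)
    have hU := isFormGroup_of_isUnitaryGroup hB hS (isUnitaryGroup_propagator N α)
    obtain ⟨V, hV⟩ := hU.exists_restricted
    refine ⟨h.continuousOn, h.contDiffOn_dual hU hV (isAdmissible_energyPower hμ), fun t ht => ?_⟩
    have := h.duhamel t ht
    simp only [toL2_energyPower] at this
    exact this

theorem exists_maximal_solution (α : ℝ) (hμ : 0 < μ) (Ψ₀ : Energy N) :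
    ∃ (Tstar : EReal) (Ψ : ℝ → Energy N), 0 < Tstar ∧ IsSolution N α μ Ψ₀ Tstar Ψ ∧
      (∀ (T : EReal) (Φ : ℝ → Energy N), IsSolution N α μ Ψ₀ T Φ →
        T ≤ Tstar ∧ EqOn Φ Ψ (timeInterval T)) ∧
      (Tstar = ⊤ ∨ ∃ τ : ℝ, Tstar = (τ : EReal) ∧
        Tendsto (fun t => ‖Ψ t‖) (𝓝[<] τ) atTop) := by
  have hB := isCoerciveForm_formOp (N := N) α
  obtain ⟨S, hS⟩ := hB.exists_solution (toL2 N)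
  have hU := isFormGroup_of_isUnitaryGroup hB hS (isUnitaryGroup_propagator N α)
  obtain ⟨V, hV⟩ := hU.exists_restricted
  simp only [isSolution_iff_isMildSolution α hμ]
  exact exists_maximal_mild hU hV (isAdmissible_energyPower hμ) Ψ₀

theorem exists_global_solution (α : ℝ) (hμ : 0 < μ) (hμ2 : μ < 2) (Ψ₀ : Energy N) :
    ∃ Ψ : ℝ → Energy N, IsSolution N α μ Ψ₀ ⊤ Ψ := by
  have hB := isCoerciveForm_formOp (N := N) α
  obtain ⟨S, hS⟩ := hB.exists_solution (toL2 N)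
  have hU := isFormGroup_of_isUnitaryGroup hB hS (isUnitaryGroup_propagator N α)
  obtain ⟨V, hV⟩ := hU.exists_restricted
  simp only [isSolution_iff_isMildSolution α hμ]
  exact exists_global_mild hU hV (isAdmissible_energyPower hμ) (isPotential_potentialEnergy hμ)
    (inner_energyPower_im hμ) (exists_norm_bound hB hμ hμ2) Ψ₀

end Propagator

end StarGraphNLS

open StarGraphNLS in
theorem proposition2p1 (N : ℕ) (hN : 1 ≤ N) (α μ : ℝ) (hμ : 0 < μ) :
    IsUnitaryGroup N α (propagator N α) ∧
    (∀ Ψ₀ : Energy N,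
      (∃ T : ℝ, 0 < T ∧ ∃ Ψ : ℝ → Energy N, IsSolution N α μ Ψ₀ T Ψ ∧
        ∀ Φ : ℝ → Energy N, IsSolution N α μ Ψ₀ T Φ → EqOn Φ Ψ (timeInterval T)) ∧
      (∃ (Tstar : EReal) (Ψmax : ℝ → Energy N), 0 < Tstar ∧ IsSolution N α μ Ψ₀ Tstar Ψmax ∧
        (∀ (T : EReal) (Φ : ℝ → Energy N), IsSolution N α μ Ψ₀ T Φ →
          0 < T → T ≤ Tstar ∧ EqOn Φ Ψmax (timeInterval T)) ∧
        (Tstar = ⊤ ∨ ∃ τ : ℝ, Tstar = (τ : EReal) ∧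
          Tendsto (fun t => ‖Ψmax t‖) (𝓝[<] τ) atTop))) ∧
    (μ < 2 → ∀ Ψ₀ : Energy N,
      ∃ Ψ : ℝ → Energy N, IsSolution N α μ Ψ₀ ⊤ Ψ ∧
        ∀ Φ : ℝ → Energy N, IsSolution N α μ Ψ₀ ⊤ Φ → EqOn Φ Ψ (timeInterval ⊤)) := by
  have : NeZero N := ⟨by omega⟩
  refine ⟨isUnitaryGroup_propagator N α, fun Ψ₀ => ?_, fun hμ2 Ψ₀ => ?_⟩
  · obtain ⟨Tstar, Ψ, hpos, hΨ, hmax, hblow⟩ := exists_maximal_solution α hμ Ψ₀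
    refine ⟨?_, Tstar, Ψ, hpos, hΨ, fun T Φ hΦ _ => hmax T Φ hΦ, hblow⟩
    -- Any real time below the maximal one serves, and uniqueness follows by comparison with the
    -- maximal solution.
    obtain ⟨T, hT0, hT⟩ := EReal.lt_iff_exists_real_btwn.1 hpos
    exact ⟨T, by exact_mod_cast hT0, Ψ, hΨ.mono hT.le, fun Φ hΦ => (hmax T Φ hΦ).2⟩
  · obtain ⟨Ψ, hΨ⟩ := exists_global_solution α hμ hμ2 Ψ₀
    obtain ⟨_, Ψmax, -, -, hmax, -⟩ := exists_maximal_solution α hμ Ψ₀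
    exact ⟨Ψ, hΨ, fun Φ hΦ => (hmax ⊤ Φ hΦ).2.trans (hmax ⊤ Ψ hΨ).2.symm⟩
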